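/- Conventions. All actions on metric spaces are by isometries. A \emph{segment} in a metric space is the image of an isometric embedding of some interval $[0,\lambda]$, $\lambda\ge 0$. A \emph{real tree} is a metric space in which any two points are joined by a segment, such that two segments meeting in exactly one point, which is an endpoint of both, have a segment as their union, and the intersection of two segments with a common endpoint is a segment. The \emph{valence} of a point $x$ of a real tree $T$ is the number of geodesic-connected components of $T\setminus\{x\}$. The \emph{universal real tree with valence} $\kappa$ is the (unique up to isometry) non-empty complete real tree all of whose points have valence $\kappa$. Given metric spaces $\mathcal T=(T_n,d_n)_{n\in N}$ and $z\in\prod_{n}T_n$, the \emph{$\ell^1$ product} $\ell^1(\mathcal T,z)$ is $\{x\in\prod_n T_n:\sum_n d_n(x_n,z_n)<\infty\}$ with the metric $d(x,y)=\sum_n d_n(x_n,y_n)$. Let $N$ be $\mathbb N$ or $\{1,\dots,n\}$ for some $n\in\mathbb N$, and let $\mathbf R=\ell^1(N)$ be the real $\ell^1$ space, with its additive group structure and the $\ell^1$ norm. A \emph{maximal flat} in a metric space $X$ is a subset $F\subseteq X$ that is the image of an isometric embedding $\mathbf R\to X$ and is not properly contained in another such subset. Let $\mathcal K$ be the set of cardinals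 $\kappa\le 2^{\aleph_0}$, let $\mathrm{Sub}_D(\mathbf R)$ be the set of dense subgroups of $\mathbf R$, and let $\overline{\mathrm{Sub}}_D(\mathbf R)$ be its quotient by the relation $H\sim K$ if and only if $A(H)=K$ for some surjective linear isometry $A$ of $\mathbf R$; write $[H]$ for the class of $H$. Theorem. Let $\iota:\overline{\mathrm{Sub}}_D(\mathbf R)\to\mathcal K$ be a map that is non-zero on at most $2^{\aleph_0}$ classes, and let $\eta:N\to\{0,1\}$ be a map that is not identically zero. For each $n\in N$ let $T_n$ be the universal real tree with valence $2^{\aleph_0}$ if $\eta(n)=1$, and let $T_n$ be (isometric to) $\mathbb R$ if $\eta(n)=0$. Let $\mathcal T=(T_n)_{n\in N}$. Then, for some $z\in\prod_{n\in N}T_n$, there is a group $G$ acting freely and transitively on $\ell^1(\mathcal T,z)$ such that for every $H\in\mathrm{Sub}_D(\mathbf R)$ the following holds. Let $A_H$ be the set of $G$-orbits of maximal flats $F\subseteq\ell^1(\mathcal T,z)$ for which the action of the setwise stabiliser $\mathrm{Stab}_G(F)$ on $F$ is isomorphic to the action of $H$ on $\mathbf R$ by translations, i.e. there are an isometry $\varphi$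 from $\mathbf R$ onto $F$ and a group isomorphism $\psi:\mathrm{Stab}_G(F)\to H$ with $g\cdot\varphi(r)=\varphi(\psi(g)+r)$ for all $g\in\mathrm{Stab}_G(F)$ and $r\in\mathbf R$. Then $|A_H|=\iota([H])$. -/

import Mathlib

open scoped Pointwise Cardinal

/-- `IsSegment S x y`: the set `S` is a segment with endpoints `x` and `y`, i.e. the image of a
geodesic (an isometric embedding of an interval `[0, l]`, `0 ≤ l`) going from `x` to `y`. -/
def IsSegment {X : Type*} [MetricSpace X] (S : Set X) (x y : X) : Prop :=
  ∃ (l : ℝ) (γ : ℝ → X), 0 ≤ l ∧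
    (∀ s ∈ Set.Icc 0 l, ∀ t ∈ Set.Icc 0 l, dist (γ s) (γ t) = |s - t|) ∧
    γ 0 = x ∧ γ l = y ∧ γ '' Set.Icc 0 l = S

/-- Real trees: geodesic metric spaces in which two segments that meet in exactly one point, which
is an endpoint of both, have a segment as their union, and in which two segments with a common
endpoint intersect in a segment. -/
structure IsRealTree (X : Type*) [MetricSpace X] : Prop where
  geodesic : ∀ x y : X, ∃ S, IsSegment S x y
  union : ∀ (S S' : Set X) (x y z : X), IsSegment S x y → IsSegment S' y z →
    S ∩ S' = {y} → ∃ a b, IsSegment (S ∪ S') a b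
  inter : ∀ (S S' : Set X) (x y z : X), IsSegment S x y → IsSegment S' x z →
    ∃ a b, IsSegment (S ∩ S') a b

/-- The set of directions at `x`: the geodesic-connected components of `X - {x}`, that is, the
classes of points of `X - {x}` for the equivalence relation generated by being the endpoints of a
segment that avoids `x`. -/
def Directions {X : Type*} [MetricSpace X] (x : X) : Type _ :=
  Quot fun y z : {y : X // y ≠ x} => ∃ S : Set X, IsSegment S (y : X) (z : X) ∧ x ∉ S

/-- `X` is the universal real tree with valence `κ`: a (nonempty) complete real tree in which the
set of directions at every point has cardinality `κ`. -/
structure IsUniversalRealTree (X : Type*) [MetricSpace X] (κ : Cardinal) : Prop where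
  nonempty : Nonempty X
  complete : CompleteSpace X
  isRealTree : IsRealTree X
  valence : ∀ x : X, #(Directions x) = κ

/-- The `ℓ¹` product, based at `z`, of a family of metric spaces. -/
def L1Product {N : Type*} (T : N → Type*) [∀ n, MetricSpace (T n)] (z : ∀ n, T n) : Type _ :=
  {x : ∀ n, T n // Summable fun n => dist (x n) (z n)}

namespace L1Product

variable {N : Type*} {T : N → Type*} [∀ n, MetricSpace (T n)] {z : ∀ n, T n}

theorem summable_dist (x y : L1Product T z) : Summable fun n => dist (x.1 n) (y.1 n) :=
  Summable.of_nonneg_of_le (fun _ => dist_nonneg)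
    (fun n => dist_triangle_right (x.1 n) (y.1 n) (z n)) (x.2.add y.2)

/-- The `ℓ¹` metric `d(x, y) = ∑ d(xₙ, yₙ)`. -/
noncomputable instance : MetricSpace (L1Product T z) where
  dist x y := ∑' n, dist (x.1 n) (y.1 n)
  dist_self x := by simp
  dist_comm x y := by simp only [dist_comm]
  dist_triangle x y w := by
    rw [← (summable_dist x y).tsum_add (summable_dist y w)]
    exact (summable_dist x w).tsum_le_tsum (fun n => dist_triangle _ _ _)
      ((summable_dist x y).add (summable_dist y w))
  eq_of_dist_eq_zero {x y} h := by
    have h0 := (hasSum_zero_iff_of_nonneg (fun _ => dist_nonneg)).1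
      (h ▸ (summable_dist x y).hasSum)
    exact Subtype.ext (funext fun n => dist_eq_zero.1 (congrFun h0 n))

end L1Product

/-- The real Banach space `ℓ¹(N)`. -/
abbrev EllOne (N : Type*) : Type _ := lp (fun _ : N => ℝ) 1

/-- The set of dense subgroups of `ℓ¹(N)`. -/
abbrev DenseSubgroup (N : Type*) : Type _ :=
  {H : AddSubgroup (EllOne N) // Dense (H : Set (EllOne N))}

/-- Two dense subgroups of `ℓ¹(N)` are equivalent if a (surjective) linear isometry of `ℓ¹(N)`
maps the first onto the second. -/
instance denseSubgroupSetoid (N : Type*) : Setoid (DenseSubgroup N) where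
  r H K := ∃ A : EllOne N ≃ₗᵢ[ℝ] EllOne N, A '' (H.1 : Set (EllOne N)) = (K.1 : Set (EllOne N))
  iseqv :=
    { refl := fun _ => ⟨LinearIsometryEquiv.refl ℝ _, by simp⟩
      symm := by
        rintro H K ⟨A, hA⟩
        exact ⟨A.symm, by rw [← hA, ← Set.image_comp]; simp⟩
      trans := by
        rintro H K L ⟨A, hA⟩ ⟨B, hB⟩
        exact ⟨A.trans B, by rw [← hB, ← hA, ← Set.image_comp]; rfl⟩ }

/-- The set of classes of dense subgroups of `ℓ¹(N)` up to linear isometry of `ℓ¹(N)`. -/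
abbrev DenseSubgroupClass (N : Type*) : Type _ := Quotient (denseSubgroupSetoid N)

/-- An isometrically embedded copy of `ℓ¹(N)` in `X`. -/
def IsFlat (N : Type*) {X : Type*} [MetricSpace X] (F : Set X) : Prop :=
  ∃ φ : EllOne N → X, Isometry φ ∧ Set.range φ = F

/-- A maximal flat: a flat that is not properly contained in another flat. -/
def IsMaximalFlat (N : Type*) {X : Type*} [MetricSpace X] (F : Set X) : Prop :=
  Maximal (IsFlat N) F

/-- The action of the (setwise) stabiliser of `F` in `G` on `F` is isomorphic to the action of the
subgroup `H` on `ℓ¹(N)` by translations: there are an isometry `φ` from `ℓ¹(N)` onto `F` and a group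
isomorphism `ψ` from the stabiliser to `H` for which `φ` is equivariant. -/
def StabiliserActsLike {N : Type*} {X : Type*} [MetricSpace X] (G : Type*) [Group G]
    [MulAction G X] (F : Set X) (H : AddSubgroup (EllOne N)) : Prop :=
  ∃ (φ : EllOne N → X) (ψ : MulAction.stabilizer G F ≃* Multiplicative H),
    Isometry φ ∧ Set.range φ = F ∧
      ∀ (g : MulAction.stabilizer G F) (r : EllOne N),
        (g : G) • φ r = φ (((ψ g).toAdd : EllOne N) + r)

/-- The set of `G`-orbits of maximal flats `F` of `X` such that the action of the stabiliser of `F`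
on `F` is isomorphic to the action of `H` on `ℓ¹(N)`. -/
def flatOrbits {N : Type*} (G X : Type*) [MetricSpace X] [Group G] [MulAction G X]
    (H : AddSubgroup (EllOne N)) : Set (Set (Set X)) :=
  {O | ∃ F : Set X, IsMaximalFlat N F ∧ StabiliserActsLike G F H ∧ O = MulAction.orbit G F}

/-!
Let `A` be a set of `2^ℵ₀` labels on which the group `R = ℓ¹(N)` acts. Consider paths in the space
of functions `Option A → ℝ` that move, on a dense open set of times, at unit speed in the coordinate
`none` (the height) and in one label coordinate. There are `2^ℵ₀` germs of such paths that do not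
backtrack, so by Zorn's lemma the universal tree `T` with valence `2^ℵ₀` has a developing map: it
sends segments to such paths and identifies the directions at each point with the germs. Reduced
paths lift uniquely along it. Hence symmetries of the class of paths, in particular translations
composed with relabellings by elements of `R`, lift to isometries of `T`; and through each point
there is for each label a line with this label. Conversely, a line along which a dense set of
translations is induced by such isometries carries a single label: by density the label near one
point propagates.

Given an action of `R` on the labels of every factor (a single label if the factor is the real
line), let `G` be the group of the families of lifts that translate heights and act on labels
through a common `r : R`. The heights of a point and of its image determine `r`, and then the image
determines the lift, so `G` acts freely and transitively. A maximal flat on which a dense group of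
translations acts is a product of lines, one in each factor, because a tree contains no rectangles;
by density each of these carries a single label. Its stabiliser is therefore the stabiliser in `R`
of the family of these labels, and `G`-orbits of such flats are `R`-orbits of families of labels. It
remains to choose the actions on the labels so that each dense subgroup occurs as a stabiliser, up
to linear isometry, with the multiplicity given by `ι`.
-/

/-! ### Segments -/

section Geodesics

variable {X Y : Type*} [MetricSpace X] [MetricSpace Y]

/-- Three points are aligned if one of them lies metrically between the other two. -/
def Aligned (x y z : X) : Prop :=
  dist x y + dist y z = dist x z ∨ dist y x + dist x z = dist y z ∨ dist x z + dist z y = dist x y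

/-- The map `f` preserves the relation that the second of three points lies metrically between the
other two. -/
def PreservesBetweenness (f : X → Y) : Prop :=
  ∀ x y z, dist x y + dist y z = dist x z → dist (f x) (f y) + dist (f y) (f z) = dist (f x) (f z)

namespace PreservesBetweenness

theorem of_isometry {f : X → Y} (hf : Isometry f) : PreservesBetweenness f := fun x y z h => by
  rwa [hf.dist_eq, hf.dist_eq, hf.dist_eq]

theorem comp {Z : Type*} [MetricSpace Z] {g : Y → Z} {f : X → Y} (hg : PreservesBetweenness g)
    (hf : PreservesBetweenness f) : PreservesBetweenness fun x => g (f x) :=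
  fun x y z h => hg _ _ _ (hf x y z h)

theorem aligned {f : X → Y} (hf : PreservesBetweenness f) {x y z : X} (h : Aligned x y z) :
    Aligned (f x) (f y) (f z) :=
  h.imp (hf _ _ _) (Or.imp (hf _ _ _) (hf _ _ _))

end PreservesBetweenness

theorem aligned_real (a b c : ℝ) : Aligned a b c := by
  simp only [Aligned, Real.dist_eq]
  grind

/-- `γ` restricts to an isometric embedding of `I`; its values outside `I` are arbitrary. -/
def IsGeodesicOn (γ : ℝ → X) (I : Set ℝ) : Prop :=
  ∀ s ∈ I, ∀ t ∈ I, dist (γ s) (γ t) = |s - t|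

namespace IsGeodesicOn

variable {γ : ℝ → X} {I J : Set ℝ} {a b : ℝ}

theorem mono (hγ : IsGeodesicOn γ J) (hIJ : I ⊆ J) : IsGeodesicOn γ I :=
  fun s hs t ht => hγ s (hIJ hs) t (hIJ ht)

theorem dist_of_le (hγ : IsGeodesicOn γ I) {s t : ℝ} (hs : s ∈ I) (ht : t ∈ I) (hst : s ≤ t) :
    dist (γ s) (γ t) = t - s := by
  rw [hγ s hs t ht, abs_sub_comm, abs_of_nonneg (sub_nonneg.2 hst)]

theorem continuousOn (hγ : IsGeodesicOn γ I) : ContinuousOn γ I := by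
  refine LipschitzOnWith.continuousOn (K := 1) (LipschitzOnWith.of_dist_le_mul fun s hs t ht => ?_)
  rw [hγ s hs t ht, NNReal.coe_one, one_mul, Real.dist_eq]

theorem isSegment (hγ : IsGeodesicOn γ (Set.Icc a b)) (hab : a ≤ b) :
    IsSegment (γ '' Set.Icc a b) (γ a) (γ b) := by
  refine ⟨b - a, fun s => γ (a + s), sub_nonneg.2 hab, fun s hs t ht => ?_, by simp, by simp, ?_⟩
  · rw [hγ _ ⟨by linarith [hs.1], by linarith [hs.2]⟩ _ ⟨by linarith [ht.1], by linarith [ht.2]⟩,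
      add_sub_add_left_eq_sub]
  · rw [← Set.image_image γ (fun s => a + s), Set.image_const_add_Icc, add_zero, add_sub_cancel]

end IsGeodesicOn

namespace IsSegment

variable {S U : Set X} {x y p q : X}

theorem exists_geodesic (hS : IsSegment S x y) : ∃ γ : ℝ → X,
    IsGeodesicOn γ (Set.Icc 0 (dist x y)) ∧ (∀ s ∈ Set.Icc 0 (dist x y), dist x (γ s) = s) ∧
      γ (dist x y) = y ∧ γ '' Set.Icc 0 (dist x y) = S := by
  obtain ⟨l, γ, hl, hγ, rfl, rfl, rfl⟩ := hS
  have hdist : ∀ s ∈ Set.Icc 0 l, dist (γ 0) (γ s) = s := fun s hs => by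
    rw [IsGeodesicOn.dist_of_le hγ ⟨le_rfl, hl⟩ hs hs.1, sub_zero]
  rw [hdist l ⟨hl, le_rfl⟩]
  exact ⟨γ, hγ, hdist, rfl, rfl⟩

theorem symm (hS : IsSegment S x y) : IsSegment S y x := by
  obtain ⟨l, γ, hl, hγ, h0, h1, rfl⟩ := hS
  refine ⟨l, fun s => γ (l - s), hl, fun s hs t ht => ?_, by simpa using h1, by simpa using h0, ?_⟩
  · rw [hγ _ ⟨by linarith [hs.2], by linarith [hs.1]⟩ _ ⟨by linarith [ht.2], by linarith [ht.1]⟩,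
      sub_sub_sub_cancel_left, abs_sub_comm]
  · rw [← Set.image_image γ (fun s => l - s), Set.image_const_sub_Icc, sub_self, sub_zero]

theorem left_mem (hS : IsSegment S x y) : x ∈ S := by
  obtain ⟨l, γ, hl, -, rfl, -, rfl⟩ := hS
  exact ⟨0, ⟨le_rfl, hl⟩, rfl⟩

theorem right_mem (hS : IsSegment S x y) : y ∈ S := hS.symm.left_mem

theorem isCompact (hS : IsSegment S x y) : IsCompact S := by
  obtain ⟨l, γ, -, hγ, -, -, rfl⟩ := hS
  exact isCompact_Icc.image_of_continuousOn (IsGeodesicOn.continuousOn hγ)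

theorem isPreconnected (hS : IsSegment S x y) : IsPreconnected S := by
  obtain ⟨l, γ, -, hγ, -, -, rfl⟩ := hS
  exact isPreconnected_Icc.image _ (IsGeodesicOn.continuousOn hγ)

theorem exists_mem_dist_eq (hS : IsSegment S x y) {t : ℝ} (h0 : 0 ≤ t) (ht : t ≤ dist x y) :
    ∃ p ∈ S, dist x p = t ∧ dist p y = dist x y - t := by
  obtain ⟨γ, hγ, hxγ, hγy, rfl⟩ := hS.exists_geodesic
  refine ⟨γ t, ⟨t, ⟨h0, ht⟩, rfl⟩, hxγ t ⟨h0, ht⟩, ?_⟩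
  nth_rw 1 [← hγy]
  exact hγ.dist_of_le ⟨h0, ht⟩ ⟨dist_nonneg, le_rfl⟩ ht

theorem exists_coordinate (hS : IsSegment S x y) :
    ∃ f : X → ℝ, ∀ p ∈ S, ∀ q ∈ S, dist p q = |f p - f q| := by
  obtain ⟨l, γ, -, hγ, -, -, rfl⟩ := hS
  choose! f hf using fun (p : X) (hp : p ∈ γ '' Set.Icc 0 l) => hp
  refine ⟨f, fun p hp q hq => ?_⟩
  rw [← hγ _ (hf p hp).1 _ (hf q hq).1, (hf p hp).2, (hf q hq).2]

theorem dist_add_of_mem (hS : IsSegment S x y) (hp : p ∈ S) :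
    dist x p + dist p y = dist x y := by
  obtain ⟨l, γ, hl, hγ, rfl, rfl, rfl⟩ := hS
  obtain ⟨s, hs, rfl⟩ := hp
  have hγ' : IsGeodesicOn γ (Set.Icc 0 l) := hγ
  rw [hγ'.dist_of_le ⟨le_rfl, hl⟩ hs hs.1, hγ'.dist_of_le hs ⟨hl, le_rfl⟩ hs.2,
    hγ'.dist_of_le ⟨le_rfl, hl⟩ ⟨hl, le_rfl⟩ hl]
  ring

theorem eq_of_dist_eq (hS : IsSegment S x y) (hp : p ∈ S) (hq : q ∈ S)
    (h : dist x p = dist x q) : p = q := by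
  obtain ⟨γ, -, hxγ, -, rfl⟩ := hS.exists_geodesic
  obtain ⟨s, hs, rfl⟩ := hp
  obtain ⟨t, ht, rfl⟩ := hq
  rw [hxγ s hs, hxγ t ht] at h
  rw [h]

theorem setOf_dist_le (hS : IsSegment S x y) (hp : p ∈ S) :
    IsSegment {q ∈ S | dist x p ≤ dist x q} p y := by
  obtain ⟨γ, hγ, hdist, hγy, rfl⟩ := hS.exists_geodesic
  obtain ⟨s, hs, rfl⟩ := hp
  have hset : {q ∈ γ '' Set.Icc 0 (dist x y) | dist x (γ s) ≤ dist x q} =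
      γ '' Set.Icc s (dist x y) := by
    ext q
    constructor
    · rintro ⟨⟨t, ht, rfl⟩, hst⟩
      rw [hdist s hs, hdist t ht] at hst
      exact ⟨t, ⟨hst, ht.2⟩, rfl⟩
    · rintro ⟨t, ht, rfl⟩
      have ht' : t ∈ Set.Icc 0 (dist x y) := ⟨hs.1.trans ht.1, ht.2⟩
      refine ⟨⟨t, ht', rfl⟩, ?_⟩
      rw [hdist s hs, hdist t ht']
      exact ht.1
  have hseg := (hγ.mono (Set.Icc_subset_Icc_left hs.1)).isSegment hs.2
  rwa [hγy, ← hset] at hseg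

theorem mem_of_dist_add {a b : X} (hS : IsSegment S x y) (hU : IsSegment U a b) (hSU : S ⊆ U)
    (hp : p ∈ U) (h : dist x p + dist p y = dist x y) : p ∈ S := by
  obtain ⟨q, hq, hxq, hqy⟩ := hS.exists_mem_dist_eq (t := dist x p) dist_nonneg
    (by linarith [dist_nonneg (x := p) (y := y)])
  obtain ⟨f, hf⟩ := hU.exists_coordinate
  have hx := hSU hS.left_mem
  have hy := hSU hS.right_mem
  suffices p = q from this ▸ hq
  rw [← dist_le_zero]
  rw [hf x hx p hp, hf p hp y hy, hf x hx y hy] at h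
  rw [hf x hx q (hSU hq), hf x hx p hp] at hxq
  rw [hf q (hSU hq) y hy, hf x hx y hy, hf x hx p hp] at hqy
  rw [hf p hp q (hSU hq)]
  grind

theorem aligned {a b c : X} (hS : IsSegment S x y) (ha : a ∈ S) (hb : b ∈ S) (hc : c ∈ S) :
    Aligned a b c := by
  obtain ⟨f, hf⟩ := hS.exists_coordinate
  unfold Aligned
  rw [hf a ha b hb, hf b hb c hc, hf a ha c hc, hf b hb a ha, hf c hc b hb]
  grind

end IsSegment

end Geodesics

/-! ### Gromov products -/

section GromovProduct

variable {X : Type*} [MetricSpace X]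

/-- The Gromov product `(y | z)ₓ`: in a tree, the length of the common part of the segments from
`x` to `y` and from `x` to `z`. -/
noncomputable def gromovProd (x y z : X) : ℝ := (dist x y + dist x z - dist y z) / 2

theorem gromovProd_comm (x y z : X) : gromovProd x y z = gromovProd x z y := by
  unfold gromovProd
  rw [dist_comm y z]
  ring

theorem gromovProd_nonneg (x y z : X) : 0 ≤ gromovProd x y z := by
  unfold gromovProd
  linarith [dist_triangle_left y z x]

theorem gromovProd_le_left (x y z : X) : gromovProd x y z ≤ dist x y := by
  unfold gromovProd
  linarith [dist_triangle x y z]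

theorem gromovProd_le_right (x y z : X) : gromovProd x y z ≤ dist x z :=
  gromovProd_comm x y z ▸ gromovProd_le_left x z y

end GromovProduct

namespace IsRealTree

variable {X : Type*} [MetricSpace X] {S S' : Set X} {x y z p : X}

theorem dist_add_of_inter_eq (hX : IsRealTree X) (hS : IsSegment S x y) (hS' : IsSegment S' y z)
    (h : S ∩ S' = {y}) : dist x y + dist y z = dist x z := by
  obtain ⟨a, b, hU⟩ := hX.union S S' x y z hS hS' h
  have hx : x ∈ S ∪ S' := Or.inl hS.left_mem
  have hz : z ∈ S ∪ S' := Or.inr hS'.right_mem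
  rcases hU.aligned hx (Or.inl hS.right_mem) hz with hxyz | hyxz | hxzy
  · exact hxyz
  · have hx' : x ∈ S ∩ S' := ⟨hS.left_mem, hS'.mem_of_dist_add hU Set.subset_union_right hx hyxz⟩
    obtain rfl : x = y := by rwa [h] at hx'
    rw [dist_self, zero_add]
  · have hz' : z ∈ S ∩ S' :=
      ⟨hS.mem_of_dist_add hU Set.subset_union_left hz hxzy, hS'.right_mem⟩
    obtain rfl : z = y := by rwa [h] at hz'
    rw [dist_self, add_zero]

theorem mem_of_dist_le_gromovProd (hX : IsRealTree X) (hS : IsSegment S x y)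
    (hS' : IsSegment S' x z) (hp : p ∈ S) (h : dist x p ≤ gromovProd x y z) : p ∈ S' := by
  obtain ⟨a, b, hI⟩ := hX.inter S S' x y z hS hS'
  have hxI : x ∈ S ∩ S' := ⟨hS.left_mem, hS'.left_mem⟩
  have hcont : Continuous fun q : X => dist x q := by fun_prop
  obtain ⟨c, hcI, hmax⟩ := hI.isCompact.exists_isMaxOn ⟨x, hxI⟩ hcont.continuousOn
  have hc : {q ∈ S | dist x c ≤ dist x q} ∩ {q ∈ S' | dist x c ≤ dist x q} = {c} := by
    ext q
    refine ⟨fun ⟨⟨hqS, hq⟩, hqS', _⟩ => ?_, ?_⟩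
    · exact hS.eq_of_dist_eq hqS hcI.1 (le_antisymm (hmax ⟨hqS, hqS'⟩) hq)
    · rintro rfl
      exact ⟨⟨hcI.1, le_rfl⟩, ⟨hcI.2, le_rfl⟩⟩
  have hycz := hX.dist_add_of_inter_eq (hS.setOf_dist_le hcI.1).symm (hS'.setOf_dist_le hcI.2) hc
  have hpc : dist x p ≤ dist x c := by
    unfold gromovProd at h
    linarith [hS.dist_add_of_mem hcI.1, hS'.dist_add_of_mem hcI.2, dist_comm y c]
  obtain ⟨q, hqI, hq⟩ := (hI.isPreconnected.image _ hcont.continuousOn).ordConnected.out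
    (Set.mem_image_of_mem _ hxI) (Set.mem_image_of_mem _ hcI)
    ⟨by simp only [dist_self, dist_nonneg], hpc⟩
  exact hS.eq_of_dist_eq hp hqI.1 hq.symm ▸ hqI.2

theorem min_gromovProd_le (hX : IsRealTree X) (x y z w : X) :
    min (gromovProd x y z) (gromovProd x z w) ≤ gromovProd x y w := by
  set t := min (gromovProd x y z) (gromovProd x z w) with ht
  obtain ⟨S, hS⟩ := hX.geodesic x y
  obtain ⟨S', hS'⟩ := hX.geodesic x z
  obtain ⟨S'', hS''⟩ := hX.geodesic x w
  obtain ⟨p, hpS, hp, hpy⟩ := hS.exists_mem_dist_eq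
    (le_min (gromovProd_nonneg x y z) (gromovProd_nonneg x z w))
    ((min_le_left _ _).trans (gromovProd_le_left x y z))
  have hpS' := hX.mem_of_dist_le_gromovProd hS hS' hpS (hp.trans_le (min_le_left _ _))
  have hpS'' := hX.mem_of_dist_le_gromovProd hS' hS'' hpS' (hp.trans_le (min_le_right _ _))
  have hpw := hS''.dist_add_of_mem hpS''
  unfold gromovProd at ht ⊢
  linarith [dist_triangle_left y w p]

end IsRealTree

/-! ### Geodesic spaces with the four point condition -/

/-- Geodesic metric spaces satisfying the four point condition. These are the real trees, in a form
that no longer mentions segments. -/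
class GeodesicTree (T : Type*) [MetricSpace T] : Prop where
  four_point : ∀ x y z w : T,
    dist x y + dist z w ≤ max (dist x z + dist y w) (dist x w + dist y z)
  exists_dist_eq : ∀ (x y : T) (t : ℝ), 0 ≤ t → t ≤ dist x y →
    ∃ p, dist x p = t ∧ dist p y = dist x y - t

theorem IsRealTree.geodesicTree {X : Type*} [MetricSpace X] (hX : IsRealTree X) :
    GeodesicTree X where
  four_point z x y w := by
    have h := hX.min_gromovProd_le x y z w
    unfold gromovProd at h
    rw [dist_comm z x, dist_comm z y]
    rcases min_le_iff.1 h with h | h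
    · exact le_max_of_le_left (by linarith)
    · exact le_max_of_le_right (by linarith)
  exists_dist_eq x y t h0 h := by
    obtain ⟨S, hS⟩ := hX.geodesic x y
    obtain ⟨p, -, hp⟩ := hS.exists_mem_dist_eq h0 h
    exact ⟨p, hp⟩

namespace GeodesicTree

variable {T : Type*} [MetricSpace T] [GeodesicTree T]

theorem eq_of_between {x y p q : T} (h1 : dist x p = dist x q) (h2 : dist p y = dist q y)
    (h : dist x p + dist p y = dist x y) : p = q := by
  have := four_point x y p q
  rw [dist_comm y q, dist_comm y p, ← h1, ← h2, max_self] at this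
  exact dist_le_zero.1 (by linarith)

theorem exists_toward (x y : T) (t : ℝ) : ∃ p : T, dist x p = max 0 (min t (dist x y)) ∧
    dist p y = dist x y - max 0 (min t (dist x y)) :=
  exists_dist_eq x y _ (le_max_left _ _) (max_le dist_nonneg (min_le_right _ _))

/-- The point at distance `t` from `x` on the segment from `x` to `y`, where `t` is clamped to
`[0, dist x y]`. -/
noncomputable def toward (x y : T) (t : ℝ) : T := (exists_toward x y t).choose

theorem dist_left_toward {x y : T} {t : ℝ} (h0 : 0 ≤ t) (h : t ≤ dist x y) :
    dist x (toward x y t) = t := by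
  rw [toward, (exists_toward x y t).choose_spec.1, min_eq_left h, max_eq_right h0]

theorem dist_toward_right {x y : T} {t : ℝ} (h0 : 0 ≤ t) (h : t ≤ dist x y) :
    dist (toward x y t) y = dist x y - t := by
  rw [toward, (exists_toward x y t).choose_spec.2, min_eq_left h, max_eq_right h0]

theorem eq_toward {x y p : T} {t : ℝ} (h1 : dist x p = t) (h2 : dist p y = dist x y - t) :
    p = toward x y t := by
  have h0 : 0 ≤ t := h1 ▸ dist_nonneg
  have h : t ≤ dist x y := by linarith [@dist_nonneg _ _ p y]
  exact eq_of_between (by rw [h1, dist_left_toward h0 h]) (by rw [h2, dist_toward_right h0 h])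
    (by linarith)

@[simp] theorem toward_zero (x y : T) : toward x y 0 = x := (eq_toward (by simp) (by simp)).symm

@[simp] theorem toward_dist (x y : T) : toward x y (dist x y) = y :=
  (eq_toward (by simp) (by simp)).symm

theorem toward_of_le {x y : T} {t : ℝ} (h : t ≤ 0) : toward x y t = x := by
  have : dist x (toward x y t) = _ := (exists_toward x y t).choose_spec.1
  rw [max_eq_left ((min_le_left _ _).trans h)] at this
  exact (dist_eq_zero.1 this).symm

theorem toward_of_ge {x y : T} {t : ℝ} (h : dist x y ≤ t) : toward x y t = y := by
  have : dist (toward x y t) y = _ := (exists_toward x y t).choose_spec.2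
  rw [min_eq_right h, max_eq_right dist_nonneg, sub_self] at this
  exact dist_eq_zero.1 this

theorem toward_comm {x y : T} {t : ℝ} (h0 : 0 ≤ t) (h : t ≤ dist x y) :
    toward y x t = toward x y (dist x y - t) := by
  have h' : t ≤ dist y x := by rwa [dist_comm]
  refine eq_toward ?_ ?_
  · rw [dist_comm, dist_toward_right h0 h', dist_comm]
  · rw [dist_comm, dist_left_toward h0 h']; ring

theorem toward_toward_left {x y : T} {s t : ℝ} (h0 : 0 ≤ t) (hts : t ≤ s) (h : s ≤ dist x y) :
    toward x (toward x y s) t = toward x y t := by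
  have hs := dist_left_toward (h0.trans hts) h
  have h1 : dist x (toward x (toward x y s) t) = t := dist_left_toward h0 (by rwa [hs])
  have h2 : dist (toward x (toward x y s) t) (toward x y s) = s - t := by
    rw [dist_toward_right h0 (by rwa [hs]), hs]
  have h3 := dist_toward_right (h0.trans hts) h
  refine eq_toward h1 (le_antisymm ?_ ?_)
  · linarith [dist_triangle (toward x (toward x y s) t) (toward x y s) y]
  · linarith [dist_triangle x (toward x (toward x y s) t) y]

theorem toward_toward_right {x y : T} {s t : ℝ} (hs : 0 ≤ s) (ht : 0 ≤ t) (h : s + t ≤ dist x y) :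
    toward (toward x y s) y t = toward x y (s + t) := by
  have hs1 := dist_left_toward hs (by linarith : s ≤ dist x y)
  have hs2 := dist_toward_right hs (by linarith : s ≤ dist x y)
  have h1 : dist (toward x y s) (toward (toward x y s) y t) = t := dist_left_toward ht (by linarith)
  have h2 : dist (toward (toward x y s) y t) y = dist x y - s - t := by
    rw [dist_toward_right ht (by linarith), hs2]
  refine eq_toward (le_antisymm ?_ ?_) (by linarith)
  · linarith [dist_triangle x (toward x y s) (toward (toward x y s) y t)]
  · linarith [dist_triangle x (toward (toward x y s) y t) y]

theorem dist_toward_toward {x y : T} {s t : ℝ} (hs : 0 ≤ s) (hst : s ≤ t) (ht : t ≤ dist x y) :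
    dist (toward x y s) (toward x y t) = t - s := by
  have h1 := dist_left_toward (hs.trans hst) ht
  rw [← toward_toward_left hs hst ht, dist_toward_right hs (by rwa [h1]), h1]

theorem toward_left_add {x y z : T} {t : ℝ} (h : dist x z = dist x y + dist y z) (ht : 0 ≤ t)
    (hty : t ≤ dist x y) : toward x z t = toward x y t := by
  have : y = toward x z (dist x y) := eq_toward rfl (by linarith)
  rw [← toward_toward_left ht hty (by linarith [@dist_nonneg _ _ y z]), ← this]

theorem toward_right_add {x y z : T} {t : ℝ} (h : dist x z = dist x y + dist y z) (ht : 0 ≤ t)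
    (hty : t ≤ dist y z) : toward x z (dist x y + t) = toward y z t := by
  have : y = toward x z (dist x y) := eq_toward rfl (by linarith)
  rw [← toward_toward_right dist_nonneg ht (by linarith), ← this]

theorem min_gromovProd_le (x y z w : T) :
    min (gromovProd x y z) (gromovProd x z w) ≤ gromovProd x y w := by
  have := four_point x z y w
  unfold gromovProd
  rcases le_max_iff.1 this with h | h
  · exact (min_le_right _ _).trans (by linarith [dist_comm z w])
  · exact (min_le_left _ _).trans (by linarith [dist_comm z y])

theorem toward_eq_of_le_gromovProd {x y z : T} {t : ℝ} (h0 : 0 ≤ t) (h : t ≤ gromovProd x y z) :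
    toward x y t = toward x z t := by
  have hz := h.trans (gromovProd_le_right x y z)
  symm
  have h1 := dist_left_toward h0 hz
  have h2 := dist_toward_right h0 hz
  refine eq_toward h1 (le_antisymm ?_ ?_)
  · have := four_point (toward x z t) y x z
    rw [dist_comm (toward x z t) x, dist_comm y x, h1, h2] at this
    unfold gromovProd at h
    rcases le_max_iff.1 this with h' | h' <;> linarith
  · linarith [dist_triangle x (toward x z t) y]

theorem dist_toward_gromovProd (x y z : T) : dist y z =
    dist y (toward x y (gromovProd x y z)) + dist (toward x y (gromovProd x y z)) z := by
  have h1 := dist_toward_right (gromovProd_nonneg x y z) (gromovProd_le_left x y z)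
  have h2 := dist_toward_right (gromovProd_nonneg x y z) (gromovProd_le_right x y z)
  rw [← toward_eq_of_le_gromovProd (gromovProd_nonneg x y z) le_rfl] at h2
  rw [dist_comm y (toward x y _), h1, h2]
  unfold gromovProd
  ring

theorem exists_toward_toward_left (x y : T) {s : ℝ} (h0 : 0 ≤ s) (h : s ≤ dist x y) (t : ℝ) :
    ∃ r, 0 ≤ r ∧ r ≤ s ∧ toward x (toward x y s) t = toward x y r := by
  rcases le_total t 0 with ht | ht
  · exact ⟨0, le_rfl, h0, by rw [toward_of_le ht, toward_zero]⟩
  rcases le_total t s with hts | hts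
  · exact ⟨t, ht, hts, toward_toward_left ht hts h⟩
  · exact ⟨s, h0, le_rfl, toward_of_ge (by rwa [dist_left_toward h0 h])⟩

theorem exists_toward_toward_right (x y : T) {s : ℝ} (h0 : 0 ≤ s) (h : s ≤ dist x y) (t : ℝ) :
    ∃ r, toward (toward x y s) y t = toward x y r := by
  rcases le_total t 0 with ht | ht
  · exact ⟨s, by rw [toward_of_le ht]⟩
  rcases le_total (s + t) (dist x y) with hts | hts
  · exact ⟨s + t, toward_toward_right h0 ht hts⟩
  · exact ⟨dist x y, by rw [toward_dist, toward_of_ge]; rw [dist_toward_right h0 h]; linarith⟩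

theorem exists_toward_comm (x y : T) (t : ℝ) : ∃ r, toward x y t = toward y x r := by
  rcases le_total t 0 with ht | ht
  · exact ⟨dist y x, by rw [toward_of_le ht, toward_dist]⟩
  rcases le_total t (dist x y) with hts | hts
  · exact ⟨_, toward_comm ht (by rwa [dist_comm])⟩
  · exact ⟨0, by rw [toward_of_ge hts, toward_zero]⟩

theorem gromovProd_toward_eq_zero {x y : T} {t : ℝ} (h0 : 0 ≤ t) (h : t ≤ dist x y) :
    gromovProd (toward x y t) x y = 0 := by
  have h1 := dist_left_toward h0 h
  have h2 := dist_toward_right h0 h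
  unfold gromovProd
  rw [dist_comm (toward x y t) x]
  linarith

theorem gromovProd_toward_pos {x y : T} {s t : ℝ} (h0 : 0 ≤ s) (hst : s < t) (h : t ≤ dist x y) :
    0 < gromovProd (toward x y s) (toward x y t) y := by
  have h1 := dist_toward_toward h0 hst.le h
  have h2 := dist_toward_right h0 (hst.le.trans h)
  have h3 := dist_toward_right (h0.trans hst.le) h
  unfold gromovProd
  linarith

theorem toward_ne_right {x y : T} {t : ℝ} (h0 : 0 ≤ t) (h : t < dist x y) : y ≠ toward x y t := by
  intro h'
  have h2 := dist_toward_right h0 h.le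
  rw [← h', dist_self] at h2
  linarith

theorem toward_ne_left {x y : T} {t : ℝ} (h0 : 0 < t) (h : t ≤ dist x y) : x ≠ toward x y t := by
  intro h'
  have h2 := dist_left_toward h0.le h
  rw [← h', dist_self] at h2
  linarith

theorem toward_ne_toward {x y : T} {s t : ℝ} (h0 : 0 ≤ s) (hst : s < t) (h : t ≤ dist x y) :
    toward x y t ≠ toward x y s := by
  intro h'
  have h2 := dist_toward_toward h0 hst.le h
  rw [← h', dist_self] at h2
  linarith

theorem map_toward {T' : Type*} [MetricSpace T'] [GeodesicTree T'] {g : T → T'} (hg : Isometry g)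
    {x z : T} {s : ℝ} (h0 : 0 ≤ s) (h : s ≤ dist x z) : g (toward x z s) = toward (g x) (g z) s :=
  eq_toward (by rw [hg.dist_eq, dist_left_toward h0 h]) 
    (by rw [hg.dist_eq, hg.dist_eq, dist_toward_right h0 h])

theorem toward_line {f : ℝ → T} (hf : Isometry f) {t s : ℝ} (h0 : 0 ≤ s) (h : s ≤ t) :
    toward (f 0) (f t) s = f s := by
  refine (eq_toward ?_ ?_).symm
  · rw [hf.dist_eq, Real.dist_eq, zero_sub, abs_neg, abs_of_nonneg h0]
  · rw [hf.dist_eq, hf.dist_eq, Real.dist_eq, Real.dist_eq, abs_sub_comm,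
      abs_of_nonneg (by linarith), zero_sub, abs_neg, abs_of_nonneg (by linarith)]

theorem isGeodesicOn_toward (x y : T) : IsGeodesicOn (toward x y) (Set.Icc 0 (dist x y)) := by
  intro s hs t ht
  rcases le_total s t with hst | hst
  · rw [dist_toward_toward hs.1 hst ht.2, abs_sub_comm, abs_of_nonneg (sub_nonneg.2 hst)]
  · rw [dist_comm, dist_toward_toward ht.1 hst hs.2, abs_of_nonneg (sub_nonneg.2 hst)]

/-! ### Alignment -/

theorem eq_or_eq_of_rectangle {p q r s : T}
    (hpqs : dist p q + dist q s = dist p s) (hprs : dist p r + dist r s = dist p s)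
    (hqpr : dist q p + dist p r = dist q r) (hqsr : dist q s + dist s r = dist q r) :
    (q = p ∧ s = r) ∨ (r = p ∧ s = q) := by
  have h := four_point p s q r
  rw [dist_comm q p] at hqpr
  rw [dist_comm s r] at hqsr h
  rw [dist_comm s q] at h
  rcases le_max_iff.1 h with h | h
  · have hpr : dist p r = 0 := le_antisymm (by linarith) dist_nonneg
    have hqs : dist q s = 0 := by linarith
    exact Or.inr ⟨(dist_eq_zero.1 hpr).symm, (dist_eq_zero.1 hqs).symm⟩
  · have hpq : dist p q = 0 := le_antisymm (by linarith) dist_nonneg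
    have hrs : dist r s = 0 := by linarith
    exact Or.inl ⟨(dist_eq_zero.1 hpq).symm, (dist_eq_zero.1 hrs).symm⟩

theorem mem_range_of_dist_add {f : ℝ → T} (hf : Isometry f) {p : T} {s t : ℝ} (hst : s ≤ t)
    (h : dist (f s) p + dist p (f t) = dist (f s) (f t)) : p ∈ Set.range f := by
  have hdist : dist (f s) (f t) = t - s := by
    rw [hf.dist_eq, Real.dist_eq, abs_sub_comm, abs_of_nonneg (sub_nonneg.2 hst)]
  have hle : dist (f s) p ≤ t - s := by linarith [dist_nonneg (x := p) (y := f t)]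
  have hsp : dist (f s) (f (s + dist (f s) p)) = dist (f s) p := by
    rw [hf.dist_eq, Real.dist_eq, sub_add_cancel_left, abs_neg, abs_of_nonneg dist_nonneg]
  have hpt : dist (f (s + dist (f s) p)) (f t) = dist p (f t) := by
    rw [hf.dist_eq, Real.dist_eq, abs_of_nonpos (by linarith)]
    linarith
  exact ⟨_, eq_of_between hsp hpt (by rw [hsp, hpt, h])⟩

/-- Far enough in both directions, the only possible alignment is the one with `p` in the middle. -/
theorem mem_range_of_aligned {f : ℝ → T} (hf : Isometry f) {p : T}
    (h : ∀ s t, Aligned (f s) p (f t)) : p ∈ Set.range f := by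
  set k := dist p (f 0) + 1
  have hk : 0 < k := by positivity
  have hdist : dist (f (-k)) (f k) = 2 * k := by
    rw [hf.dist_eq, Real.dist_eq, abs_of_nonpos (by linarith)]
    ring
  have hleft : dist (f (-k)) (f 0) = k := by
    rw [hf.dist_eq, Real.dist_eq, sub_zero, abs_neg, abs_of_pos hk]
  have hright : dist (f 0) (f k) = k := by
    rw [hf.dist_eq, Real.dist_eq, zero_sub, abs_neg, abs_of_pos hk]
  have hpk := dist_triangle p (f 0) (f k)
  have hkp := dist_triangle_right (f (-k)) p (f 0)
  rcases h (-k) k with h | h | h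
  · exact mem_range_of_dist_add hf (by linarith) h
  · linarith [dist_nonneg (x := p) (y := f (-k))]
  · linarith [dist_nonneg (x := f k) (y := p)]

/-! ### Directions -/

theorem exists_isSegment_notMem_iff {x y z : T} :
    (∃ S : Set T, IsSegment S y z ∧ x ∉ S) ↔ 0 < gromovProd x y z := by
  constructor
  · rintro ⟨S, hS, hx⟩
    by_contra hnonpos
    have hzero : dist y x + dist x z = dist y z := by
      have := le_antisymm (not_lt.1 hnonpos) (gromovProd_nonneg x y z)
      unfold gromovProd at this
      linarith [dist_comm x y]
    obtain ⟨p, hp, hyp, hpz⟩ := hS.exists_mem_dist_eq (t := dist y x) dist_nonneg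
      (by linarith [dist_nonneg (x := x) (y := z)])
    have hpx : p = x := eq_of_between hyp (by linarith) (by linarith)
    exact hx (hpx ▸ hp)
  · intro hpos
    have hS := (isGeodesicOn_toward y z).isSegment dist_nonneg
    rw [toward_zero, toward_dist] at hS
    refine ⟨_, hS, fun hx => ?_⟩
    have := hS.dist_add_of_mem hx
    unfold gromovProd at hpos
    linarith [dist_comm x y]

theorem directions_mk_eq_iff {x : T} (y z : {y : T // y ≠ x}) :
    (Quot.mk _ y : Directions x) = Quot.mk _ z ↔ 0 < gromovProd x y.1 z.1 := by
  have hequiv : Equivalence fun y z : {y : T // y ≠ x} => 0 < gromovProd x y.1 z.1 :=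
    { refl := fun y => by
        have := dist_pos.2 y.2.symm
        unfold gromovProd
        rw [dist_self]
        linarith
      symm := fun {y z} h => by rwa [gromovProd_comm]
      trans := fun {y z w} h h' => (lt_min h h').trans_le (min_gromovProd_le x y.1 z.1 w.1) }
  rw [Quot.eq, ← hequiv.eqvGen_iff]
  simp only [exists_isSegment_notMem_iff]

/-! ### The real line -/

instance : GeodesicTree ℝ where
  four_point x y z w := by
    simp only [Real.dist_eq]
    grind
  exists_dist_eq x y t h0 h := by
    simp only [Real.dist_eq] at h ⊢
    rcases le_total x y with hxy | hxy
    · refine ⟨x + t, ?_, ?_⟩ <;> grind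
    · refine ⟨x - t, ?_, ?_⟩ <;> grind

theorem of_isometryEquiv {T' : Type*} [MetricSpace T'] (e : T' ≃ᵢ T) : GeodesicTree T' where
  four_point x y z w := by
    simp only [← e.dist_eq]
    exact four_point _ _ _ _
  exists_dist_eq x y t h0 h := by
    obtain ⟨p, hxp, hpy⟩ := exists_dist_eq (e x) (e y) t h0 (by rwa [e.dist_eq])
    refine ⟨e.symm p, ?_, ?_⟩
    · rw [← e.dist_eq, e.apply_symm_apply, hxp]
    · rw [← e.dist_eq, e.apply_symm_apply, hpy, e.dist_eq]

end GeodesicTree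

open GeodesicTree Filter Topology Cardinal

/-! ### Path classes and developing maps -/

/-- Two paths have the same germ at `0⁺`. -/
def GermEq {V : Type*} (γ γ' : ℝ → V) : Prop := γ =ᶠ[𝓝[≥] 0] γ'

namespace GermEq

variable {V : Type*} {γ γ' γ'' δ δ' : ℝ → V} {e : ℝ}

theorem refl (γ : ℝ → V) : GermEq γ γ := EventuallyEq.refl _ _

theorem symm (h : GermEq γ γ') : GermEq γ' γ := EventuallyEq.symm h

theorem trans (h : GermEq γ γ') (h' : GermEq γ' γ'') : GermEq γ γ'' := EventuallyEq.trans h h'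

theorem of_lt (he : 0 < e) (h : ∀ s, 0 ≤ s → s < e → γ s = γ' s) : GermEq γ γ' :=
  mem_of_superset (Ico_mem_nhdsGE he) fun s hs => h s hs.1 hs.2

theorem exists_pos (h : GermEq γ γ') : ∃ e > 0, ∀ s, 0 ≤ s → s ≤ e → γ s = γ' s := by
  obtain ⟨e, he, h⟩ := mem_nhdsGE_iff_exists_Icc_subset.1 h
  exact ⟨e, he, fun s h0 h1 => h ⟨h0, h1⟩⟩

theorem congr_of_lt (he : 0 < e) (h : ∀ s, 0 ≤ s → s < e → γ s = δ s)
    (h' : ∀ s, 0 ≤ s → s < e → γ' s = δ' s) (H : GermEq γ γ') : GermEq δ δ' :=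
  ((of_lt he h).symm.trans H).trans (of_lt he h')

end GermEq

/-- A path is reduced if it does not backtrack at any interior time. -/
def IsReducedPath {V : Type*} (γ : ℝ → V) (a b : ℝ) : Prop :=
  ∀ t, a < t → t < b → ¬ GermEq (fun s => γ (t - s)) (fun s => γ (t + s))

/-- A class of paths in `V`, closed under restriction, reparametrisation by isometries of the line,
concatenation and limits. `P γ a b` says that the restriction of `γ` to `[a, b]` is in the class. -/
structure PathClass (V : Type*) where
  P : (ℝ → V) → ℝ → ℝ → Prop
  point : ∀ γ a, P γ a a
  congr : ∀ {γ γ' a b}, Set.EqOn γ γ' (Set.Icc a b) → P γ a b → P γ' a b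
  mono : ∀ {γ a b a' b'}, P γ a b → a ≤ a' → a' ≤ b' → b' ≤ b → P γ a' b'
  shift : ∀ {γ a b} c, P γ a b → P (fun s => γ (s + c)) (a - c) (b - c)
  rev : ∀ {γ a b}, P γ a b → P (fun s => γ (-s)) (-b) (-a)
  concat : ∀ {γ a b c}, a ≤ b → b ≤ c → P γ a b → P γ b c → P γ a c
  extend : ∀ {γ a b}, a < b → (∀ c, a ≤ c → c < b → P γ a c) →
    ∃ v, P (Function.update γ b v) a b
  eq_right : ∀ {γ γ' a b}, a < b → P γ a b → P γ' a b → Set.EqOn γ γ' (Set.Ico a b) → γ b = γ' b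

namespace PathClass

section Germs

variable {V : Type*} (Ω : PathClass V)

/-- Paths representing the germ of a reduced path issuing from `v`. -/
def IsGerm (v : V) (γ : ℝ → V) : Prop := ∃ l > 0, Ω.P γ 0 l ∧ IsReducedPath γ 0 l ∧ γ 0 = v

/-- Equality of germs, on the paths representing the germ of a reduced path issuing from `v`. -/
def germSetoid (v : V) : Setoid {γ : ℝ → V // Ω.IsGerm v γ} where
  r γ γ' := GermEq γ.1 γ'.1
  iseqv := ⟨fun _ => GermEq.refl _, fun h => h.symm, fun h h' => h.trans h'⟩

/-- The germs of reduced paths issuing from `v`. -/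
def Germs (v : V) : Type _ := Quotient (Ω.germSetoid v)

theorem backward {γ : ℝ → V} {a t : ℝ} (hP : Ω.P γ a t) : Ω.P (fun s => γ (t - s)) 0 (t - a) := by
  simpa only [neg_add_rev, neg_neg, sub_neg_eq_add, neg_add_cancel, neg_add_eq_sub,
    ← sub_eq_add_neg, neg_sub] using Ω.shift (-t) (Ω.rev hP)

variable {Ω} {γ : ℝ → V} {t d : ℝ}

theorem isGerm_backward (hP : Ω.P γ 0 d) (hred : IsReducedPath γ 0 d) (h0 : 0 < t) (ht : t ≤ d) :
    Ω.IsGerm (γ t) fun s => γ (t - s) := by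
  refine ⟨t, h0, ?_, fun r hr0 hr1 h => ?_, by simp⟩
  · simpa using Ω.backward (Ω.mono hP le_rfl h0.le ht)
  · refine hred (t - r) (by linarith) (by linarith) ?_
    simpa only [sub_sub, sub_add] using h.symm

theorem isGerm_forward (hP : Ω.P γ 0 d) (hred : IsReducedPath γ 0 d) (h0 : 0 ≤ t) (ht : t < d) :
    Ω.IsGerm (γ t) fun s => γ (t + s) := by
  refine ⟨d - t, sub_pos.2 ht, ?_, fun r hr0 hr1 h => ?_, by simp⟩
  · simpa only [sub_self, add_comm] using Ω.shift t (Ω.mono hP h0 ht.le le_rfl)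
  · refine hred (t + r) (by linarith) (by linarith) ?_
    simpa only [add_assoc, ← add_sub_assoc] using h

end Germs

section Charts

variable {V : Type*} (Ω : PathClass V) {T : Type*} [MetricSpace T]

/-- An identification of the directions at `p` with the germs of reduced paths issuing from `v`:
`B y` represents the germ corresponding to the direction of `y` at `p`. -/
structure Chart (p : T) (v : V) (B : T → ℝ → V) : Prop where
  germ : ∀ y, y ≠ p → Ω.IsGerm v (B y)
  eq : ∀ y z, y ≠ p → z ≠ p → 0 < gromovProd p y z → B y = B z
  ne : ∀ y z, y ≠ p → z ≠ p → gromovProd p y z = 0 → ¬ GermEq (B y) (B z)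
  surj : ∀ γ, Ω.IsGerm v γ → ∃ y, y ≠ p ∧ GermEq (B y) γ

variable {Ω} [GeodesicTree T] {p y₁ y₂ : T} {v : V} {γ₁ γ₂ : ℝ → V}

theorem exists_chart_of_equiv (e : Directions p ≃ Ω.Germs v) : ∃ B, Ω.Chart p v B ∧
    ∀ (y : {y // y ≠ p}) (γ : {γ // Ω.IsGerm v γ}), e (Quot.mk _ y) = Quotient.mk _ γ →
      GermEq (B y) γ := by
  classical
  let B : T → ℝ → V := fun y => if hy : y ≠ p then (e (Quot.mk _ ⟨y, hy⟩)).out.1 else fun _ => v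
  have hB : ∀ y (hy : y ≠ p), B y = (e (Quot.mk _ ⟨y, hy⟩)).out.1 := fun y hy => dif_pos hy
  have hBg : ∀ (y : {y // y ≠ p}) (γ : {γ // Ω.IsGerm v γ}),
      e (Quot.mk _ y) = Quotient.mk _ γ → GermEq (B y) γ := by
    intro y γ h
    rw [hB y y.2, h]
    exact Quotient.exact (Quotient.out_eq (Quotient.mk (Ω.germSetoid v) γ))
  refine ⟨B, ⟨fun y hy => ?_, fun y z hy hz h => ?_, fun y z hy hz h hyz => ?_, fun γ hγ => ?_⟩,
    hBg⟩
  · rw [hB y hy]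
    exact (e (Quot.mk _ ⟨y, hy⟩)).out.2
  · rw [hB y hy, hB z hz, (directions_mk_eq_iff ⟨y, hy⟩ ⟨z, hz⟩).2 h]
  · rw [hB y hy, hB z hz] at hyz
    have hdir := (directions_mk_eq_iff _ _).1 (e.injective (Quotient.out_equiv_out.1 hyz))
    exact hdir.ne' h
  · obtain ⟨a, ha⟩ := e.surjective (Quotient.mk _ ⟨γ, hγ⟩)
    obtain ⟨y, rfl⟩ := Quot.exists_rep a
    exact ⟨y, y.2, hBg y ⟨γ, hγ⟩ ha⟩

theorem exists_chart_one (e : Nonempty (Directions p ≃ Ω.Germs v)) (h₁ : y₁ ≠ p)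
    (hγ₁ : Ω.IsGerm v γ₁) : ∃ B, Ω.Chart p v B ∧ GermEq (B y₁) γ₁ := by
  obtain ⟨e⟩ := e
  obtain ⟨τ, hτ⟩ := MulAction.exists_smul_eq (Equiv.Perm (Ω.Germs v)) (e (Quot.mk _ ⟨y₁, h₁⟩))
    (Quotient.mk _ ⟨γ₁, hγ₁⟩)
  obtain ⟨B, hB, hBg⟩ := exists_chart_of_equiv (e.trans τ)
  exact ⟨B, hB, hBg ⟨y₁, h₁⟩ ⟨γ₁, hγ₁⟩ hτ⟩

theorem exists_chart_two (e : Nonempty (Directions p ≃ Ω.Germs v)) (h₁ : y₁ ≠ p) (h₂ : y₂ ≠ p)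
    (h₁₂ : gromovProd p y₁ y₂ = 0) (hγ₁ : Ω.IsGerm v γ₁) (hγ₂ : Ω.IsGerm v γ₂)
    (hγ : ¬ GermEq γ₁ γ₂) : ∃ B, Ω.Chart p v B ∧ GermEq (B y₁) γ₁ ∧ GermEq (B y₂) γ₂ := by
  obtain ⟨e⟩ := e
  have hdir : e (Quot.mk _ ⟨y₁, h₁⟩) ≠ e (Quot.mk _ ⟨y₂, h₂⟩) := fun h =>
    ((directions_mk_eq_iff _ _).1 (e.injective h)).ne' h₁₂
  have hgerm : (Quotient.mk _ ⟨γ₁, hγ₁⟩ : Ω.Germs v) ≠ Quotient.mk _ ⟨γ₂, hγ₂⟩ := fun h =>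
    hγ (Quotient.exact h)
  obtain ⟨τ, hτ₁, hτ₂⟩ := (MulAction.is_two_pretransitive_iff (G := Equiv.Perm (Ω.Germs v))).1
    (Equiv.Perm.isMultiplyPretransitive (Ω.Germs v) 2) hdir hgerm
  obtain ⟨B, hB, hBg⟩ := exists_chart_of_equiv (e.trans τ)
  exact ⟨B, hB, hBg ⟨y₁, h₁⟩ ⟨γ₁, hγ₁⟩ hτ₁, hBg ⟨y₂, h₂⟩ ⟨γ₂, hγ₂⟩ hτ₂⟩

theorem exists_chart_toward (e : ∀ (p : T) (v : V), Nonempty (Directions p ≃ Ω.Germs v)) {b x : T}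
    {δ : ℝ → V} (hP : Ω.P δ 0 (dist b x)) (hred : IsReducedPath δ 0 (dist b x)) {t : ℝ}
    (h0 : 0 < t) (ht : t ≤ dist b x) : ∃ B, Ω.Chart (toward b x t) (δ t) B ∧
      GermEq (B b) (fun s => δ (t - s)) ∧ (t < dist b x → GermEq (B x) (fun s => δ (t + s))) := by
  have hback := isGerm_backward hP hred h0 ht
  rcases ht.lt_or_eq with hlt | heq
  · obtain ⟨B, hB, hb, hx⟩ := exists_chart_two (e _ _) (toward_ne_left h0 ht)
      (toward_ne_right h0.le hlt) (gromovProd_toward_eq_zero h0.le ht) hback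
      (isGerm_forward hP hred h0.le hlt) (hred t h0 hlt)
    exact ⟨B, hB, hb, fun _ => hx⟩
  · obtain ⟨B, hB, hb⟩ := exists_chart_one (e _ _) (toward_ne_left h0 ht) hback
    exact ⟨B, hB, hb, fun h => absurd heq h.ne⟩

end Charts

variable {V : Type*} (Ω : PathClass V) {T : Type*} [MetricSpace T] [GeodesicTree T]

/-- A developing map `T → V`: it sends segments to paths of the class and induces at every point a
bijection between directions and germs of reduced paths. -/
structure Developing (π : T → V) : Prop where
  path : ∀ x y, Ω.P (fun s => π (toward x y s)) 0 (dist x y)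
  inj : ∀ x y z, y ≠ x → z ≠ x → gromovProd x y z = 0 →
    ¬ GermEq (fun s => π (toward x y s)) (fun s => π (toward x z s))
  surj : ∀ x γ, Ω.IsGerm (π x) γ → ∃ y, y ≠ x ∧ GermEq (fun s => π (toward x y s)) γ

/-- The conditions on a partially defined developing map `f`, with charts `B`, along the segment
from `b` to `x`. -/
structure LocalDev (b : T) (f : T → V) (B : T → T → ℝ → V) (x : T) : Prop where
  path : Ω.P (fun s => f (toward b x s)) 0 (dist b x)
  chart : Ω.Chart x (f x) (B x)
  out : ∀ t, 0 ≤ t → t < dist b x →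
    GermEq (fun s => f (toward (toward b x t) x s)) (B (toward b x t) x)
  inn : x ≠ b → GermEq (fun s => f (toward x b s)) (B x b)

/-- A developing map defined on a subset which is star-shaped about `b`, together with charts at the
points of this subset. -/
structure PartialDev (b : T) where
  S : Set T
  f : T → V
  B : T → T → ℝ → V
  base : b ∈ S
  star : ∀ x ∈ S, ∀ t, toward b x t ∈ S
  loc : ∀ x ∈ S, Ω.LocalDev b f B x

variable {Ω}

theorem LocalDev.congr {b x : T} {f f' : T → V} {B B' : T → T → ℝ → V} (h : Ω.LocalDev b f B x)
    (hf : ∀ t, f (toward b x t) = f' (toward b x t))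
    (hB : ∀ t, B (toward b x t) = B' (toward b x t)) : Ω.LocalDev b f' B' x := by
  have hfx : f x = f' x := by simpa using hf (dist b x)
  have hBx : B x = B' x := by simpa using hB (dist b x)
  refine ⟨?_, hfx ▸ hBx ▸ h.chart, fun t h0 ht => ?_, fun hb => ?_⟩
  · simpa only [hf] using h.path
  · have hfs : ∀ s, f (toward (toward b x t) x s) = f' (toward (toward b x t) x s) := fun s => by
      obtain ⟨r, hr⟩ := exists_toward_toward_right b x h0 ht.le s
      rw [hr, hf]
    simpa only [hfs, hB] using h.out t h0 ht
  · have hfs : ∀ s, f (toward x b s) = f' (toward x b s) := fun s => by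
      obtain ⟨r, hr⟩ := exists_toward_comm x b s
      rw [hr, hf]
    simpa only [hfs, hBx] using h.inn hb

namespace PartialDev

variable {b : T}

instance : Preorder (PartialDev (T := T) Ω b) where
  le D D' := D.S ⊆ D'.S ∧ ∀ x ∈ D.S, D.f x = D'.f x ∧ D.B x = D'.B x
  le_refl D := ⟨subset_rfl, fun _ _ => ⟨rfl, rfl⟩⟩
  le_trans D D' D'' h h' := ⟨h.1.trans h'.1, fun x hx =>
    ⟨(h.2 x hx).1.trans (h'.2 x (h.1 hx)).1, (h.2 x hx).2.trans (h'.2 x (h.1 hx)).2⟩⟩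

theorem bddAbove_of_chain {c : Set (PartialDev (T := T) Ω b)} (hc : IsChain (· ≤ ·) c)
    (hne : c.Nonempty) : BddAbove c := by
  classical
  obtain ⟨D₀, hD₀⟩ := hne
  let g : T → PartialDev (T := T) Ω b := fun x => if h : ∃ D ∈ c, x ∈ D.S then h.choose else D₀
  have hg : ∀ D ∈ c, ∀ x ∈ D.S, D.f x = (g x).f x ∧ D.B x = (g x).B x := by
    intro D hD x hx
    have h : ∃ D ∈ c, x ∈ D.S := ⟨D, hD, hx⟩
    have hgx : g x = h.choose := dif_pos h
    rw [hgx]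
    rcases hc.total hD h.choose_spec.1 with h' | h'
    · exact h'.2 x hx
    · exact (h'.2 x h.choose_spec.2).imp Eq.symm Eq.symm
  refine ⟨⟨{x | ∃ D ∈ c, x ∈ D.S}, fun x => (g x).f x, fun x => (g x).B x, ⟨D₀, hD₀, D₀.base⟩,
    ?_, ?_⟩, fun D hD => ⟨fun x hx => ⟨D, hD, hx⟩, hg D hD⟩⟩
  · rintro x ⟨D, hD, hx⟩ t
    exact ⟨D, hD, D.star x hx t⟩
  · rintro x ⟨D, hD, hx⟩
    exact (D.loc x hx).congr (fun t => (hg D hD _ (D.star x hx t)).1)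
      fun t => (hg D hD _ (D.star x hx t)).2

section Restriction

variable (D : PartialDev (T := T) Ω b) {x : T} {s t : ℝ}

theorem toward_mem_of_le (h0 : 0 ≤ s) (hst : s ≤ t) (ht : t ≤ dist b x) (h : toward b x t ∈ D.S) :
    toward b x s ∈ D.S := by
  rw [← toward_toward_left h0 hst ht]
  exact D.star _ h s

theorem path_toward (h0 : 0 ≤ t) (ht : t ≤ dist b x) (h : toward b x t ∈ D.S) :
    Ω.P (fun s => D.f (toward b x s)) 0 t := by
  have hpath := (D.loc _ h).path
  rw [dist_left_toward h0 ht] at hpath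
  exact Ω.congr (fun s hs => by simp only [toward_toward_left hs.1 hs.2 ht]) hpath

theorem inn_toward (h0 : 0 < t) (ht : t ≤ dist b x) (h : toward b x t ∈ D.S) :
    GermEq (fun s => D.f (toward b x (t - s))) (D.B (toward b x t) b) := by
  refine GermEq.trans (.of_lt h0 fun s hs0 hs1 => ?_)
    ((D.loc _ h).inn (toward_ne_left h0 ht).symm)
  rw [toward_comm hs0 (by rw [dist_left_toward h0.le ht]; exact hs1.le),
    dist_left_toward h0.le ht, toward_toward_left (by linarith) (by linarith) ht]

theorem out_toward (h0 : 0 ≤ s) (hst : s < t) (ht : t ≤ dist b x) (h : toward b x t ∈ D.S) :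
    GermEq (fun r => D.f (toward b x (s + r))) (D.B (toward b x s) x) := by
  have hdist := dist_left_toward (h0.trans hst.le) ht
  have hs := D.toward_mem_of_le h0 hst.le ht h
  have hout := (D.loc _ h).out s h0 (by rwa [hdist])
  rw [toward_toward_left h0 hst.le ht, (D.loc _ hs).chart.eq _ _ (toward_ne_toward h0 hst ht)
    (toward_ne_right h0 (hst.trans_le ht)) (gromovProd_toward_pos h0 hst ht)] at hout
  refine GermEq.trans (.of_lt (sub_pos.2 hst) fun r hr0 hr1 => ?_) hout
  rw [← toward_toward_left h0 hst.le ht, toward_toward_right h0 hr0 (by rw [hdist]; linarith),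
    toward_toward_left (by linarith) (by linarith) ht]

end Restriction

section Extension

/-- `D.ExtendsAlong x δ`: the path `δ` is a candidate for the values on the segment from `b` to `x`
of a developing map extending `D`. -/
structure ExtendsAlong (D : PartialDev (T := T) Ω b) (x : T) (δ : ℝ → V) : Prop where
  path : Ω.P δ 0 (dist b x)
  eq : ∀ t, 0 ≤ t → t ≤ dist b x → toward b x t ∈ D.S → δ t = D.f (toward b x t)
  out : ∀ t, 0 ≤ t → t < dist b x → toward b x t ∈ D.S →
    GermEq (fun s => δ (t + s)) (D.B (toward b x t) x)
  red : ∀ t, 0 < t → t < dist b x → toward b x t ∉ D.S →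
    ¬ GermEq (fun s => δ (t - s)) (fun s => δ (t + s))

variable {D : PartialDev (T := T) Ω b} {x : T} {δ : ℝ → V} {t : ℝ}

theorem ExtendsAlong.inn (h : D.ExtendsAlong x δ) (h0 : 0 < t) (ht : t ≤ dist b x)
    (hS : toward b x t ∈ D.S) : GermEq (fun s => δ (t - s)) (D.B (toward b x t) b) :=
  GermEq.trans (.of_lt h0 fun _ _ _ => h.eq _ (by linarith) (by linarith)
    (D.toward_mem_of_le (by linarith) (by linarith) ht hS)) (D.inn_toward h0 ht hS)

theorem ExtendsAlong.isReducedPath (h : D.ExtendsAlong x δ) : IsReducedPath δ 0 (dist b x) := by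
  intro t h0 ht hfold
  by_cases hS : toward b x t ∈ D.S
  · exact (D.loc _ hS).chart.ne b x (toward_ne_left h0 ht.le) (toward_ne_right h0.le ht)
      (gromovProd_toward_eq_zero h0.le ht.le)
      (((h.inn h0 ht.le hS).symm.trans hfold).trans (h.out t h0.le ht hS))
  · exact h.red t h0 ht hS hfold

theorem ExtendsAlong.exists_chart (e : ∀ (p : T) (v : V), Nonempty (Directions p ≃ Ω.Germs v))
    (h : D.ExtendsAlong x δ) (h0 : 0 ≤ t) (ht : t ≤ dist b x) :
    ∃ C, Ω.Chart (toward b x t) (δ t) C ∧ (toward b x t ∈ D.S → C = D.B (toward b x t)) ∧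
      (t < dist b x → GermEq (fun s => δ (t + s)) (C x)) ∧
      (0 < t → GermEq (fun s => δ (t - s)) (C b)) := by
  by_cases hS : toward b x t ∈ D.S
  · exact ⟨D.B (toward b x t), h.eq t h0 ht hS ▸ (D.loc _ hS).chart, fun _ => rfl,
      fun hlt => h.out t h0 hlt hS, fun hpos => h.inn hpos ht hS⟩
  · have hpos : 0 < t := h0.lt_of_ne (by rintro rfl; exact hS (by simpa using D.base))
    obtain ⟨C, hC, hb, hx⟩ := exists_chart_toward e h.path h.isReducedPath hpos ht
    exact ⟨C, hC, fun hS' => absurd hS' hS, fun hlt => (hx hlt).symm, fun _ => hb.symm⟩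

theorem localDev_toward {f : T → V} {B : T → T → ℝ → V} (hP : Ω.P δ 0 (dist b x))
    (hf : ∀ t, 0 ≤ t → t ≤ dist b x → f (toward b x t) = δ t)
    (hchart : ∀ t, 0 ≤ t → t ≤ dist b x →
      Ω.Chart (toward b x t) (f (toward b x t)) (B (toward b x t)))
    (hout : ∀ t, 0 ≤ t → t < dist b x → GermEq (fun s => δ (t + s)) (B (toward b x t) x))
    (hinn : ∀ t, 0 < t → t ≤ dist b x → GermEq (fun s => δ (t - s)) (B (toward b x t) b))
    {t : ℝ} (h0 : 0 ≤ t) (ht : t ≤ dist b x) : Ω.LocalDev b f B (toward b x t) := by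
  have hdist := dist_left_toward h0 ht
  refine ⟨?_, hchart t h0 ht, fun r hr0 hrt => ?_, fun hne => ?_⟩
  · rw [hdist]
    refine Ω.congr (fun s hs => ?_) (Ω.mono hP le_rfl h0 ht)
    rw [toward_toward_left hs.1 hs.2 ht, hf s hs.1 (hs.2.trans ht)]
  · rw [hdist] at hrt
    have hr := hrt.trans_le ht
    rw [toward_toward_left hr0 hrt.le ht, (hchart r hr0 hr.le).eq (toward b x t) x
      (toward_ne_toward hr0 hrt ht) (toward_ne_right hr0 hr) (gromovProd_toward_pos hr0 hrt ht)]
    refine GermEq.trans (.of_lt (sub_pos.2 hrt) fun s hs0 hs1 => ?_) (hout r hr0 hr)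
    rw [← hf (r + s) (by linarith) (by linarith), ← toward_toward_left hr0 hrt.le ht,
      toward_toward_right hr0 hs0 (by rw [hdist]; linarith),
      toward_toward_left (by linarith) (by linarith) ht]
  · have ht0 : 0 < t := h0.lt_of_ne (by rintro rfl; simp at hne)
    refine GermEq.trans (.of_lt ht0 fun s hs0 hs1 => ?_) (hinn t ht0 ht)
    rw [← hf (t - s) (by linarith) (by linarith), toward_comm hs0 (by rw [hdist]; exact hs1.le),
      hdist, toward_toward_left (by linarith) (by linarith) ht]

theorem ExtendsAlong.exists_localDev (e : ∀ (p : T) (v : V), Nonempty (Directions p ≃ Ω.Germs v))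
    (h : D.ExtendsAlong x δ) : ∃ (f : T → V) (B : T → T → ℝ → V),
      (∀ q ∈ D.S, D.f q = f q ∧ D.B q = B q) ∧
      ∀ t, 0 ≤ t → t ≤ dist b x → Ω.LocalDev b f B (toward b x t) := by
  classical
  have : Nonempty V := ⟨δ 0⟩
  choose! C hC hCS hCx hCb using fun (t : ℝ) (ht : 0 ≤ t ∧ t ≤ dist b x) =>
    h.exists_chart e ht.1 ht.2
  let f : T → V := fun q => if q ∈ D.S then D.f q else δ (dist b q)
  let B : T → T → ℝ → V := fun q => if q ∈ D.S then D.B q else C (dist b q)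
  have hf : ∀ t, 0 ≤ t → t ≤ dist b x → f (toward b x t) = δ t := by
    intro t h0 ht
    by_cases hS : toward b x t ∈ D.S
    · simp only [f, if_pos hS, h.eq t h0 ht hS]
    · simp only [f, if_neg hS, dist_left_toward h0 ht]
  have hB : ∀ t, 0 ≤ t → t ≤ dist b x → B (toward b x t) = C t := by
    intro t h0 ht
    by_cases hS : toward b x t ∈ D.S
    · simp only [B, if_pos hS, hCS t ⟨h0, ht⟩ hS]
    · simp only [B, if_neg hS, dist_left_toward h0 ht]
  refine ⟨f, B, fun q hq => ⟨(if_pos hq).symm, (if_pos hq).symm⟩, fun t h0 ht =>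
    localDev_toward h.path hf (fun r hr0 hr => ?_) (fun r hr0 hr => ?_) (fun r hr0 hr => ?_) h0 ht⟩
  · rw [hf r hr0 hr, hB r hr0 hr]; exact hC r ⟨hr0, hr⟩
  · rw [hB r hr0 hr.le]; exact hCx r ⟨hr0, hr.le⟩ hr
  · rw [hB r hr0.le hr]; exact hCb r ⟨hr0.le, hr⟩ hr0

theorem ExtendsAlong.exists_gt (e : ∀ (p : T) (v : V), Nonempty (Directions p ≃ Ω.Germs v))
    (h : D.ExtendsAlong x δ) (hx : x ∉ D.S) : ∃ D', D < D' := by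
  obtain ⟨f, B, hDfB, hloc⟩ := h.exists_localDev e
  refine ⟨⟨D.S ∪ toward b x '' Set.Icc 0 (dist b x), f, B, Or.inl D.base, ?_, ?_⟩,
    ⟨Set.subset_union_left, hDfB⟩,
    fun h => hx (h.1 (Or.inr ⟨dist b x, ⟨dist_nonneg, le_rfl⟩, by simp⟩))⟩
  · rintro q (hq | ⟨t, ⟨h0, ht⟩, rfl⟩) s
    · exact Or.inl (D.star q hq s)
    · obtain ⟨r, hr0, hr1, hr⟩ := exists_toward_toward_left b x h0 ht s
      exact Or.inr ⟨r, ⟨hr0, hr1.trans ht⟩, hr.symm⟩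
  · rintro q (hq | ⟨t, ⟨h0, ht⟩, rfl⟩)
    · exact (D.loc q hq).congr (fun t => (hDfB _ (D.star q hq t)).1)
        fun t => (hDfB _ (D.star q hq t)).2
    · exact hloc t h0 ht

theorem exists_gt_of_forall_lt_mem
    (e : ∀ (p : T) (v : V), Nonempty (Directions p ≃ Ω.Germs v))
    (hS : ∀ t, 0 ≤ t → t < dist b x → toward b x t ∈ D.S) (hx : x ∉ D.S) : ∃ D', D < D' := by
  have hpos : 0 < dist b x := dist_pos.2 (ne_of_mem_of_not_mem D.base hx)
  obtain ⟨v, hv⟩ := Ω.extend hpos fun t h0 ht => D.path_toward h0 ht.le (hS t h0 ht)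
  have hδ : ∀ t < dist b x,
      Function.update (fun s => D.f (toward b x s)) (dist b x) v t = D.f (toward b x t) :=
    fun t ht => Function.update_of_ne ht.ne _ _
  refine ExtendsAlong.exists_gt e ⟨hv, fun t _ ht h => ?_, fun t h0 ht _ => ?_,
    fun t h0 ht h => absurd (hS t h0.le ht) h⟩ hx
  · exact hδ t (ht.lt_of_ne fun htx => hx (by simpa [htx] using h))
  · obtain ⟨r, htr, hr⟩ := exists_between ht
    exact GermEq.trans (.of_lt (sub_pos.2 ht) fun s _ hs => hδ _ (by linarith))
      (D.out_toward h0 htr hr.le (hS r (h0.trans htr.le) hr))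

theorem exists_gt_of_germ (e : ∀ (p : T) (v : V), Nonempty (Directions p ≃ Ω.Germs v)) {σ : ℝ}
    (h0 : 0 ≤ σ) (hσx : σ < dist b x) (hS : toward b x σ ∈ D.S)
    (hnot : ∀ t, σ < t → t ≤ dist b x → toward b x t ∉ D.S)
    (hP : Ω.P (D.B (toward b x σ) x) 0 (dist b x - σ))
    (hred : IsReducedPath (D.B (toward b x σ) x) 0 (dist b x - σ)) : ∃ D', D < D' := by
  have hx : x ∉ D.S := by simpa using hnot _ hσx le_rfl
  have hle : ∀ t, t ≤ dist b x → toward b x t ∈ D.S → t ≤ σ := fun t ht h =>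
    not_lt.1 fun hlt => hnot t hlt ht h
  let γ := D.B (toward b x σ) x
  let δ : ℝ → V := fun t => if t ≤ σ then D.f (toward b x t) else γ (t - σ)
  have hδ1 : ∀ t, t ≤ σ → δ t = D.f (toward b x t) := fun t ht => if_pos ht
  have hδ2 : ∀ t, σ ≤ t → δ t = γ (t - σ) := by
    intro t ht
    rcases ht.lt_or_eq with h | rfl
    · exact if_neg (not_le.2 h)
    · obtain ⟨-, -, -, -, hγ0⟩ := (D.loc _ hS).chart.germ x (toward_ne_right h0 hσx)
      rw [hδ1 _ le_rfl, sub_self]; exact hγ0.symm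
  refine ExtendsAlong.exists_gt e (δ := δ) ⟨?_, fun t _ ht h => hδ1 t (hle t ht h),
    fun t ht0 ht h => ?_, fun t ht0 ht h => ?_⟩ hx
  · refine Ω.concat h0 hσx.le
      (Ω.congr (fun s hs => (hδ1 s hs.2).symm) (D.path_toward h0 hσx.le hS)) ?_
    have hshift := Ω.shift (-σ) hP
    rw [sub_neg_eq_add, zero_add, sub_neg_eq_add, sub_add_cancel] at hshift
    exact Ω.congr (fun s hs => by rw [hδ2 s hs.1, sub_eq_add_neg]) hshift
  · rcases (hle t ht.le h).lt_or_eq with hlt | rfl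
    · exact GermEq.trans (.of_lt (sub_pos.2 hlt) fun s _ hs => hδ1 _ (by linarith))
        (D.out_toward ht0 hlt hσx.le hS)
    · exact .of_lt one_pos fun s hs _ => by rw [hδ2 _ (by linarith), add_sub_cancel_left]
  · have hσt : σ < t := not_le.1 fun hle => h (D.toward_mem_of_le ht0.le hle hσx.le hS)
    refine fun hfold => hred (t - σ) (by linarith) (by linarith)
      (hfold.congr_of_lt (sub_pos.2 hσt) (fun s _ hs => ?_) fun s hs _ => ?_)
    · rw [hδ2 _ (by linarith), sub_right_comm]
    · rw [hδ2 _ (by linarith), add_sub_right_comm]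

theorem exists_gt_of_last_mem (e : ∀ (p : T) (v : V), Nonempty (Directions p ≃ Ω.Germs v)) {σ : ℝ}
    (h0 : 0 ≤ σ) (hσx : σ < dist b x) (hS : toward b x σ ∈ D.S)
    (hnot : ∀ t, σ < t → t ≤ dist b x → toward b x t ∉ D.S) : ∃ D', D < D' := by
  have hchart := (D.loc _ hS).chart
  obtain ⟨r, hr, hP, hred, -⟩ := hchart.germ x (toward_ne_right h0 hσx)
  let l := min (dist b x) (σ + r)
  have hσl : σ < l := lt_min hσx (by linarith)
  have hlx : l ≤ dist b x := min_le_left _ _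
  have hlr : l - σ ≤ r := by linarith [min_le_right (dist b x) (σ + r)]
  have hl : dist b (toward b x l) = l := dist_left_toward (h0.trans hσl.le) hlx
  have hpσ : toward b (toward b x l) σ = toward b x σ := toward_toward_left h0 hσl.le hlx
  have hB : D.B (toward b x σ) (toward b x l) = D.B (toward b x σ) x :=
    hchart.eq _ _ (toward_ne_toward h0 hσl hlx) (toward_ne_right h0 hσx)
      (gromovProd_toward_pos h0 hσl hlx)
  refine exists_gt_of_germ e (x := toward b x l) h0 (by rwa [hl]) (by rwa [hpσ])
    (fun t hσt ht => ?_) ?_ fun t ht0 ht => ?_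
  · rw [hl] at ht
    rw [toward_toward_left (h0.trans hσt.le) ht hlx]
    exact hnot t hσt (ht.trans hlx)
  · rw [hpσ, hB, hl]
    exact Ω.mono hP le_rfl (sub_pos.2 hσl).le hlr
  · rw [hl] at ht
    rw [hpσ, hB]
    exact hred t ht0 (ht.trans_le hlr)

theorem exists_gt (e : ∀ (p : T) (v : V), Nonempty (Directions p ≃ Ω.Germs v)) (hx : x ∉ D.S) :
    ∃ D', D < D' := by
  let J : Set ℝ := {t | 0 ≤ t ∧ t ≤ dist b x ∧ toward b x t ∈ D.S}
  have hJ0 : (0 : ℝ) ∈ J := ⟨le_rfl, dist_nonneg, by simpa using D.base⟩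
  have hJb : BddAbove J := ⟨dist b x, fun t ht => ht.2.1⟩
  let σ := sSup J
  have hσ0 : 0 ≤ σ := le_csSup hJb hJ0
  have hσx : σ ≤ dist b x := csSup_le ⟨0, hJ0⟩ fun t ht => ht.2.1
  by_cases hS : toward b x σ ∈ D.S
  · refine exists_gt_of_last_mem e hσ0 (hσx.lt_of_ne fun h => hx (by simpa [h] using hS)) hS
      fun t hσt ht h => ?_
    exact (le_csSup hJb (show t ∈ J from ⟨hσ0.trans hσt.le, ht, h⟩)).not_gt hσt
  · refine exists_gt_of_forall_lt_mem e (fun t h0 ht => ?_) hS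
    rw [dist_left_toward hσ0 hσx] at ht
    obtain ⟨r, hr, htr⟩ := exists_lt_of_lt_csSup ⟨0, hJ0⟩ ht
    rw [toward_toward_left h0 ht.le hσx]
    exact D.toward_mem_of_le h0 htr.le hr.2.1 hr.2.2

end Extension

end PartialDev

theorem nonempty_partialDev (e : ∀ (p : T) (v : V), Nonempty (Directions p ≃ Ω.Germs v)) (b : T)
    (v : V) : Nonempty (PartialDev (T := T) Ω b) := by
  obtain ⟨B, hB, -⟩ := exists_chart_of_equiv (e b v).some
  have hb : ∀ t, toward b b t = b := fun t =>
    (le_total t 0).elim toward_of_le fun h => toward_of_ge (by rwa [dist_self])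
  refine ⟨⟨{b}, fun _ => v, fun _ => B, rfl, ?_, ?_⟩⟩
  · rintro x rfl t
    exact hb t
  · rintro x rfl
    refine ⟨?_, hB, fun t h0 ht => absurd ht ?_, fun h => absurd rfl h⟩
    · rw [dist_self]; exact Ω.point _ _
    · rw [dist_self]; exact not_lt.2 h0

theorem exists_forall_localDev (e : ∀ (p : T) (v : V), Nonempty (Directions p ≃ Ω.Germs v))
    (b : T) (v : V) : ∃ (f : T → V) (B : T → T → ℝ → V), ∀ x, Ω.LocalDev b f B x := by
  have := nonempty_partialDev e b v
  obtain ⟨D, hmax⟩ := zorn_le_nonempty (α := PartialDev (T := T) Ω b)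
    fun c hc hne => PartialDev.bddAbove_of_chain hc hne
  refine ⟨D.f, D.B, fun x => D.loc x ?_⟩
  by_contra hx
  obtain ⟨D', hD'⟩ := PartialDev.exists_gt e hx
  exact hD'.not_ge (hmax hD'.le)

section Segments

variable {f : T → V} {x y z : T}

theorem path_toward_symm (h : Ω.P (fun s => f (toward x y s)) 0 (dist x y)) :
    Ω.P (fun s => f (toward y x s)) 0 (dist y x) := by
  have hback := Ω.backward h
  rw [sub_zero] at hback
  rw [dist_comm]
  exact Ω.congr (fun s hs => by rw [toward_comm hs.1 hs.2]) hback

theorem path_toward_right (hxyz : dist x z = dist x y + dist y z)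
    (h : Ω.P (fun s => f (toward x z s)) 0 (dist x z)) :
    Ω.P (fun s => f (toward y z s)) 0 (dist y z) := by
  have hle : dist x y ≤ dist x z := by linarith [@dist_nonneg _ _ y z]
  have hshift := Ω.shift (dist x y) (Ω.mono h dist_nonneg hle le_rfl)
  rw [sub_self, hxyz, add_sub_cancel_left] at hshift
  exact Ω.congr (fun s hs => by rw [add_comm, toward_right_add hxyz hs.1 hs.2]) hshift

theorem path_toward_concat (hxyz : dist x z = dist x y + dist y z)
    (hxy : Ω.P (fun s => f (toward x y s)) 0 (dist x y))
    (hyz : Ω.P (fun s => f (toward y z s)) 0 (dist y z)) :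
    Ω.P (fun s => f (toward x z s)) 0 (dist x z) := by
  refine Ω.concat dist_nonneg (by linarith [@dist_nonneg _ _ y z])
    (Ω.congr (fun s hs => by rw [toward_left_add hxyz hs.1 hs.2]) hxy) ?_
  have hshift := Ω.shift (-dist x y) hyz
  rw [sub_neg_eq_add, zero_add, sub_neg_eq_add, add_comm (dist y z), ← hxyz] at hshift
  refine Ω.congr (fun s hs => ?_) hshift
  rw [← toward_right_add hxyz (by linarith [hs.1]) (by linarith [hs.2])]
  ring_nf

end Segments

section Developing

variable {b : T} {f : T → V} {B : T → T → ℝ → V}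

theorem germEq_of_localDev (h : ∀ x, Ω.LocalDev b f B x) {x y : T} (hyx : y ≠ x) :
    GermEq (fun s => f (toward x y s)) (B x y) := by
  rcases (gromovProd_nonneg x y b).lt_or_eq with hpos | hzero
  · have hxb : x ≠ b := by
      rintro rfl
      linarith [gromovProd_le_right x y x, dist_self x]
    rw [(h x).chart.eq y b hyx hxb.symm hpos]
    exact GermEq.trans (.of_lt hpos fun s hs0 hs1 => by
      rw [toward_eq_of_le_gromovProd hs0 hs1.le]) ((h x).inn hxb)
  · have hbxy : dist b x + dist x y = dist b y := by
      unfold gromovProd at hzero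
      linarith [dist_comm x b, dist_comm y b]
    have hx : x = toward b y (dist b x) := eq_toward rfl (by linarith)
    have hout := (h y).out (dist b x) dist_nonneg (by linarith [dist_pos.2 hyx.symm])
    rwa [← hx] at hout

theorem path_of_localDev (h : ∀ x, Ω.LocalDev b f B x) (x y : T) :
    Ω.P (fun s => f (toward x y s)) 0 (dist x y) := by
  let r := toward b x (gromovProd b x y)
  have hr0 := gromovProd_nonneg b x y
  have hbr : dist b r = gromovProd b x y := dist_left_toward hr0 (gromovProd_le_left _ _ _)
  have hbx : dist b x = dist b r + dist r x := by
    rw [hbr, dist_toward_right hr0 (gromovProd_le_left _ _ _)]; ring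
  have hby : dist b y = dist b r + dist r y := by
    rw [hbr, show r = toward b y _ from toward_eq_of_le_gromovProd hr0 le_rfl,
      dist_toward_right hr0 (gromovProd_le_right _ _ _)]
    ring
  exact path_toward_concat (dist_toward_gromovProd b x y)
    (path_toward_symm (path_toward_right hbx (h x).path)) (path_toward_right hby (h y).path)

theorem exists_developing (e : ∀ (p : T) (v : V), Nonempty (Directions p ≃ Ω.Germs v)) (b : T)
    (v : V) : ∃ π : T → V, Ω.Developing π := by
  obtain ⟨f, B, h⟩ := exists_forall_localDev e b v
  refine ⟨f, path_of_localDev h, fun x y z hy hz h0 hyz => ?_, fun x γ hγ => ?_⟩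
  · exact (h x).chart.ne y z hy hz h0
      (((germEq_of_localDev h hy).symm.trans hyz).trans (germEq_of_localDev h hz))
  · obtain ⟨y, hy, hyγ⟩ := (h x).chart.surj γ hγ
    exact ⟨y, hy, (germEq_of_localDev h hy).trans hyγ⟩

end Developing

end PathClass

/-! ### Lifting along developing maps -/

namespace PathClass

variable {V : Type*} {Ω : PathClass V}

/-- A bijection which, with its inverse, preserves a class of paths. -/
def IsSymmetry (Ω : PathClass V) (Φ : V ≃ V) : Prop :=
  ∀ γ a b, Ω.P γ a b ↔ Ω.P (fun s => Φ (γ s)) a b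

theorem IsSymmetry.symm {Φ : V ≃ V} (hΦ : Ω.IsSymmetry Φ) : Ω.IsSymmetry Φ.symm := fun γ a b => by
  simpa only [Equiv.apply_symm_apply] using (hΦ (fun s => Φ.symm (γ s)) a b).symm

variable {T : Type*} [MetricSpace T] [GeodesicTree T] {π : T → V} {γ γ' : ℝ → V} {x y z z' : T}
  {s t l : ℝ}

/-- The segment from `x` to `z` has length `t` and develops onto the restriction of `γ` to
`[0, t]`. -/
def IsLift (π : T → V) (γ : ℝ → V) (x : T) (t : ℝ) (z : T) : Prop :=
  dist x z = t ∧ ∀ s, 0 ≤ s → s ≤ t → π (toward x z s) = γ s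

theorem IsLift.map_eq (h : IsLift π γ x t z) : π z = γ t := by
  obtain ⟨rfl, h⟩ := h
  simpa using h (dist x z) dist_nonneg le_rfl

theorem isLift_zero (h : γ 0 = π x) : IsLift π γ x 0 x :=
  ⟨dist_self x, fun s h0 h1 => by rw [h1.antisymm h0, toward_zero, h]⟩

theorem dist_of_not_germEq (hγ : ¬ GermEq γ γ') (hz : IsLift π γ x s z)
    (hz' : IsLift π γ' x t z') : dist z z' = s + t := by
  have hzero : gromovProd x z z' = 0 := by
    by_contra hne
    refine hγ (.of_lt ((gromovProd_nonneg x z z').lt_of_ne' hne) fun r hr0 hr => ?_)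
    rw [← hz.2 r hr0 (hr.le.trans (hz.1 ▸ gromovProd_le_left x z z')),
      ← hz'.2 r hr0 (hr.le.trans (hz'.1 ▸ gromovProd_le_right x z z')),
      toward_eq_of_le_gromovProd hr0 hr.le]
  unfold gromovProd at hzero
  linarith [hz.1, hz'.1]

theorem gromovProd_eq_zero_of_isLift {y : T} (hz : IsLift π γ x t z) (hred : IsReducedPath γ 0 l)
    (ht : t < l) (hy : GermEq (fun s => π (toward z y s)) fun s => γ (t + s)) :
    gromovProd z x y = 0 := by
  by_contra hne
  have hpos := (gromovProd_nonneg z x y).lt_of_ne' hne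
  have hle : gromovProd z x y ≤ t := by
    rw [← hz.1, dist_comm]
    exact gromovProd_le_left _ _ _
  refine hred t (hpos.trans_le hle) ht (GermEq.trans (.of_lt hpos fun s hs0 hs1 => ?_) hy)
  have hst := hs1.le.trans hle
  rw [← toward_eq_of_le_gromovProd hs0 hs1.le, toward_comm hs0 (by rwa [hz.1]), hz.1,
    hz.2 _ (by linarith) (by linarith)]

namespace Developing

theorem isReducedPath (hπ : Ω.Developing π) (x y : T) :
    IsReducedPath (fun s => π (toward x y s)) 0 (dist x y) := by
  intro t h0 h1 hfold
  have hdist := dist_left_toward h0.le h1.le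
  refine hπ.inj (toward x y t) x y (toward_ne_left h0 h1.le) (toward_ne_right h0.le h1)
    (gromovProd_toward_eq_zero h0.le h1.le) (hfold.congr_of_lt (lt_min h0 (sub_pos.2 h1))
      (fun s hs0 hs => ?_) fun s hs0 hs => ?_)
  · have hst := (lt_min_iff.1 hs).1
    rw [toward_comm (x := x) hs0 (by rw [hdist]; exact hst.le), hdist,
      toward_toward_left (by linarith) (by linarith) h1.le]
  · have hsd := (lt_min_iff.1 hs).2
    rw [toward_toward_right h0.le hs0 (by linarith)]

theorem le_gromovProd_of_agree (hπ : Ω.Developing π) {r : ℝ} (hz : r ≤ dist x z)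
    (hz' : r ≤ dist x z') (h : ∀ s, 0 ≤ s → s ≤ r → π (toward x z s) = π (toward x z' s)) :
    r ≤ gromovProd x z z' := by
  by_contra! hlt
  have hc0 := gromovProd_nonneg x z z'
  have hbranch := dist_toward_gromovProd x z z'
  set c := gromovProd x z z'
  have hc : toward x z c = toward x z' c := toward_eq_of_le_gromovProd hc0 le_rfl
  refine hπ.inj (toward x z c) z z' (toward_ne_right hc0 (hlt.trans_le hz))
    (hc ▸ toward_ne_right hc0 (hlt.trans_le hz')) ?_
    (.of_lt (sub_pos.2 hlt) fun s h0 h1 => ?_)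
  · unfold gromovProd
    linarith [dist_comm z (toward x z c)]
  · rw [toward_toward_right hc0 h0 (by linarith), hc, toward_toward_right hc0 h0 (by linarith)]
    exact h _ (by linarith) (by linarith)

theorem eq_of_agree (hπ : Ω.Developing π) (hd : dist x z = dist x z')
    (h : ∀ s, 0 ≤ s → s ≤ dist x z → π (toward x z s) = π (toward x z' s)) : z = z' := by
  have hz := toward_eq_of_le_gromovProd dist_nonneg (hπ.le_gromovProd_of_agree le_rfl hd.le h)
  rwa [toward_dist, hd, toward_dist] at hz

theorem eq_toward_of_isLift (hπ : Ω.Developing π) (h0 : 0 ≤ s) (hst : s ≤ t)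
    (hz : IsLift π γ x s z) (hz' : IsLift π γ x t z') : z = toward x z' s := by
  have hle : s ≤ dist x z' := by rwa [hz'.1]
  refine hπ.eq_of_agree (x := x) (by rw [hz.1, dist_left_toward h0 hle]) fun r hr0 hr => ?_
  rw [hz.1] at hr
  rw [toward_toward_left hr0 hr hle, hz.2 r hr0 hr, hz'.2 r hr0 (hr.trans hst)]

theorem dist_of_isLift (hπ : Ω.Developing π) (h0 : 0 ≤ s) (hst : s ≤ t)
    (hz : IsLift π γ x s z) (hz' : IsLift π γ x t z') : dist z z' = t - s := by
  rw [hπ.eq_toward_of_isLift h0 hst hz hz', dist_toward_right h0 (by rwa [hz'.1]), hz'.1]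

theorem isometry_ext (hπ : Ω.Developing π) {g g' : T → T} (hg : Isometry g) (hg' : Isometry g')
    (hx : g x = g' x) (h : ∀ z, π (g z) = π (g' z)) : g = g' := by
  funext z
  refine hπ.eq_of_agree (x := g x) (by rw [hg.dist_eq, hx, hg'.dist_eq]) fun s hs0 hs1 => ?_
  rw [hg.dist_eq] at hs1
  rw [← map_toward hg hs0 hs1, h, map_toward hg' hs0 hs1, hx]

theorem line_ext_of_nonneg (hπ : Ω.Developing π) {f f' : ℝ → T} (hf : Isometry f)
    (hf' : Isometry f') (h0 : f 0 = f' 0) (h : ∀ t, π (f t) = π (f' t)) (ht : 0 ≤ t) :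
    f t = f' t := by
  have hd : dist (f 0) (f t) = t := by
    rw [hf.dist_eq, Real.dist_eq, zero_sub, abs_neg, abs_of_nonneg ht]
  refine hπ.eq_of_agree (x := f 0) (by rw [hf.dist_eq, h0, hf'.dist_eq]) fun s hs0 hs1 => ?_
  rw [hd] at hs1
  rw [toward_line hf hs0 hs1, h0, toward_line hf' hs0 hs1, h]

theorem line_ext (hπ : Ω.Developing π) {f f' : ℝ → T} (hf : Isometry f) (hf' : Isometry f')
    (h0 : f 0 = f' 0) (h : ∀ t, π (f t) = π (f' t)) : f = f' := by
  funext t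
  rcases le_total 0 t with ht | ht
  · exact hπ.line_ext_of_nonneg hf hf' h0 h ht
  · have hneg : Isometry fun t : ℝ => -t := isometry_neg
    simpa using hπ.line_ext_of_nonneg (hf.comp hneg) (hf'.comp hneg) (by simpa using h0)
      (fun t => h (-t)) (neg_nonneg.2 ht)

section Lifting

theorem exists_isLift_add (hπ : Ω.Developing π) (hP : Ω.P γ 0 l) (hred : IsReducedPath γ 0 l)
    (h0 : 0 ≤ t) (ht : t < l) (hz : IsLift π γ x t z) :
    ∃ r > 0, t + r ≤ l ∧ ∃ w, IsLift π γ x (t + r) w := by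
  obtain ⟨y, hy, hyγ⟩ := hπ.surj z _ (hz.map_eq ▸ isGerm_forward hP hred h0 ht)
  have hxy : dist x y = dist x z + dist z y := by
    have hzero := gromovProd_eq_zero_of_isLift hz hred ht hyγ
    unfold gromovProd at hzero
    linarith [dist_comm x z]
  obtain ⟨e, he, hyγ⟩ := hyγ.exists_pos
  obtain ⟨r, hr0, hr⟩ : ∃ r > 0, r ≤ min (min e (dist z y)) (l - t) :=
    ⟨_, lt_min (lt_min he (dist_pos.2 hy.symm)) (sub_pos.2 ht), le_rfl⟩
  obtain ⟨⟨hre, hry⟩, hrl⟩ := (le_min_iff.1 hr).imp_left le_min_iff.1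
  have hle : t + r ≤ dist x y := by linarith [hz.1]
  refine ⟨r, hr0, by linarith, toward x y (t + r), dist_left_toward (by linarith) hle,
    fun s hs0 hs => ?_⟩
  rw [toward_toward_left hs0 hs hle]
  rcases le_total s t with hst | hts
  · rw [toward_left_add hxy hs0 (by rwa [hz.1]), hz.2 s hs0 hst]
  · have hright := toward_right_add hxy (sub_nonneg.2 hts) (by linarith)
    rw [hz.1, add_sub_cancel] at hright
    rw [hright, hyγ (s - t) (by linarith) (by linarith), add_sub_cancel]

variable [CompleteSpace T]

theorem exists_tendsto_of_isLift (hπ : Ω.Developing π) {u : ℕ → ℝ} {v : ℕ → T} (hu0 : ∀ n, 0 ≤ u n)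
    (humono : Monotone u) (hu : Tendsto u atTop (𝓝 t)) (hv : ∀ n, IsLift π γ x (u n) (v n)) :
    ∃ w, dist x w = t ∧ ∀ n, v n = toward x w (u n) := by
  have hdist : ∀ m n, m ≤ n → dist (v m) (v n) = u n - u m := fun m n hmn =>
    hπ.dist_of_isLift (hu0 m) (humono hmn) (hv m) (hv n)
  have hcauchy : CauchySeq v := by
    refine Metric.cauchySeq_iff'.2 fun ε hε => ?_
    obtain ⟨N, hN⟩ := Metric.cauchySeq_iff'.1 hu.cauchySeq ε hε
    refine ⟨N, fun n hn => ?_⟩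
    rw [dist_comm, hdist N n hn]
    exact (le_abs_self _).trans_lt (hN n hn)
  obtain ⟨w, hw⟩ := cauchySeq_tendsto_of_complete hcauchy
  have hxw : dist x w = t :=
    tendsto_nhds_unique (tendsto_const_nhds.dist hw) (by simpa only [(hv _).1] using hu)
  refine ⟨w, hxw, fun m => eq_toward (hv m).1 ?_⟩
  rw [hxw]
  refine tendsto_nhds_unique (tendsto_const_nhds.dist hw) ((hu.sub_const (u m)).congr' ?_)
  filter_upwards [eventually_ge_atTop m] with n hn
  exact (hdist m n hn).symm

theorem exists_isLift_of_tendsto (hπ : Ω.Developing π) (hP : Ω.P γ 0 t) (hx : γ 0 = π x)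
    {u : ℕ → ℝ} {v : ℕ → T} (hu0 : ∀ n, 0 ≤ u n) (humono : Monotone u)
    (hu : Tendsto u atTop (𝓝 t)) (hv : ∀ n, IsLift π γ x (u n) (v n)) :
    ∃ w, IsLift π γ x t w := by
  obtain ⟨w, hxw, hvw⟩ := hπ.exists_tendsto_of_isLift hu0 humono hu hv
  have hagree : ∀ s, 0 ≤ s → s < t → π (toward x w s) = γ s := by
    intro s hs0 hs
    obtain ⟨m, hm⟩ := (hu.eventually (lt_mem_nhds hs)).exists
    rw [← (hv m).2 s hs0 hm.le, hvw m,
      toward_toward_left hs0 hm.le (hxw ▸ humono.ge_of_tendsto hu m)]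
  refine ⟨w, hxw, fun s hs0 hs => ?_⟩
  rcases hs.lt_or_eq with hlt | rfl
  · exact hagree s hs0 hlt
  · rcases hs0.lt_or_eq with hpos | rfl
    · exact Ω.eq_right hpos (hxw ▸ hπ.path x w) hP fun r hr => hagree r hr.1 hr.2
    · rw [toward_zero, hx]

theorem exists_isLift (hπ : Ω.Developing π) (hl : 0 ≤ l) (hP : Ω.P γ 0 l)
    (hred : IsReducedPath γ 0 l) (hx : γ 0 = π x) : ∃ z, IsLift π γ x l z := by
  let I : Set ℝ := {t | 0 ≤ t ∧ t ≤ l ∧ ∃ z, IsLift π γ x t z}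
  have hI0 : (0 : ℝ) ∈ I := ⟨le_rfl, hl, x, isLift_zero hx⟩
  have hIb : BddAbove I := ⟨l, fun t ht => ht.2.1⟩
  have hσ0 : 0 ≤ sSup I := le_csSup hIb hI0
  have hσl : sSup I ≤ l := csSup_le ⟨0, hI0⟩ fun t ht => ht.2.1
  obtain ⟨z, hz⟩ : ∃ z, IsLift π γ x (sSup I) z := by
    obtain ⟨u, humono, hu, huI⟩ := exists_seq_tendsto_sSup ⟨0, hI0⟩ hIb
    choose hu0 _ v hv using huI
    exact hπ.exists_isLift_of_tendsto (Ω.mono hP le_rfl hσ0 hσl) hx hu0 humono hu hv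
  rcases hσl.lt_or_eq with hlt | heq
  · obtain ⟨r, hr, hrl, w, hw⟩ := hπ.exists_isLift_add hP hred hσ0 hlt hz
    linarith [le_csSup hIb (show sSup I + r ∈ I from ⟨by linarith, hrl, w, hw⟩)]
  · exact ⟨z, heq ▸ hz⟩

end Lifting

section Isometries

variable [CompleteSpace T] {Φ : V ≃ V}

theorem exists_isometry (hπ : Ω.Developing π) (hΦ : Ω.IsSymmetry Φ) (hxy : Φ (π x) = π y) :
    ∃ g : T → T, Isometry g ∧ g x = y ∧ ∀ z, π (g z) = Φ (π z) := by
  have hlift : ∀ z, ∃ w, dist y w = dist x z ∧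
      ∀ s, 0 ≤ s → s ≤ dist x z → π (toward y w s) = Φ (π (toward x z s)) := fun z =>
    hπ.exists_isLift dist_nonneg ((hΦ _ _ _).1 (hπ.path x z))
      (fun t h0 h1 h => hπ.isReducedPath x z t h0 h1 (h.mono fun _ hs => Φ.injective hs))
      (by rw [toward_zero, hxy])
  choose g hgd hgπ using hlift
  have hgromov : ∀ z z', gromovProd y (g z) (g z') = gromovProd x z z' := by
    intro z z'
    refine le_antisymm (hπ.le_gromovProd_of_agree ?_ ?_ fun s hs0 hs1 => Φ.injective ?_)
      (hπ.le_gromovProd_of_agree ?_ ?_ fun s hs0 hs1 => ?_)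
    · rw [← hgd]; exact gromovProd_le_left _ _ _
    · rw [← hgd]; exact gromovProd_le_right _ _ _
    · rw [← hgπ z s hs0 (by rw [← hgd]; exact hs1.trans (gromovProd_le_left _ _ _)),
        ← hgπ z' s hs0 (by rw [← hgd]; exact hs1.trans (gromovProd_le_right _ _ _)),
        toward_eq_of_le_gromovProd hs0 hs1]
    · rw [hgd]; exact gromovProd_le_left _ _ _
    · rw [hgd]; exact gromovProd_le_right _ _ _
    · rw [hgπ z s hs0 (hs1.trans (gromovProd_le_left _ _ _)),
        hgπ z' s hs0 (hs1.trans (gromovProd_le_right _ _ _)), toward_eq_of_le_gromovProd hs0 hs1]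
  refine ⟨g, Isometry.of_dist_eq fun z z' => ?_, ?_, fun z => ?_⟩
  · have hzz' := hgromov z z'
    unfold gromovProd at hzz'
    linarith [hgd z, hgd z']
  · exact (dist_eq_zero.1 ((hgd x).trans (dist_self x))).symm
  · simpa using IsLift.map_eq (γ := fun s => Φ (π (toward x z s))) ⟨hgd z, hgπ z⟩

theorem exists_isometryEquiv (hπ : Ω.Developing π) (hΦ : Ω.IsSymmetry Φ) (hxy : Φ (π x) = π y) :
    ∃ g : T ≃ᵢ T, g x = y ∧ ∀ z, π (g z) = Φ (π z) := by
  obtain ⟨g, hg, hgx, hgπ⟩ := hπ.exists_isometry hΦ hxy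
  obtain ⟨g', hg', hgx', hgπ'⟩ := hπ.exists_isometry hΦ.symm (x := y) (y := x) (by simp [← hxy])
  have hleft : g' ∘ g = id := hπ.isometry_ext (hg'.comp hg) isometry_id (x := x)
    (by simp [hgx, hgx']) fun z => by simp [hgπ, hgπ']
  have hright : g ∘ g' = id := hπ.isometry_ext (hg.comp hg') isometry_id (x := y)
    (by simp [hgx, hgx']) fun z => by simp [hgπ, hgπ']
  exact ⟨⟨⟨g, g', congrFun hleft, congrFun hright⟩, hg⟩, hgx, hgπ⟩

end Isometries

section Lines

theorem dist_glue_rays (hπ : Ω.Developing π) (hγ : ¬ GermEq (fun s => γ (-s)) γ) {p q : ℝ → T}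
    (hp : ∀ t, 0 ≤ t → IsLift π γ x t (p t))
    (hq : ∀ t, 0 ≤ t → IsLift π (fun s => γ (-s)) x t (q t)) (hst : s ≤ t) :
    dist (if 0 ≤ s then p s else q (-s)) (if 0 ≤ t then p t else q (-t)) = t - s := by
  rcases le_or_gt 0 s with hs | hs
  · rw [if_pos hs, if_pos (hs.trans hst),
      hπ.dist_of_isLift hs hst (hp s hs) (hp t (hs.trans hst))]
  · have hs' : 0 ≤ -s := by linarith
    rw [if_neg hs.not_ge]
    rcases le_or_gt 0 t with ht | ht
    · rw [if_pos ht, dist_of_not_germEq hγ (hq _ hs') (hp t ht)]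
      ring
    · have ht' : 0 ≤ -t := by linarith
      rw [if_neg ht.not_ge, dist_comm,
        hπ.dist_of_isLift ht' (neg_le_neg hst) (hq _ ht') (hq _ hs')]
      ring

theorem exists_line [CompleteSpace T] (hπ : Ω.Developing π) (hP : ∀ a b, a ≤ b → Ω.P γ a b)
    (hred : ∀ a b, IsReducedPath γ a b) (hx : γ 0 = π x) :
    ∃ f : ℝ → T, Isometry f ∧ f 0 = x ∧ ∀ t, π (f t) = γ t := by
  have hP' : ∀ b, 0 ≤ b → Ω.P (fun s => γ (-s)) 0 b := fun b hb => by
    simpa using Ω.rev (hP (-b) 0 (by linarith))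
  have hred' : ∀ b, IsReducedPath (fun s => γ (-s)) 0 b := fun b t _ _ h =>
    hred (-t - 1) (-t + 1) (-t) (by linarith) (by linarith)
      (by simpa only [neg_sub, neg_add, sub_eq_add_neg, neg_neg, add_comm] using h.symm)
  have : Nonempty T := ⟨x⟩
  choose! p hp using fun (t : ℝ) (ht : 0 ≤ t) => hπ.exists_isLift ht (hP 0 t ht) (hred 0 t) hx
  choose! q hq using fun (t : ℝ) (ht : 0 ≤ t) =>
    hπ.exists_isLift ht (hP' t ht) (hred' t) (by simpa using hx)
  have hfold : ¬ GermEq (fun s => γ (-s)) γ := by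
    simpa using hred (-1) 1 0 (by norm_num) (by norm_num)
  have hdist : ∀ s t, s ≤ t →
      dist (if 0 ≤ s then p s else q (-s)) (if 0 ≤ t then p t else q (-t)) = t - s :=
    fun s t => hπ.dist_glue_rays hfold hp hq
  refine ⟨fun t => if 0 ≤ t then p t else q (-t), Isometry.of_dist_eq fun s t => ?_, ?_,
    fun t => ?_⟩
  · rw [Real.dist_eq]
    rcases le_total s t with h | h
    · rw [hdist s t h, abs_sub_comm, abs_of_nonneg (sub_nonneg.2 h)]
    · rw [dist_comm, hdist t s h, abs_of_nonneg (sub_nonneg.2 h)]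
  · simpa using (dist_eq_zero.1 (hp 0 le_rfl).1).symm
  · rcases le_or_gt 0 t with h | h
    · simpa [h] using (hp t h).map_eq
    · simpa [h.not_ge] using (hq (-t) (by linarith)).map_eq

end Lines

end Developing

end PathClass

/-! ### Labelled paths -/

theorem lipschitzOnWith_Icc_union {f : ℝ → ℝ} {K : NNReal} {a b c : ℝ}
    (h : LipschitzOnWith K f (Set.Icc a b)) (h' : LipschitzOnWith K f (Set.Icc b c)) :
    LipschitzOnWith K f (Set.Icc a c) := by
  have key : ∀ s ∈ Set.Icc a c, ∀ t ∈ Set.Icc a c, s ≤ t → dist (f s) (f t) ≤ K * dist s t := by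
    intro s hs t ht hst
    rcases le_total t b with htb | hbt
    · exact h.dist_le_mul s ⟨hs.1, hst.trans htb⟩ t ⟨ht.1, htb⟩
    rcases le_total b s with hbs | hsb
    · exact h'.dist_le_mul s ⟨hbs, hs.2⟩ t ⟨hbt, ht.2⟩
    calc dist (f s) (f t) ≤ dist (f s) (f b) + dist (f b) (f t) := dist_triangle _ _ _
      _ ≤ K * dist s b + K * dist b t := add_le_add
          (h.dist_le_mul s ⟨hs.1, hsb⟩ b ⟨hs.1.trans hsb, le_rfl⟩)
          (h'.dist_le_mul b ⟨le_rfl, hbt.trans ht.2⟩ t ⟨hbt, ht.2⟩)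
      _ = K * dist s t := by
        rw [← mul_add, dist_add_dist_of_mem_segment]
        rw [segment_eq_Icc hst]
        exact ⟨hsb, hbt⟩
  refine LipschitzOnWith.of_dist_le_mul fun s hs t ht => ?_
  rcases le_total s t with hst | hts
  · exact key s hs t ht hst
  · rw [dist_comm (f s), dist_comm s]
    exact key t ht s hs hts

theorem lipschitzOnWith_of_eqOn {α β : Type*} [PseudoEMetricSpace α] [PseudoEMetricSpace β]
    {f g : α → β} {K : NNReal} {s : Set α} (h : LipschitzOnWith K f s) (hfg : Set.EqOn f g s) :
    LipschitzOnWith K g s := fun x hx y hy => by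
  rw [← hfg hx, ← hfg hy]
  exact h hx hy

theorem eq_add_smul_of_eventually {E : Type*} [AddCommGroup E] [Module ℝ E] {γ ν : ℝ → E}
    (h : ∀ t, ∀ᶠ u in 𝓝 t, γ u = γ t + (u - t) • ν t) (t : ℝ) : γ t = γ 0 + t • ν 0 := by
  have hν : IsLocallyConstant ν := by
    refine (IsLocallyConstant.iff_eventually_eq ν).2 fun t => ?_
    filter_upwards [h t, eventually_eventually_nhds.2 (h t)] with u hu hut
    obtain ⟨v, ⟨hvt, hvu⟩, hne⟩ :=
      (((hut.and (h u)).filter_mono nhdsWithin_le_nhds).and self_mem_nhdsWithin :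
        ∀ᶠ v in 𝓝[≠] u, _).exists
    have hsmul : (v - u) • ν u = (v - u) • ν t := by
      refine add_left_cancel (a := γ u) ?_
      rw [← hvu, hvt, hu, add_assoc, ← add_smul, add_comm (u - t), sub_add_sub_cancel]
    exact smul_right_injective E (sub_ne_zero.2 hne) hsmul
  have hγ : IsLocallyConstant fun t => γ t - t • ν 0 := by
    refine (IsLocallyConstant.iff_eventually_eq _).2 fun t => ?_
    filter_upwards [h t] with u hu
    rw [hu, hν.apply_eq_of_preconnectedSpace t 0, sub_smul]
    abel
  have hconst := hγ.apply_eq_of_preconnectedSpace t 0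
  rw [zero_smul, sub_zero] at hconst
  rw [← hconst, sub_add_cancel]

section LabelledPaths

variable {A : Type}

/-- The velocity of a path with label `a`: unit speed in the height, which is the coordinate `none`,
and in the coordinate `a`. -/
noncomputable def labelVec (a : A) : Option A → ℝ := by
  classical exact fun o => if o = none ∨ o = some a then 1 else 0

@[simp] theorem labelVec_none (a : A) : labelVec a none = 1 := by simp [labelVec]

@[simp] theorem labelVec_self (a : A) : labelVec a (some a) = 1 := by simp [labelVec]

theorem labelVec_of_ne {a a' : A} (h : a' ≠ a) : labelVec a (some a') = 0 := by
  simp [labelVec, h]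

theorem labelVec_injective : Function.Injective (labelVec : A → Option A → ℝ) := by
  intro a a' h
  by_contra hne
  simpa [labelVec_of_ne hne] using congrFun h (some a)

theorem labelVec_map (a : A) (σ : Equiv.Perm A) (o : Option A) :
    labelVec a (o.map σ) = labelVec (σ.symm a) o := by
  have h : o.map σ = some a ↔ o = some (σ.symm a) := by
    cases o <;> simp [σ.eq_symm_apply]
  classical exact if_congr (or_congr Option.map_eq_none_iff h) rfl rfl

theorem abs_labelVec_le_one (a : A) (o : Option A) : |labelVec a o| ≤ 1 := by
  unfold labelVec
  split_ifs <;> simp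

/-- The velocities of paths moving with a constant label, up or down. -/
def velocities (A : Type) : Set (Option A → ℝ) := {ν | ∃ a, ν = labelVec a ∨ ν = -labelVec a}

theorem labelVec_mem_velocities (a : A) : labelVec a ∈ velocities A := ⟨a, Or.inl rfl⟩

theorem neg_mem_velocities {ν : Option A → ℝ} : ν ∈ velocities A → -ν ∈ velocities A := by
  rintro ⟨a, rfl | rfl⟩
  exacts [⟨a, Or.inr rfl⟩, ⟨a, Or.inl (neg_neg _)⟩]

theorem comp_map_mem_velocities {ν : Option A → ℝ} (σ : Equiv.Perm A) :
    ν ∈ velocities A → ν ∘ Option.map σ ∈ velocities A := by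
  rintro ⟨a, rfl | rfl⟩
  · exact ⟨σ.symm a, Or.inl (funext (labelVec_map a σ))⟩
  · exact ⟨σ.symm a, Or.inr (funext fun o => congrArg Neg.neg (labelVec_map a σ o))⟩

/-- Translation by `w` composed with the relabelling by `σ`. -/
def relabel (w : Option A → ℝ) (σ : Equiv.Perm A) : (Option A → ℝ) ≃ (Option A → ℝ) where
  toFun v o := w o + v (o.map σ)
  invFun v o := -w (o.map σ.symm) + v (o.map σ.symm)
  left_inv v := by funext o; simp
  right_inv v := by funext o; simp

theorem relabel_apply (w : Option A → ℝ) (σ : Equiv.Perm A) (v : Option A → ℝ) (o : Option A) :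
    relabel w σ v o = w o + v (o.map σ) := rfl

theorem relabel_add_smul (w : Option A → ℝ) (σ : Equiv.Perm A) (v ν : Option A → ℝ) (t : ℝ) :
    relabel w σ (v + t • ν) = relabel w σ v + t • (ν ∘ Option.map σ) := by
  funext o
  simp only [relabel_apply, Pi.add_apply, Pi.smul_apply, Function.comp_apply, add_assoc]

/-- The path `γ` moves with a constant label on `[s, t]`. -/
def IsPure (γ : ℝ → Option A → ℝ) (s t : ℝ) : Prop :=
  ∃ ν ∈ velocities A, ∀ u ∈ Set.Icc s t, ∀ v ∈ Set.Icc s t, γ v = γ u + (v - u) • ν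

namespace IsPure

variable {γ γ' : ℝ → Option A → ℝ} {s t : ℝ}

theorem congr (h : Set.EqOn γ γ' (Set.Icc s t)) (H : IsPure γ s t) : IsPure γ' s t := by
  obtain ⟨ν, hν, H⟩ := H
  exact ⟨ν, hν, fun u hu v hv => by rw [← h hu, ← h hv, H u hu v hv]⟩

theorem shift (c : ℝ) (H : IsPure γ s t) : IsPure (fun r => γ (r + c)) (s - c) (t - c) := by
  obtain ⟨ν, hν, H⟩ := H
  refine ⟨ν, hν, fun u hu v hv => ?_⟩
  simpa using H _ (Set.add_mem_Icc_iff_left.2 hu) _ (Set.add_mem_Icc_iff_left.2 hv)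

theorem rev (H : IsPure γ s t) : IsPure (fun r => γ (-r)) (-t) (-s) := by
  obtain ⟨ν, hν, H⟩ := H
  refine ⟨-ν, neg_mem_velocities hν, fun u hu v hv => ?_⟩
  have h := H _ (Set.neg_mem_Icc_iff.2 hu) _ (Set.neg_mem_Icc_iff.2 hv)
  rwa [← neg_smul_neg, neg_sub, sub_neg_eq_add, neg_add_eq_sub] at h

theorem map (w : Option A → ℝ) (σ : Equiv.Perm A) (H : IsPure γ s t) :
    IsPure (fun r => relabel w σ (γ r)) s t := by
  obtain ⟨ν, hν, H⟩ := H
  exact ⟨_, comp_map_mem_velocities σ hν, fun u hu v hv =>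
    (congrArg (relabel w σ) (H u hu v hv)).trans (relabel_add_smul w σ _ _ _)⟩

end IsPure

/-- Labelled paths: Lipschitz paths with countably many moving coordinates, whose label is locally
constant on a dense open set. -/
structure IsLabelledPath (γ : ℝ → Option A → ℝ) (a b : ℝ) : Prop where
  lip : ∀ o, LipschitzOnWith 1 (fun s => γ s o) (Set.Icc a b)
  countable : ∃ C : Set (Option A), C.Countable ∧
    ∀ o ∉ C, ∀ s ∈ Set.Icc a b, ∀ t ∈ Set.Icc a b, γ s o = γ t o
  pure : ∀ s t, a ≤ s → s < t → t ≤ b → ∃ s' t', s ≤ s' ∧ s' < t' ∧ t' ≤ t ∧ IsPure γ s' t'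

namespace IsLabelledPath

variable {γ γ' : ℝ → Option A → ℝ} {a b c : ℝ}

theorem point (γ : ℝ → Option A → ℝ) (a : ℝ) : IsLabelledPath γ a a where
  lip o := LipschitzOnWith.of_dist_le_mul fun s hs t ht => by
    rw [Set.Icc_self, Set.mem_singleton_iff] at hs ht
    simp [hs, ht]
  countable := ⟨∅, Set.countable_empty, fun o _ s hs t ht => by
    rw [Set.Icc_self, Set.mem_singleton_iff] at hs ht
    rw [hs, ht]⟩
  pure _ _ h1 h2 h3 := absurd (h1.trans_lt h2) (not_lt.2 h3)

theorem congr (h : Set.EqOn γ γ' (Set.Icc a b)) (H : IsLabelledPath γ a b) :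
    IsLabelledPath γ' a b where
  lip o := lipschitzOnWith_of_eqOn (H.lip o) fun s hs => congrFun (h hs) o
  countable := by
    obtain ⟨C, hC, hconst⟩ := H.countable
    exact ⟨C, hC, fun o ho s hs t ht => by rw [← h hs, ← h ht, hconst o ho s hs t ht]⟩
  pure s t h1 h2 h3 := by
    obtain ⟨s', t', h4, h5, h6, hp⟩ := H.pure s t h1 h2 h3
    exact ⟨s', t', h4, h5, h6,
      hp.congr (h.mono (Set.Icc_subset_Icc (h1.trans h4) (h6.trans h3)))⟩

theorem mono {a' b' : ℝ} (H : IsLabelledPath γ a b) (ha : a ≤ a') (hb : b' ≤ b) :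
    IsLabelledPath γ a' b' where
  lip o := (H.lip o).mono (Set.Icc_subset_Icc ha hb)
  countable := by
    obtain ⟨C, hC, hconst⟩ := H.countable
    have hsub := Set.Icc_subset_Icc ha hb
    exact ⟨C, hC, fun o ho s hs t ht => hconst o ho s (hsub hs) t (hsub ht)⟩
  pure s t h1 h2 h3 := H.pure s t (ha.trans h1) h2 (h3.trans hb)

theorem shift (c : ℝ) (H : IsLabelledPath γ a b) :
    IsLabelledPath (fun s => γ (s + c)) (a - c) (b - c) where
  lip o := LipschitzOnWith.of_dist_le_mul fun s hs t ht => by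
    simpa only [dist_add_right] using (H.lip o).dist_le_mul _ (Set.add_mem_Icc_iff_left.2 hs) _
      (Set.add_mem_Icc_iff_left.2 ht)
  countable := by
    obtain ⟨C, hC, hconst⟩ := H.countable
    exact ⟨C, hC, fun o ho s hs t ht => hconst o ho _ (Set.add_mem_Icc_iff_left.2 hs) _
      (Set.add_mem_Icc_iff_left.2 ht)⟩
  pure s t h1 h2 h3 := by
    obtain ⟨s', t', h4, h5, h6, hp⟩ := H.pure (s + c) (t + c) (by linarith) (by linarith)
      (by linarith)
    exact ⟨s' - c, t' - c, by linarith, by linarith, by linarith, hp.shift c⟩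

theorem rev (H : IsLabelledPath γ a b) : IsLabelledPath (fun s => γ (-s)) (-b) (-a) where
  lip o := LipschitzOnWith.of_dist_le_mul fun s hs t ht => by
    simpa only [dist_neg_neg] using (H.lip o).dist_le_mul _ (Set.neg_mem_Icc_iff.2 hs) _
      (Set.neg_mem_Icc_iff.2 ht)
  countable := by
    obtain ⟨C, hC, hconst⟩ := H.countable
    exact ⟨C, hC, fun o ho s hs t ht => hconst o ho _ (Set.neg_mem_Icc_iff.2 hs) _
      (Set.neg_mem_Icc_iff.2 ht)⟩
  pure s t h1 h2 h3 := by
    obtain ⟨s', t', h4, h5, h6, hp⟩ := H.pure (-t) (-s) (by linarith) (by linarith) (by linarith)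
    exact ⟨-t', -s', by linarith, by linarith, by linarith, hp.rev⟩

theorem concat (hab : a ≤ b) (hbc : b ≤ c) (H : IsLabelledPath γ a b) (H' : IsLabelledPath γ b c) :
    IsLabelledPath γ a c where
  lip o := lipschitzOnWith_Icc_union (H.lip o) (H'.lip o)
  countable := by
    obtain ⟨C, hC, h⟩ := H.countable
    obtain ⟨C', hC', h'⟩ := H'.countable
    have eq_mid : ∀ o ∉ C ∪ C', ∀ s ∈ Set.Icc a c, γ s o = γ b o := by
      intro o ho s hs
      rcases le_total s b with hsb | hsb
      · exact h o (fun hoC => ho (Or.inl hoC)) s ⟨hs.1, hsb⟩ b ⟨hab, le_rfl⟩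
      · exact h' o (fun hoC => ho (Or.inr hoC)) s ⟨hsb, hs.2⟩ b ⟨le_rfl, hbc⟩
    exact ⟨C ∪ C', hC.union hC', fun o ho s hs t ht => by rw [eq_mid o ho s hs, eq_mid o ho t ht]⟩
  pure s t h1 h2 h3 := by
    rcases lt_or_ge s b with h | h
    · obtain ⟨s', t', h4, h5, h6, hp⟩ := H.pure s (min t b) h1 (lt_min h2 h) (min_le_right _ _)
      exact ⟨s', t', h4, h5, h6.trans (min_le_left _ _), hp⟩
    · exact H'.pure s t h h2 h3

theorem eq_right (hab : a < b) (H : IsLabelledPath γ a b) (H' : IsLabelledPath γ' a b)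
    (h : Set.EqOn γ γ' (Set.Ico a b)) : γ b = γ' b := by
  funext o
  have heq : Set.EqOn (fun s => γ s o) (fun s => γ' s o) (Set.Icc a b) :=
    Set.EqOn.of_subset_closure (fun s hs => congrFun (h hs) o) (H.lip o).continuousOn
      (H'.lip o).continuousOn Set.Ico_subset_Icc_self (closure_Ico hab.ne).ge
  exact heq (Set.right_mem_Icc.2 hab.le)

theorem extend (hab : a < b) (H : ∀ c, a ≤ c → c < b → IsLabelledPath γ a c) :
    ∃ v, IsLabelledPath (Function.update γ b v) a b := by
  have hlip : ∀ o, LipschitzOnWith 1 (fun s => γ s o) (Set.Ico a b) := fun o s hs t ht =>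
    (H (max s t) (hs.1.trans (le_max_left _ _)) (max_lt hs.2 ht.2)).lip o
      ⟨hs.1, le_max_left _ _⟩ ⟨ht.1, le_max_right _ _⟩
  choose g hg hγg using fun o => (hlip o).extend_real
  have hne : ∀ s, s < b → Function.update γ b (fun o => g o b) s = γ s := fun s hs =>
    Function.update_of_ne hs.ne _ _
  have heq : ∀ o, Set.EqOn (g o) (fun s => Function.update γ b (fun o => g o b) s o)
      (Set.Icc a b) := by
    intro o s hs
    rcases hs.2.lt_or_eq with h | rfl
    · simpa only [hne s h] using (hγg o ⟨hs.1, h⟩).symm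
    · simp only [Function.update_self]
  refine ⟨fun o => g o b, fun o => lipschitzOnWith_of_eqOn (hg o).lipschitzOnWith (heq o), ?_,
    fun s t h1 h2 h3 => ?_⟩
  · obtain ⟨u, -, hu, hulim⟩ := exists_seq_strictMono_tendsto' hab
    choose C hC hconst using fun n => (H (u n) (hu n).1.le (hu n).2).countable
    have hIco : ∀ o ∉ ⋃ n, C n, Set.EqOn (g o) (fun _ => γ a o) (Set.Ico a b) := by
      intro o ho s hs
      obtain ⟨n, hn⟩ := (hulim.eventually (lt_mem_nhds hs.2)).exists
      exact (hγg o hs).symm.trans (hconst n o (fun hoC => ho (Set.mem_iUnion_of_mem n hoC)) s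
        ⟨hs.1, hn.le⟩ a ⟨le_rfl, (hu n).1.le⟩)
    have hIcc : ∀ o ∉ ⋃ n, C n, Set.EqOn (g o) (fun _ => γ a o) (Set.Icc a b) := fun o ho =>
      (hIco o ho).of_subset_closure (hg o).continuous.continuousOn continuousOn_const
        Set.Ico_subset_Icc_self (closure_Ico hab.ne).ge
    exact ⟨⋃ n, C n, Set.countable_iUnion hC, fun o ho s hs t ht =>
      ((heq o hs).symm.trans (hIcc o ho hs)).trans ((hIcc o ho ht).symm.trans (heq o ht))⟩
  · obtain ⟨s', t', h4, h5, h6, hp⟩ := (H ((s + t) / 2) (by linarith) (by linarith)).pure s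
      ((s + t) / 2) h1 (by linarith) le_rfl
    exact ⟨s', t', h4, h5, by linarith, hp.congr fun u hu => (hne u (by linarith [hu.2])).symm⟩

theorem map (w : Option A → ℝ) (σ : Equiv.Perm A) (H : IsLabelledPath γ a b) :
    IsLabelledPath (fun s => relabel w σ (γ s)) a b where
  lip o := LipschitzOnWith.of_dist_le_mul fun s hs t ht => by
    simpa only [relabel_apply, dist_add_left] using (H.lip (o.map σ)).dist_le_mul s hs t ht
  countable := by
    obtain ⟨C, hC, hconst⟩ := H.countable
    refine ⟨Option.map σ ⁻¹' C, hC.preimage (Option.map_injective σ.injective), ?_⟩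
    intro o ho s hs t ht
    rw [relabel_apply, relabel_apply, hconst (o.map σ) ho s hs t ht]
  pure s t h1 h2 h3 := by
    obtain ⟨s', t', h4, h5, h6, hp⟩ := H.pure s t h1 h2 h3
    exact ⟨s', t', h4, h5, h6, hp.map w σ⟩

theorem line (v : Option A → ℝ) (x : A) (a b : ℝ) :
    IsLabelledPath (fun t => v + t • labelVec x) a b where
  lip o := LipschitzOnWith.of_dist_le_mul fun s _ t _ => by
    simp only [Pi.add_apply, Pi.smul_apply, smul_eq_mul, dist_add_left, Real.dist_eq, ← sub_mul,
      abs_mul, NNReal.coe_one, one_mul]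
    exact mul_le_of_le_one_right (abs_nonneg _) (abs_labelVec_le_one x o)
  countable := by
    refine ⟨{none, some x}, (Set.toFinite _).countable, fun o ho s _ t _ => ?_⟩
    have h0 : labelVec x o = 0 := by simpa [labelVec] using ho
    simp [h0]
  pure s t _ h2 _ := ⟨s, t, le_rfl, h2, le_rfl, labelVec x, labelVec_mem_velocities x,
    fun u _ u' _ => by rw [add_assoc, ← add_smul, add_sub_cancel]⟩

theorem eqOn_of_eqOn_rat (hab : a < b) (H : IsLabelledPath γ a b) (H' : IsLabelledPath γ' a b)
    (ha : γ a = γ' a) {C : Set (Option A)}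
    (hC : ∀ o ∉ C, ∀ s ∈ Set.Icc a b, ∀ t ∈ Set.Icc a b, γ s o = γ t o)
    (hC' : ∀ o ∉ C, ∀ s ∈ Set.Icc a b, ∀ t ∈ Set.Icc a b, γ' s o = γ' t o)
    (h : ∀ o ∈ C, ∀ q : ℚ, γ q o = γ' q o) : Set.EqOn γ γ' (Set.Icc a b) := by
  have hdense : Set.Icc a b ⊆ closure (Set.Ioo a b ∩ Set.range ((↑) : ℚ → ℝ)) := by
    rw [← closure_Ioo hab.ne]
    exact closure_minimal (Rat.denseRange_cast.open_subset_closure_inter isOpen_Ioo)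
      isClosed_closure
  intro s hs
  funext o
  by_cases ho : o ∈ C
  · have heq : Set.EqOn (fun s => γ s o) (fun s => γ' s o)
        (Set.Ioo a b ∩ Set.range ((↑) : ℚ → ℝ)) := by
      rintro _ ⟨-, q, rfl⟩
      exact h o ho q
    exact heq.of_subset_closure (H.lip o).continuousOn (H'.lip o).continuousOn
      (Set.inter_subset_left.trans Set.Ioo_subset_Icc_self) hdense hs
  · have ha' := Set.left_mem_Icc.2 hab.le
    rw [hC o ho s hs a ha', hC' o ho s hs a ha', ha]

theorem exists_eq_range_countable (H : IsLabelledPath γ a b) : ∃ f : ℕ → Option A,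
    ∀ o ∉ Set.range f, ∀ s ∈ Set.Icc a b, ∀ t ∈ Set.Icc a b, γ s o = γ t o := by
  obtain ⟨C, hC, h⟩ := H.countable
  obtain ⟨f, hf⟩ := (hC.insert none).exists_eq_range (Set.insert_nonempty _ _)
  exact ⟨f, fun o ho => h o fun hoC => ho (hf ▸ Set.mem_insert_of_mem _ hoC)⟩

end IsLabelledPath

theorem isReducedPath_line (v : Option A → ℝ) (x : A) (a b : ℝ) :
    IsReducedPath (fun t => v + t • labelVec x) a b := by
  rintro t - - h
  obtain ⟨δ, hδ, h⟩ := h.exists_pos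
  have hnone := congrFun (h δ hδ.le le_rfl) none
  simp only [Pi.add_apply, Pi.smul_apply, labelVec_none, smul_eq_mul, mul_one] at hnone
  linarith

/-- The class of labelled paths. -/
def labelledPaths (A : Type) : PathClass (Option A → ℝ) where
  P := IsLabelledPath
  point := IsLabelledPath.point
  congr := IsLabelledPath.congr
  mono H h1 _ h2 := H.mono h1 h2
  shift := IsLabelledPath.shift
  rev := IsLabelledPath.rev
  concat := IsLabelledPath.concat
  extend := IsLabelledPath.extend
  eq_right := IsLabelledPath.eq_right

theorem relabel_isSymmetry (w : Option A → ℝ) (σ : Equiv.Perm A) :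
    (labelledPaths A).IsSymmetry (relabel w σ) := by
  refine fun γ a b => ⟨fun H => H.map w σ, fun H => ?_⟩
  have h := H.map (fun o => -w (o.map σ.symm)) σ.symm
  exact h.congr fun s _ => (relabel w σ).symm_apply_apply (γ s)

/-- A germ is determined by a length, a sequence of coordinates containing all moving ones, and
their values at rational times. -/
theorem mk_germs_labelledPaths_le (hA : #A = 𝔠) (v : Option A → ℝ) :
    #((labelledPaths A).Germs v) ≤ 𝔠 := by
  have hex : ∀ g : (labelledPaths A).Germs v, ∃ (l : ℝ) (f : ℕ → Option A), 0 < l ∧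
      IsLabelledPath g.out.1 0 l ∧
      ∀ o ∉ Set.range f, ∀ s ∈ Set.Icc 0 l, ∀ t ∈ Set.Icc 0 l, g.out.1 s o = g.out.1 t o := by
    intro g
    obtain ⟨l, hl, hP, -, -⟩ := g.out.2
    obtain ⟨f, hf⟩ := IsLabelledPath.exists_eq_range_countable hP
    exact ⟨l, f, hl, hP, hf⟩
  have h0 : ∀ g : (labelledPaths A).Germs v, g.out.1 0 = v := fun g => by
    obtain ⟨-, -, -, -, h⟩ := g.out.2
    exact h
  choose l f hl hP hf using hex
  let code : (labelledPaths A).Germs v → ℝ × (ℕ → Option A) × (ℕ × ℚ → ℝ) := fun g =>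
    (l g, f g, fun p => g.out.1 p.2 (f g p.1))
  have hinj : Function.Injective code := by
    intro g g' h
    simp only [code, Prod.mk.injEq] at h
    obtain ⟨hll, hff, hval⟩ := h
    have hval' : ∀ o ∈ Set.range (f g), ∀ q : ℚ, g.out.1 q o = g'.out.1 q o := by
      rintro _ ⟨n, rfl⟩ q
      simpa only [← hff] using congrFun hval (n, q)
    have heq := (hP g).eqOn_of_eqOn_rat (hl g) (hll ▸ hP g') ((h0 g).trans (h0 g').symm) (hf g)
      (by simpa only [← hll, ← hff] using hf g') hval'
    exact Quotient.out_equiv_out.1 (GermEq.of_lt (hl g) fun s hs0 hs1 => heq ⟨hs0, hs1.le⟩)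
  have hO : #(Option A) = 𝔠 := by
    rw [mk_option, hA]
    exact add_one_eq aleph0_le_continuum
  refine (mk_le_of_injective hinj).trans ?_
  simp [hO, mk_prod, mk_real]

theorem mk_germs_labelledPaths (hA : #A = 𝔠) (v : Option A → ℝ) :
    #((labelledPaths A).Germs v) = 𝔠 := by
  refine le_antisymm (mk_germs_labelledPaths_le hA v) ?_
  have hg : ∀ x : A, (labelledPaths A).IsGerm v (fun t => v + t • labelVec x) := fun x =>
    ⟨1, one_pos, .line v x 0 1, isReducedPath_line v x 0 1, by simp⟩
  rw [← hA]
  refine mk_le_of_injective (f := fun x => Quotient.mk _ ⟨_, hg x⟩) fun x y h => ?_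
  obtain ⟨δ, hδ, h⟩ := GermEq.exists_pos (Quotient.exact h)
  exact labelVec_injective (smul_right_injective _ hδ.ne' (add_left_cancel (h δ hδ.le le_rfl)))

theorem IsPure.exists_eq_line_of_dense {γ : ℝ → Option A → ℝ} {p q : ℝ} (hpq : p < q)
    (hpure : IsPure γ p q)
    (h : Dense {s | ∃ (w : Option A → ℝ) (σ : Equiv.Perm A), ∀ t, γ (t + s) = relabel w σ (γ t)}) :
    ∃ ν ∈ velocities A, ∀ t, γ t = γ 0 + t • ν := by
  obtain ⟨ν, hν, hpure⟩ := hpure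
  have hloc : ∀ t, ∃ ν' ∈ velocities A, ∀ᶠ u in 𝓝 t, γ u = γ t + (u - t) • ν' := by
    intro t
    obtain ⟨s, ⟨hs1, hs2⟩, w, σ, hs⟩ := h.inter_open_nonempty (Set.Ioo (t - q) (t - p)) isOpen_Ioo
      (Set.nonempty_Ioo.2 (by linarith))
    refine ⟨_, comp_map_mem_velocities σ hν, ?_⟩
    filter_upwards [Ioo_mem_nhds (by linarith : p + s < t) (by linarith : t < q + s)] with u hu
    calc γ u = relabel w σ (γ (u - s)) := by rw [← hs, sub_add_cancel]
      _ = relabel w σ (γ (t - s) + (u - t) • ν) := by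
        rw [hpure (t - s) ⟨by linarith, by linarith⟩ (u - s)
          ⟨by linarith [hu.1], by linarith [hu.2]⟩, sub_sub_sub_cancel_right]
      _ = γ t + (u - t) • (ν ∘ Option.map σ) := by rw [relabel_add_smul, ← hs, sub_add_cancel]
  choose ν' hν' hloc using hloc
  exact ⟨ν' 0, hν' 0, eq_add_smul_of_eventually hloc⟩

end LabelledPaths

/-! ### Labelled trees -/

/-- A height function `h` on `T`, a group of isometries of `T` indexed by translation lengths and
elements of `R`, and a family of lines labelled by `A` on which `R` acts. `Sym r g` says that `g`
belongs to the group and acts through `r`: it translates heights by `c r` and labels by `r`. -/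
structure LabelledTree (T : Type) [MetricSpace T] (R : Type) [AddCommGroup R] (c : R →+ ℝ)
    (A : Type) [AddAction R A] where
  h : T → ℝ
  h_le : ∀ x y, |h x - h y| ≤ dist x y
  Sym : R → (T ≃ᵢ T) → Prop
  sym_one : Sym 0 1
  sym_mul : ∀ {r r' g g'}, Sym r g → Sym r' g' → Sym (r + r') (g * g')
  sym_inv : ∀ {r g}, Sym r g → Sym (-r) g⁻¹
  h_sym : ∀ {r g}, Sym r g → ∀ x, h (g x) = h x + c r
  exists_sym : ∀ {r x y}, c r = h y - h x → ∃ g, Sym r g ∧ g x = y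
  free : ∀ {g x}, Sym 0 g → g x = x → g = 1
  line : A → T → ℝ → T
  line_isometry : ∀ a x, Isometry (line a x)
  line_zero : ∀ a x, line a x 0 = x
  h_line : ∀ a x u, h (line a x u) = h x + u
  line_line : ∀ a x s u, line a (line a x s) u = line a x (s + u)
  sym_line : ∀ {r g}, Sym r g → ∀ a x u, g (line a x u) = line (r +ᵥ a) (g x) u
  line_inj : ∀ {a a' x}, line a x = line a' x → a = a'
  eq_line : ∀ f : ℝ → T, Isometry f → Dense {s | ∃ r g, Sym r g ∧ ∀ t, g (f t) = f (t + s)} →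
    ∃ a x, Set.range f = Set.range (line a x)

section Relabel

variable {A : Type}

theorem relabel_zero_one (v : Option A → ℝ) : relabel 0 1 v = v := by
  funext o
  simp [relabel_apply]

theorem relabel_relabel (w w' : Option A → ℝ) (σ σ' : Equiv.Perm A) (v : Option A → ℝ) :
    relabel w σ (relabel w' σ' v) = relabel (relabel w σ w') (σ' * σ) v := by
  funext o
  simp [relabel_apply, Equiv.Perm.coe_mul, add_assoc]

theorem labelVec_map_toPerm {R : Type*} [AddCommGroup R] [AddAction R A] (r : R) (a : A) :
    labelVec a ∘ Option.map (AddAction.toPerm (-r)) = labelVec (r +ᵥ a) := by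
  funext o
  simp [labelVec_map]

variable {R : Type} [AddCommGroup R] [AddAction R A] {T : Type} [MetricSpace T]

/-- The isometry `g` translates heights by `c r` and labels by `r`, as seen by the developing
map `π`. -/
def ActsThrough (π : T → Option A → ℝ) (c : R →+ ℝ) (r : R) (g : T ≃ᵢ T) : Prop :=
  ∃ w, w none = c r ∧ ∀ x, π (g x) = relabel w (AddAction.toPerm (-r)) (π x)

namespace ActsThrough

variable {π : T → Option A → ℝ} {c : R →+ ℝ} {r r' : R} {g g' : T ≃ᵢ T}

theorem one (π : T → Option A → ℝ) (c : R →+ ℝ) : ActsThrough π c 0 1 := by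
  refine ⟨0, (map_zero c).symm, fun x => ?_⟩
  rw [neg_zero, AddAction.toPerm_zero]
  exact (relabel_zero_one (π x)).symm

theorem mul : ActsThrough π c r g → ActsThrough π c r' g' →
    ActsThrough π c (r + r') (g * g') := by
  rintro ⟨w, hw, hg⟩ ⟨w', hw', hg'⟩
  refine ⟨relabel w (AddAction.toPerm (-r)) w', ?_, fun x => ?_⟩
  · rw [relabel_apply, Option.map_none, hw, hw', map_add]
  · rw [IsometryEquiv.mul_apply, hg, hg', relabel_relabel]
    congr 2
    ext a
    simp [vadd_vadd]

theorem inv : ActsThrough π c r g → ActsThrough π c (-r) g⁻¹ := by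
  rintro ⟨w, hw, hg⟩
  refine ⟨fun o => -w (o.map (AddAction.toPerm (-r)).symm), ?_, fun x => ?_⟩
  · rw [map_neg, ← hw]
    rfl
  · have h := hg (g⁻¹ x)
    rw [IsometryEquiv.apply_inv_self, ← Equiv.symm_apply_eq] at h
    have hinv : AddAction.toPerm (- -r) = (AddAction.toPerm (-r) : Equiv.Perm A).symm := by
      ext a
      simp
    rw [← h, hinv]
    rfl

theorem height_apply (hg : ActsThrough π c r g) (x : T) : π (g x) none = π x none + c r := by
  obtain ⟨w, hw, hg⟩ := hg
  rw [hg, relabel_apply, hw, Option.map_none, add_comm]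

end ActsThrough

end Relabel

namespace PathClass.Developing

variable {A : Type} {T : Type} [MetricSpace T] [GeodesicTree T] {π : T → Option A → ℝ}

theorem abs_sub_le_dist (hπ : (labelledPaths A).Developing π) (x y : T) (o : Option A) :
    |π x o - π y o| ≤ dist x y := by
  have h := ((hπ.path x y).lip o).dist_le_mul 0 ⟨le_rfl, dist_nonneg⟩ (dist x y)
    ⟨dist_nonneg, le_rfl⟩
  simpa [Real.dist_eq] using h

theorem exists_isPure (hπ : (labelledPaths A).Developing π) {f : ℝ → T} (hf : Isometry f) :
    ∃ p q, p < q ∧ IsPure (fun t => π (f t)) p q := by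
  have hdist : dist (f 0) (f 1) = 1 := by simp [hf.dist_eq]
  obtain ⟨p, q, hp, hpq, hq, hpure⟩ := (hπ.path (f 0) (f 1)).pure 0 1 le_rfl one_pos hdist.ge
  exact ⟨p, q, hpq, hpure.congr fun t ht =>
    congrArg π (toward_line hf (hp.trans ht.1) (ht.2.trans hq))⟩

section LabelLine

variable [CompleteSpace T]

theorem exists_labelLine (hπ : (labelledPaths A).Developing π) (a : A) (x : T) :
    ∃ f : ℝ → T, Isometry f ∧ f 0 = x ∧ ∀ t, π (f t) = π x + t • labelVec a :=
  hπ.exists_line (fun p q _ => .line (π x) a p q) (isReducedPath_line (π x) a) (by simp)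

/-- The line through `x` that moves upwards with the label `a` under the developing map. -/
noncomputable def labelLine (hπ : (labelledPaths A).Developing π) (a : A) (x : T) : ℝ → T :=
  (hπ.exists_labelLine a x).choose

variable (hπ : (labelledPaths A).Developing π) (a : A) (x : T)

theorem isometry_labelLine : Isometry (hπ.labelLine a x) :=
  (hπ.exists_labelLine a x).choose_spec.1

@[simp] theorem labelLine_zero : hπ.labelLine a x 0 = x :=
  (hπ.exists_labelLine a x).choose_spec.2.1

theorem map_labelLine (t : ℝ) : π (hπ.labelLine a x t) = π x + t • labelVec a :=
  (hπ.exists_labelLine a x).choose_spec.2.2 t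

variable {a x}

theorem eq_labelLine {f : ℝ → T} (hf : Isometry f) (h0 : f 0 = x)
    (h : ∀ t, π (f t) = π x + t • labelVec a) : f = hπ.labelLine a x :=
  hπ.line_ext hf (hπ.isometry_labelLine a x) (h0.trans (hπ.labelLine_zero a x).symm) fun t => by
    rw [h, hπ.map_labelLine]

variable (a x)

theorem labelLine_labelLine (s u : ℝ) :
    hπ.labelLine a (hπ.labelLine a x s) u = hπ.labelLine a x (s + u) := by
  refine (congrFun (hπ.eq_labelLine (f := fun u => hπ.labelLine a x (s + u))
    ((hπ.isometry_labelLine a x).comp (isometry_add_left s)) (by rw [add_zero]) fun t => ?_) u).symm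
  rw [hπ.map_labelLine, hπ.map_labelLine, add_smul, add_assoc]

variable {a x}

theorem labelLine_injective {a' : A} (h : hπ.labelLine a x = hπ.labelLine a' x) : a = a' := by
  have h1 := hπ.map_labelLine a x 1
  rw [h, hπ.map_labelLine, one_smul, one_smul] at h1
  exact (labelVec_injective (add_left_cancel h1)).symm

theorem exists_range_eq_labelLine {f : ℝ → T} (hf : Isometry f)
    (h : Dense {s | ∃ (w : Option A → ℝ) (σ : Equiv.Perm A),
      ∀ t, π (f (t + s)) = relabel w σ (π (f t))}) :
    ∃ a x, Set.range f = Set.range (hπ.labelLine a x) := by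
  obtain ⟨p, q, hpq, hpure⟩ := hπ.exists_isPure hf
  obtain ⟨_, ⟨a, rfl | rfl⟩, hγ⟩ := hpure.exists_eq_line_of_dense hpq h
  · exact ⟨a, f 0, by rw [← hπ.eq_labelLine hf rfl hγ]⟩
  · refine ⟨a, f 0, ?_⟩
    rw [← hπ.eq_labelLine (f := fun t => f (-t)) (hf.comp isometry_neg) (by rw [neg_zero])
      fun t => by rw [hγ, neg_smul_neg]]
    exact (neg_surjective.range_comp f).symm

end LabelLine

variable {R : Type} [AddCommGroup R] [AddAction R A] {c : R →+ ℝ} {r : R} {g : T ≃ᵢ T}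

theorem exists_actsThrough [CompleteSpace T] (hπ : (labelledPaths A).Developing π) {x y : T}
    (h : c r = π y none - π x none) : ∃ g, ActsThrough π c r g ∧ g x = y := by
  let w : Option A → ℝ := fun o => π y o - π x (o.map (AddAction.toPerm (-r)))
  obtain ⟨g, hgx, hg⟩ := hπ.exists_isometryEquiv (relabel_isSymmetry w (AddAction.toPerm (-r)))
    (funext fun o => by rw [relabel_apply, sub_add_cancel] : _ = π y)
  exact ⟨g, ⟨w, h.symm, hg⟩, hgx⟩

theorem eq_one_of_actsThrough (hπ : (labelledPaths A).Developing π) {x : T}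
    (hg : ActsThrough π c 0 g) (hx : g x = x) : g = 1 := by
  obtain ⟨w, -, hg⟩ := hg
  simp only [neg_zero, AddAction.toPerm_zero] at hg
  have hw : w = 0 := by
    funext o
    have h := congrFun (hg x) o
    rw [hx, relabel_apply] at h
    simpa using h
  have hid : (g : T → T) = id := hπ.isometry_ext g.isometry isometry_id hx fun z => by
    rw [hg, hw]
    exact relabel_zero_one (π z)
  ext z
  exact congrFun hid z

theorem labelLine_vadd_of_actsThrough [CompleteSpace T] (hπ : (labelledPaths A).Developing π)
    (hg : ActsThrough π c r g) (a : A) (x : T) (u : ℝ) :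
    g (hπ.labelLine a x u) = hπ.labelLine (r +ᵥ a) (g x) u := by
  obtain ⟨w, -, hg⟩ := hg
  refine congrFun (hπ.eq_labelLine (f := fun u => g (hπ.labelLine a x u))
    (g.isometry.comp (hπ.isometry_labelLine a x)) (by rw [labelLine_zero]) fun t => ?_) u
  rw [hg, hg, hπ.map_labelLine, relabel_add_smul, labelVec_map_toPerm]

/-- The labelled tree structure induced by a developing map. -/
noncomputable def labelledTree [CompleteSpace T] (hπ : (labelledPaths A).Developing π)
    (c : R →+ ℝ) : LabelledTree T R c A where
  h x := π x none
  h_le x y := hπ.abs_sub_le_dist x y none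
  Sym := ActsThrough π c
  sym_one := .one π c
  sym_mul := .mul
  sym_inv := .inv
  h_sym := ActsThrough.height_apply
  exists_sym := hπ.exists_actsThrough
  free := hπ.eq_one_of_actsThrough
  line := hπ.labelLine
  line_isometry := hπ.isometry_labelLine
  line_zero := hπ.labelLine_zero
  h_line a x u := by simp [hπ.map_labelLine]
  line_line := hπ.labelLine_labelLine
  sym_line := hπ.labelLine_vadd_of_actsThrough
  line_inj := hπ.labelLine_injective
  eq_line f hf hd := by
    refine hπ.exists_range_eq_labelLine hf (hd.mono ?_)
    rintro s ⟨r, g, ⟨w, -, hg⟩, hgf⟩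
    exact ⟨w, AddAction.toPerm (-r), fun t => by rw [← hgf, hg]⟩

end PathClass.Developing

theorem IsUniversalRealTree.nonempty_labelledTree {T : Type} [MetricSpace T]
    (hT : IsUniversalRealTree T 𝔠) {R : Type} [AddCommGroup R] (c : R →+ ℝ) {A : Type}
    [AddAction R A] (hA : #A = 𝔠) : Nonempty (LabelledTree T R c A) := by
  have := hT.isRealTree.geodesicTree
  have := hT.complete
  obtain ⟨b⟩ := hT.nonempty
  have e : ∀ (p : T) (v : Option A → ℝ), Nonempty (Directions p ≃ (labelledPaths A).Germs v) :=
    fun p v => Cardinal.eq.1 ((hT.valence p).trans (mk_germs_labelledPaths hA v).symm)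
  obtain ⟨π, hπ⟩ := PathClass.exists_developing e b 0
  exact ⟨hπ.labelledTree c⟩

section RealLine

variable {T : Type} [MetricSpace T] (e : T ≃ᵢ ℝ)

include e in
theorem surjective_of_isometry_real {f : ℝ → T} (hf : Isometry f) : Function.Surjective f := by
  have := GeodesicTree.of_isometryEquiv e
  refine fun y => mem_range_of_aligned hf fun s t => ?_
  simpa only [e.symm_apply_apply] using
    (PreservesBetweenness.of_isometry e.symm.isometry).aligned
      (aligned_real (e (f s)) (e y) (e (f t)))

/-- The real line is a labelled tree with a single label. -/
noncomputable def realLineLabelledTree {R : Type} [AddCommGroup R] (c : R →+ ℝ) {A : Type}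
    [AddAction R A] [Unique A] : LabelledTree T R c A where
  h := e
  h_le x y := by rw [← Real.dist_eq, e.dist_eq]
  Sym r g := ∀ x, e (g x) = e x + c r
  sym_one := by simp
  sym_mul h h' x := by rw [IsometryEquiv.mul_apply, h, h', map_add, add_assoc, add_comm (c _)]
  sym_inv {r g} h x := by
    rw [map_neg, ← sub_eq_add_neg, eq_sub_iff_add_eq, ← h, IsometryEquiv.apply_inv_self]
  h_sym h := h
  exists_sym {r x y} h :=
    ⟨(e.trans (IsometryEquiv.addRight (c r))).trans e.symm, by simp, e.injective (by simp [h])⟩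
  free {g x} h _ := by
    ext y
    exact e.injective (by simp [h y])
  line _ x u := e.symm (e x + u)
  line_isometry _ x := e.symm.isometry.comp (isometry_add_left _)
  line_zero _ x := by simp
  h_line _ x u := by simp
  line_line _ x s u := by simp [add_assoc]
  sym_line {r g} h _ x u := e.injective (by
    rw [h, e.apply_symm_apply, e.apply_symm_apply, h, add_right_comm])
  line_inj _ := Subsingleton.elim _ _
  eq_line f hf _ := by
    have hline : Isometry fun u => e.symm (e (f 0) + u) :=
      e.symm.isometry.comp (isometry_add_left _)
    exact ⟨default, f 0, by
      rw [(surjective_of_isometry_real e hf).range_eq,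
        (surjective_of_isometry_real e hline).range_eq]⟩

end RealLine

/-! ### Flats in products of trees -/

namespace EllOne

variable {N : Type*}

theorem summable_abs (r : EllOne N) : Summable fun n => |r n| := by
  simpa using (lp.memℓp r).summable (by simp)

theorem norm_eq (r : EllOne N) : ‖r‖ = ∑' n, |r n| := by
  rw [lp.norm_eq_tsum_rpow (by simp)]
  simp

theorem dist_eq (r s : EllOne N) : dist r s = ∑' n, |r n - s n| := by
  rw [dist_eq_norm, norm_eq]
  rfl

theorem ext {r s : EllOne N} (h : ∀ n, r n = s n) : r = s := lp.ext (funext h)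

/-- The element of `ℓ¹` given by an absolutely summable family. -/
def ofSummable (f : N → ℝ) (hf : Summable fun n => |f n|) : EllOne N :=
  ⟨f, memℓp_gen (by simpa using hf)⟩

/-- The `n`-th coordinate on `ℓ¹`, as a homomorphism. -/
def coord (n : N) : EllOne N →+ ℝ where
  toFun r := r n
  map_zero' := rfl
  map_add' _ _ := rfl

@[simp] theorem coord_apply (n : N) (r : EllOne N) : coord n r = r n := rfl

theorem norm_add_of_disjoint {u w : EllOne N} (h : ∀ n, u n = 0 ∨ w n = 0) :
    ‖u + w‖ = ‖u‖ + ‖w‖ := by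
  rw [norm_eq, norm_eq, norm_eq, ← (summable_abs u).tsum_add (summable_abs w)]
  refine tsum_congr fun n => ?_
  rw [lp.coeFn_add, Pi.add_apply]
  rcases h n with h | h <;> simp [h]

theorem isometry_single [DecidableEq N] (n : N) :
    Isometry fun t : ℝ => (lp.single 1 n t : EllOne N) :=
  lp.isometry_single (E := fun _ : N => ℝ) n

theorem continuous_apply (n : N) : Continuous fun r : EllOne N => r n :=
  (LipschitzWith.of_dist_le_mul (K := 1) fun r s => by
    rw [dist_eq, NNReal.coe_one, one_mul, Real.dist_eq]
    exact (summable_abs (r - s)).le_tsum n fun _ _ => abs_nonneg _).continuous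

theorem surjective_apply (n : N) : Function.Surjective fun r : EllOne N => r n := by
  classical
  exact fun t => ⟨lp.single 1 n t, lp.single_apply_self _ _ _⟩

theorem single_disjoint [DecidableEq N] {i : N} {w : EllOne N} (hw : w i = 0) (b : ℝ) (n : N) :
    (lp.single 1 i b : EllOne N) n = 0 ∨ w n = 0 := by
  rcases eq_or_ne n i with rfl | hn
  · exact .inr hw
  · exact .inl (lp.single_apply_ne _ _ _ hn)

theorem eq_of_forall_add_single [DecidableEq N] {Y : Type*} [TopologicalSpace Y] [T2Space Y]
    {f : EllOne N → Y} (hf : Continuous f) (h : ∀ x i a, f (x + lp.single 1 i a) = f x)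
    (x : EllOne N) : f x = f 0 := by
  have hsum : ∀ s : Finset N, f (∑ i ∈ s, lp.single 1 i (x i)) = f 0 := fun s => by
    induction s using Finset.induction_on with
    | empty => simp
    | insert i s hi ih => rw [Finset.sum_insert hi, add_comm, h, ih]
  refine tendsto_nhds_unique ((hf.tendsto x).comp
    (lp.hasSum_single (E := fun _ : N => ℝ) (p := 1) (by simp) x)) ?_
  exact tendsto_const_nhds.congr fun s => (hsum s).symm

end EllOne

namespace L1Product

variable {N : Type*} {T : N → Type*} [∀ n, MetricSpace (T n)] {z : ∀ n, T n}

theorem summable_of_summable {x y w : ∀ n, T n} (hxy : Summable fun n => dist (x n) (y n))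
    (hyw : Summable fun n => dist (y n) (w n)) : Summable fun n => dist (x n) (w n) :=
  .of_nonneg_of_le (fun _ => dist_nonneg) (fun _ => dist_triangle _ _ _) (hxy.add hyw)

theorem dist_def (x y : L1Product T z) : dist x y = ∑' n, dist (x.1 n) (y.1 n) := rfl

theorem continuous_apply (n : N) : Continuous fun x : L1Product T z => x.1 n :=
  (LipschitzWith.of_dist_le_mul (K := 1) fun x y => by
    rw [NNReal.coe_one, one_mul]
    exact (summable_dist x y).le_tsum n fun _ _ => dist_nonneg).continuous

theorem preservesBetweenness_apply (n : N) :
    PreservesBetweenness fun x : L1Product T z => x.1 n := by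
  intro x y w h
  have hsum := ((summable_dist x y).hasSum.add (summable_dist y w).hasSum).sub
    (summable_dist x w).hasSum
  rw [← dist_def, ← dist_def, ← dist_def, h, sub_self] at hsum
  exact sub_eq_zero.1 (congrFun ((hasSum_zero_iff_of_nonneg fun n => sub_nonneg.2
    (dist_triangle (x.1 n) (y.1 n) (w.1 n))).1 hsum) n)

end L1Product

theorem eq_mul_of_continuous_of_add {ρ : ℝ → ℝ} (hρ : Continuous ρ)
    (hadd : ∀ s t, 0 ≤ s → 0 ≤ t → ρ (s + t) = ρ s + ρ t) {t : ℝ} (ht : 0 ≤ t) :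
    ρ t = t * ρ 1 := by
  let θ : ℝ → ℝ := fun t => ρ (max t 0) - ρ (max (-t) 0)
  have hρ_zero : ρ 0 = 0 := by simpa using hadd 0 0 le_rfl le_rfl
  have hθ_sub : ∀ x y, 0 ≤ x → 0 ≤ y → θ (x - y) = ρ x - ρ y := by
    intro x y hx hy
    rcases le_total y x with h | h
    · have := hadd (x - y) y (sub_nonneg.2 h) hy
      simp_all [θ]
    · have := hadd (y - x) x (sub_nonneg.2 h) hx
      simp_all [θ]
  have hθ_add : ∀ s t, θ (s + t) = θ s + θ t := by
    intro s t
    have hsplit : s + t = max s 0 + max t 0 - (max (-s) 0 + max (-t) 0) := by grind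
    rw [hsplit, hθ_sub _ _ (by positivity) (by positivity),
      hadd _ _ (by positivity) (by positivity), hadd _ _ (by positivity) (by positivity)]
    ring
  have hθ_of_nonneg : ∀ t, 0 ≤ t → θ t = ρ t := fun t ht => by simp [θ, hρ_zero, ht]
  have hlin := map_real_smul (AddMonoidHom.mk' θ hθ_add)
    (show Continuous θ by fun_prop) t 1
  simpa [hθ_of_nonneg, ht] using hlin

namespace PreservesBetweenness

section Line

variable {X : Type*} [MetricSpace X] {f : ℝ → X}

theorem dist_add_of_le (hf : PreservesBetweenness f) {s t u : ℝ} (hst : s ≤ t) (htu : t ≤ u) :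
    dist (f s) (f u) = dist (f s) (f t) + dist (f t) (f u) := by
  refine (hf s t u ?_).symm
  rw [Real.dist_eq, Real.dist_eq, Real.dist_eq]
  grind

theorem exists_dist_eq_mul (hf : PreservesBetweenness f) (hc : Continuous f)
    (htrans : ∀ s t u, dist (f (t + s)) (f (u + s)) = dist (f t) (f u)) :
    ∃ k, 0 ≤ k ∧ ∀ s t, dist (f s) (f t) = k * |s - t| := by
  refine ⟨dist (f 0) (f 1), dist_nonneg, fun s t => ?_⟩
  wlog hst : s ≤ t generalizing s t
  · rw [dist_comm, abs_sub_comm, this t s (le_of_not_ge hst)]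
  have hdist : ∀ u v, dist (f u) (f (v + u)) = dist (f 0) (f v) := fun u v => by
    simpa using htrans u 0 v
  have hρ := eq_mul_of_continuous_of_add (ρ := fun u => dist (f 0) (f u)) (by fun_prop)
    (fun u v hu hv => by
      rw [hf.dist_add_of_le hu (le_add_of_nonneg_right hv), add_comm u v, hdist])
    (sub_nonneg.2 hst)
  rw [abs_sub_comm, abs_of_nonneg (sub_nonneg.2 hst), mul_comm, ← hρ, ← hdist s, sub_add_cancel]

/-- The map `f` has constant speed, and the line is `f` with its parameter divided by this speed. -/
theorem exists_isometry_of_dense (hf : PreservesBetweenness f) (hc : Continuous f)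
    {Γ : Set (X ≃ᵢ X)} (hΓ : Dense {s | ∃ g ∈ Γ, ∀ t, g (f t) = f (t + s)}) :
    (∀ t, f t = f 0) ∨ ∃ l : ℝ → X, Isometry l ∧ Set.range f ⊆ Set.range l ∧
      Dense {s | ∃ g ∈ Γ, ∀ t, g (l t) = l (t + s)} := by
  have htrans : ∀ s t u, dist (f (t + s)) (f (u + s)) = dist (f t) (f u) := fun s t u => by
    have hcs : Continuous fun s => dist (f (t + s)) (f (u + s)) := by fun_prop
    refine congrFun (hcs.ext_on hΓ (continuous_const (y := dist (f t) (f u))) ?_) s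
    rintro s ⟨g, -, hg⟩
    simp only [← hg, g.dist_eq]
  obtain ⟨k, hk, hdist⟩ := hf.exists_dist_eq_mul hc htrans
  rcases hk.eq_or_lt with rfl | hk
  · exact .inl fun t => dist_eq_zero.1 ((hdist t 0).trans (zero_mul _))
  refine .inr ⟨fun t => f (t / k), Isometry.of_dist_eq fun s t => ?_, ?_, ?_⟩
  · rw [hdist, Real.dist_eq, ← sub_div, abs_div, abs_of_pos hk, mul_div_cancel₀ _ hk.ne']
  · rintro _ ⟨t, rfl⟩
    exact ⟨t * k, congrArg f (mul_div_cancel_right₀ t hk.ne')⟩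
  · refine ((Homeomorph.mulRight₀ k hk.ne').surjective.denseRange.dense_image
      (Homeomorph.continuous _) hΓ).mono ?_
    rintro _ ⟨s, ⟨g, hgΓ, hg⟩, rfl⟩
    refine ⟨g, hgΓ, fun t => ?_⟩
    simp only [hg, Homeomorph.coe_mulRight₀, add_div, mul_div_cancel_right₀ _ hk.ne']

end Line

section EllOne

variable {N : Type*} {T : Type*} [MetricSpace T] {f : EllOne N → T}

theorem dist_add_of_disjoint (hf : PreservesBetweenness f) {u w : EllOne N}
    (h : ∀ n, u n = 0 ∨ w n = 0) (x : EllOne N) :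
    dist (f x) (f (x + u)) + dist (f (x + u)) (f (x + u + w)) = dist (f x) (f (x + u + w)) := by
  refine hf _ _ _ ?_
  rw [add_assoc x, dist_self_add_right, ← add_assoc, dist_self_add_right, add_assoc,
    dist_self_add_right, EllOne.norm_add_of_disjoint h]

variable [GeodesicTree T]

theorem eq_or_eq_of_disjoint (hf : PreservesBetweenness f) {u w : EllOne N}
    (h : ∀ n, u n = 0 ∨ w n = 0) (x : EllOne N) :
    (f (x + u) = f x ∧ f (x + u + w) = f (x + w)) ∨
      (f (x + w) = f x ∧ f (x + u + w) = f (x + u)) := by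
  have hu : ∀ n, (-u) n = 0 ∨ w n = 0 := fun n => by simpa using h n
  refine eq_or_eq_of_rectangle (hf.dist_add_of_disjoint h x) ?_ ?_ ?_
  · simpa only [add_right_comm] using hf.dist_add_of_disjoint (fun n => (h n).symm) x
  · simpa only [add_neg_cancel_right] using hf.dist_add_of_disjoint hu (x + u)
  · simpa only [add_right_comm _ w, add_neg_cancel_right] using
      hf.dist_add_of_disjoint (fun n => (hu n).symm) (x + u)

variable [DecidableEq N]

theorem eq_of_single_ne (hf : PreservesBetweenness f) {x₀ : EllOne N} {i : N} {a : ℝ}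
    (ha : f (x₀ + lp.single 1 i a) ≠ f x₀) (y : EllOne N) :
    f y = f (x₀ + lp.single 1 i (y i - x₀ i)) := by
  set u : EllOne N := lp.single 1 i (y i - x₀ i) with hu
  obtain ⟨b, hb⟩ : ∃ b, f (x₀ + u + lp.single 1 i b) ≠ f (x₀ + u) := by
    by_contra! hcon
    have h0 := hcon (x₀ i - y i)
    have h1 := hcon (x₀ i - y i + a)
    rw [add_assoc, hu, ← lp.single_add] at h0 h1
    rw [← add_sub_assoc, sub_add_cancel, sub_self, lp.single_zero, add_zero] at h0
    rw [← add_assoc, ← add_sub_assoc, sub_add_cancel, sub_self, zero_add] at h1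
    exact ha (h1.trans h0.symm)
  have hi : (y - (x₀ + u)) i = 0 := by
    change y i - (x₀ i + u i) = 0
    rw [hu, lp.single_apply_self, add_sub_cancel, sub_self]
  rcases hf.eq_or_eq_of_disjoint (EllOne.single_disjoint hi b) (x₀ + u) with h | h
  · exact absurd h.1 hb
  · simpa only [add_sub_cancel] using h.1

/-- A tree contains no nondegenerate rectangles, so that `f` cannot vary in two coordinates. -/
theorem eq_const_or_exists_single (hf : PreservesBetweenness f) (hc : Continuous f) :
    (∀ x, f x = f 0) ∨ ∃ i, ∀ x, f x = f (lp.single 1 i (x i)) := by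
  by_cases! h : ∀ x i a, f (x + lp.single 1 i a) = f x
  · exact .inl (EllOne.eq_of_forall_add_single hc h)
  · obtain ⟨x₀, i, a, ha⟩ := h
    refine .inr ⟨i, fun x => ?_⟩
    rw [hf.eq_of_single_ne ha x, hf.eq_of_single_ne ha (lp.single 1 i (x i)), lp.single_apply_self]

omit [DecidableEq N]

theorem aligned_of_ellOne (hf : PreservesBetweenness f) (hc : Continuous f) (x y w : EllOne N) :
    Aligned (f x) (f y) (f w) := by
  classical
  rcases hf.eq_const_or_exists_single hc with h | ⟨i, h⟩
  · simp [h x, h y, h w, Aligned]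
  · rw [h x, h y, h w]
    exact (hf.comp (.of_isometry (EllOne.isometry_single i))).aligned (aligned_real _ _ _)

theorem eq_const_or_exists_isometry (hf : PreservesBetweenness f) (hc : Continuous f)
    {Γ : Set (T ≃ᵢ T)} (hΓ : Dense {r | ∃ g ∈ Γ, ∀ x, g (f x) = f (r + x)}) :
    (∀ x, f x = f 0) ∨ ∃ l : ℝ → T, Isometry l ∧ Set.range f ⊆ Set.range l ∧
      Dense {s | ∃ g ∈ Γ, ∀ t, g (l t) = l (t + s)} := by
  classical
  rcases hf.eq_const_or_exists_single hc with h | ⟨i, h⟩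
  · exact .inl h
  have hsingle := EllOne.isometry_single i
  have hdense : Dense {s | ∃ g ∈ Γ, ∀ t : ℝ,
      g (f (lp.single 1 i t)) = f (lp.single 1 i (t + s))} := by
    refine ((EllOne.surjective_apply i).denseRange.dense_image
      (EllOne.continuous_apply i) hΓ).mono ?_
    rintro _ ⟨r, ⟨g, hgΓ, hg⟩, rfl⟩
    refine ⟨g, hgΓ, fun t => ?_⟩
    rw [hg, h, lp.coeFn_add, Pi.add_apply, lp.single_apply_self, add_comm]
  rcases (hf.comp (.of_isometry hsingle)).exists_isometry_of_dense
    (hc.comp hsingle.continuous) hdense with hconst | ⟨l, hl, hrange, hd⟩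
  · exact .inl fun x => by rw [h x, h 0, hconst, hconst ((0 : EllOne N) i)]
  · refine .inr ⟨l, hl, ?_, hd⟩
    rintro _ ⟨x, rfl⟩
    exact hrange ⟨x i, (h x).symm⟩

end EllOne

end PreservesBetweenness

theorem exists_isometryEquiv_of_range_eq {X Y Y' : Type*} [MetricSpace X] [MetricSpace Y]
    [MetricSpace Y'] {f : Y → X} {f' : Y' → X} (hf : Isometry f) (hf' : Isometry f')
    (h : Set.range f = Set.range f') : ∃ e : Y ≃ᵢ Y', ∀ y, f' (e y) = f y := by
  choose e he using fun y => h.subset (Set.mem_range_self y)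
  choose e' he' using fun y => h.superset (Set.mem_range_self y)
  exact ⟨.mk' e e' (fun y => hf'.injective (by rw [he, he']))
    (.of_dist_eq fun y y' => by rw [← hf'.dist_eq, he, he, hf.dist_eq]), he⟩

namespace StabiliserActsLike

variable {N X G : Type*} [MetricSpace X] [Group G] [MulAction G X] {F : Set X}
  {H K : AddSubgroup (EllOne N)}

theorem exists_image_eq (hH : StabiliserActsLike G F H) (hK : StabiliserActsLike G F K) :
    ∃ L : EllOne N ≃ₗᵢ[ℝ] EllOne N, L '' (H : Set (EllOne N)) = K := by
  obtain ⟨φ, ψ, hφ, hφF, hψ⟩ := hH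
  obtain ⟨φ', ψ', hφ', hφF', hψ'⟩ := hK
  obtain ⟨e, he⟩ := exists_isometryEquiv_of_range_eq hφ hφ' (hφF.trans hφF'.symm)
  have hL : ∀ g, e.toRealLinearIsometryEquiv ((ψ g).toAdd : EllOne N) = (ψ' g).toAdd := by
    intro g
    have h := hψ g 0
    rw [← he, ← he, hψ', add_zero] at h
    rw [IsometryEquiv.toRealLinearIsometryEquiv_apply, ← hφ'.injective h, add_sub_cancel_right]
  refine ⟨e.toRealLinearIsometryEquiv, Set.Subset.antisymm ?_ fun k hk => ?_⟩
  · rintro _ ⟨h, hh, rfl⟩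
    obtain ⟨g, hg⟩ := ψ.surjective (.ofAdd ⟨h, hh⟩)
    have hg' := hL g
    rw [hg] at hg'
    exact hg' ▸ (ψ' g).toAdd.2
  · obtain ⟨g, hg⟩ := ψ'.surjective (.ofAdd ⟨k, hk⟩)
    exact ⟨_, (ψ g).toAdd.2, (hL g).trans (by rw [hg]; rfl)⟩

theorem of_image_eq (hK : StabiliserActsLike G F K) {L : EllOne N ≃ₗᵢ[ℝ] EllOne N}
    (hL : L '' (H : Set (EllOne N)) = K) : StabiliserActsLike G F H := by
  obtain ⟨φ, ψ, hφ, hφF, hψ⟩ := hK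
  obtain rfl : H.map (L.toLinearEquiv.toAddEquiv : EllOne N →+ EllOne N) = K :=
    SetLike.coe_injective hL
  let e := L.toLinearEquiv.toAddEquiv.addSubgroupMap H
  refine ⟨φ ∘ L, ψ.trans (AddEquiv.toMultiplicative e.symm), hφ.comp L.isometry,
    (L.surjective.range_comp φ).trans hφF, fun g r => ?_⟩
  have hg : ((ψ g).toAdd : EllOne N) = L (e.symm (ψ g).toAdd) :=
    congrArg Subtype.val (e.apply_symm_apply (ψ g).toAdd).symm
  simp only [Function.comp_apply, hψ, hg, ← map_add]
  rfl

theorem iff_exists_image_eq (hK : StabiliserActsLike G F K) :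
    StabiliserActsLike G F H ↔
      ∃ L : EllOne N ≃ₗᵢ[ℝ] EllOne N, L '' (H : Set (EllOne N)) = K :=
  ⟨fun hH => hH.exists_image_eq hK, fun ⟨_, hL⟩ => hK.of_image_eq hL⟩

end StabiliserActsLike

/-! ### The group acting on a product of labelled trees -/

namespace LabelledTree

variable {T R A : Type} [MetricSpace T] [AddCommGroup R] {c : R →+ ℝ} [AddAction R A]
  (D : LabelledTree T R c A)

theorem range_line_eq {a : A} {x y : T} (hy : y ∈ Set.range (D.line a x)) :
    Set.range (D.line a y) = Set.range (D.line a x) := by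
  obtain ⟨s, rfl⟩ := hy
  simp only [funext (D.line_line a x s)]
  exact (add_left_surjective s).range_comp (D.line a x)

theorem line_h_sub_h {a : A} {x y : T} (hy : y ∈ Set.range (D.line a x)) :
    D.line a x (D.h y - D.h x) = y := by
  obtain ⟨s, rfl⟩ := hy
  rw [D.h_line, add_sub_cancel_left]

theorem label_eq_of_range_subset {a a' : A} {x x' : T}
    (h : Set.range (D.line a x) ⊆ Set.range (D.line a' x')) : a = a' := by
  have hx : x ∈ Set.range (D.line a' x') := h ⟨0, D.line_zero a x⟩
  rw [← D.range_line_eq hx] at h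
  refine D.line_inj (x := x) (funext fun u => ?_)
  rw [← D.line_h_sub_h (h ⟨u, rfl⟩), D.h_line, add_sub_cancel_left]

end LabelledTree

section Product

variable {N : Type} {T : N → Type} [∀ n, MetricSpace (T n)] {A : N → Type}
  [∀ n, AddAction (EllOne N) (A n)]
  (D : ∀ n, LabelledTree (T n) (EllOne N) (EllOne.coord n) (A n))

section HeightDiff

variable {z : ∀ n, T n}

/-- The family of the differences between the heights of the components of `y` and of `x`. -/
def heightDiff (x y : L1Product T z) : EllOne N :=
  .ofSummable (fun n => (D n).h (y.1 n) - (D n).h (x.1 n)) <|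
    .of_nonneg_of_le (fun _ => abs_nonneg _) (fun n => (D n).h_le _ _)
      (L1Product.summable_dist y x)

theorem heightDiff_apply (x y : L1Product T z) (n : N) :
    heightDiff D x y n = (D n).h (y.1 n) - (D n).h (x.1 n) := rfl

theorem heightDiff_self (x : L1Product T z) : heightDiff D x x = 0 :=
  EllOne.ext fun _ => sub_self _

end HeightDiff

variable (z : ∀ n, T n)

/-- The group of the families of isometries `gₙ` of the factors that preserve the `ℓ¹` product and
for which some `r : EllOne N` acts on the heights and labels of every factor as `gₙ` does. The
translation part `r` is recorded in the first component. -/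
def symGroup : Subgroup (Multiplicative (EllOne N) × ∀ n, T n ≃ᵢ T n) where
  carrier := {g | (∀ n, (D n).Sym g.1.toAdd (g.2 n)) ∧ Summable fun n => dist (g.2 n (z n)) (z n)}
  one_mem' := ⟨fun n => (D n).sym_one, by simp⟩
  mul_mem' {g _} hg hg' := ⟨fun n => (D n).sym_mul (hg.1 n) (hg'.1 n),
    L1Product.summable_of_summable (y := fun n => g.2 n (z n))
      (hg'.2.congr fun n => ((g.2 n).dist_eq _ _).symm) hg.2⟩
  inv_mem' {g} hg := ⟨fun n => (D n).sym_inv (hg.1 n), hg.2.congr fun n => by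
    rw [Prod.snd_inv, Pi.inv_apply, dist_comm, ← (g.2 n).dist_eq ((g.2 n)⁻¹ (z n)),
      IsometryEquiv.apply_inv_self]⟩

namespace symGroup

variable {D z}

/-- The translation part. -/
def trans (g : symGroup D z) : EllOne N := g.1.1.toAdd

theorem sym (g : symGroup D z) (n : N) : (D n).Sym (trans g) (g.1.2 n) := g.2.1 n

instance : MulAction (symGroup D z) (L1Product T z) where
  smul g x := ⟨fun n => g.1.2 n (x.1 n),
    L1Product.summable_of_summable (x.2.congr fun n => ((g.1.2 n).dist_eq _ _).symm) g.2.2⟩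
  one_smul _ := rfl
  mul_smul _ _ _ := rfl

theorem smul_apply (g : symGroup D z) (x : L1Product T z) (n : N) :
    (g • x).1 n = g.1.2 n (x.1 n) := rfl

theorem isometry_smul (g : symGroup D z) : Isometry fun x : L1Product T z => g • x :=
  .of_dist_eq fun _ _ => tsum_congr fun n => (g.1.2 n).dist_eq _ _

theorem heightDiff_smul (g : symGroup D z) (x : L1Product T z) :
    heightDiff D x (g • x) = trans g :=
  EllOne.ext fun n => by
    rw [heightDiff_apply, smul_apply, (D n).h_sym (sym g n), add_sub_cancel_left,
      EllOne.coord_apply]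

theorem eq_one_of_smul_eq (g : symGroup D z) (x : L1Product T z) (h : g • x = x) : g = 1 := by
  have htrans : trans g = 0 := by rw [← heightDiff_smul g x, h, heightDiff_self]
  refine Subtype.ext (Prod.ext htrans (funext fun n => ?_))
  exact (D n).free (htrans ▸ sym g n) (congrFun (congrArg Subtype.val h) n)

theorem exists_smul_eq (x y : L1Product T z) : ∃ g : symGroup D z, g • x = y := by
  have h n := (D n).exists_sym (r := heightDiff D x y) (x := x.1 n) (y := y.1 n) rfl
  choose g hg hgx using h
  refine ⟨⟨(.ofAdd (heightDiff D x y), g), hg, ?_⟩, Subtype.ext (funext hgx)⟩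
  refine L1Product.summable_of_summable (y := y.1)
    ((L1Product.summable_dist ⟨z, by simp⟩ x).congr fun n => ?_) y.2
  simp only [← hgx n, (g n).dist_eq]

end symGroup

open symGroup

/-! ### Labelled flats -/

section LabelledFlat

variable {z}

/-- The product of the lines with labels `a` through the components of `x`. -/
def labelledFlat (a : ∀ n, A n) (x : L1Product T z) (r : EllOne N) : L1Product T z :=
  ⟨fun n => (D n).line (a n) (x.1 n) (r n),
    L1Product.summable_of_summable (y := x.1) ((EllOne.summable_abs r).congr fun n => by
      conv_rhs => rw [← (D n).line_zero (a n) (x.1 n), (D n).line_line, zero_add,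
        ((D n).line_isometry _ _).dist_eq, Real.dist_eq, sub_zero]) x.2⟩

variable {a a' : ∀ n, A n} {x x' y : L1Product T z}

theorem labelledFlat_apply (a : ∀ n, A n) (x : L1Product T z) (r : EllOne N) (n : N) :
    (labelledFlat D a x r).1 n = (D n).line (a n) (x.1 n) (r n) := rfl

theorem isometry_labelledFlat (a : ∀ n, A n) (x : L1Product T z) :
    Isometry (labelledFlat D a x) :=
  .of_dist_eq fun r s => by
    rw [EllOne.dist_eq]
    exact tsum_congr fun n => ((D n).line_isometry _ _).dist_eq _ _

theorem labelledFlat_zero (a : ∀ n, A n) (x : L1Product T z) : labelledFlat D a x 0 = x :=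
  Subtype.ext (funext fun n => (D n).line_zero _ _)

theorem labelledFlat_labelledFlat (a : ∀ n, A n) (x : L1Product T z) (r s : EllOne N) :
    labelledFlat D a (labelledFlat D a x r) s = labelledFlat D a x (r + s) :=
  Subtype.ext (funext fun n => (D n).line_line _ _ _ _)

theorem heightDiff_labelledFlat (a : ∀ n, A n) (x y : L1Product T z) (r : EllOne N) :
    heightDiff D y (labelledFlat D a x r) = heightDiff D y x + r :=
  EllOne.ext fun n => by
    rw [heightDiff_apply, labelledFlat_apply, (D n).h_line, lp.coeFn_add, Pi.add_apply,
      heightDiff_apply, sub_add_eq_add_sub]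

theorem smul_labelledFlat (g : symGroup D z) (a : ∀ n, A n) (x : L1Product T z) (r : EllOne N) :
    g • labelledFlat D a x r = labelledFlat D (trans g +ᵥ a) (g • x) r :=
  Subtype.ext (funext fun n => (D n).sym_line (sym g n) _ _ _)

theorem mem_range_labelledFlat :
    y ∈ Set.range (labelledFlat D a x) ↔ ∀ n, y.1 n ∈ Set.range ((D n).line (a n) (x.1 n)) := by
  refine ⟨?_, fun h => ⟨heightDiff D x y, Subtype.ext (funext fun n => (D n).line_h_sub_h (h n))⟩⟩
  rintro ⟨r, rfl⟩ n
  exact ⟨r n, rfl⟩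

theorem exists_range_labelledFlat_apply_eq (a : ∀ n, A n) (x : L1Product T z) (n : N) (u : ℝ) :
    ∃ y ∈ Set.range (labelledFlat D a x), y.1 n = (D n).line (a n) (x.1 n) u := by
  obtain ⟨r, rfl⟩ := EllOne.surjective_apply n u
  exact ⟨_, ⟨r, rfl⟩, rfl⟩

theorem range_labelledFlat_eq_iff :
    Set.range (labelledFlat D a x) = Set.range (labelledFlat D a' x') ↔
      a = a' ∧ x ∈ Set.range (labelledFlat D a' x') := by
  refine ⟨fun h => ⟨funext fun n => ?_, h ▸ ⟨0, labelledFlat_zero D a x⟩⟩, ?_⟩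
  · refine (D n).label_eq_of_range_subset (x := x.1 n) (x' := x'.1 n) ?_
    rintro _ ⟨u, rfl⟩
    obtain ⟨y, hy, hyu⟩ := exists_range_labelledFlat_apply_eq D a x n u
    exact hyu ▸ (mem_range_labelledFlat D).1 (h ▸ hy) n
  · rintro ⟨rfl, hx⟩
    ext y
    simp only [mem_range_labelledFlat, (D _).range_line_eq ((mem_range_labelledFlat D).1 hx _)]

theorem isMaximalFlat_labelledFlat [∀ n, GeodesicTree (T n)] (a : ∀ n, A n) (x : L1Product T z) :
    IsMaximalFlat N (Set.range (labelledFlat D a x)) := by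
  refine ⟨⟨_, isometry_labelledFlat D a x, rfl⟩, ?_⟩
  rintro _ ⟨φ, hφ, rfl⟩ hle _ ⟨r, rfl⟩
  refine (mem_range_labelledFlat D).2 fun n =>
    mem_range_of_aligned ((D n).line_isometry _ _) fun s t => ?_
  have hmem : ∀ u, ∃ r', (φ r').1 n = (D n).line (a n) (x.1 n) u := fun u => by
    obtain ⟨y, hy, hyu⟩ := exists_range_labelledFlat_apply_eq D a x n u
    obtain ⟨r', rfl⟩ := hle hy
    exact ⟨r', hyu⟩
  obtain ⟨r₁, h₁⟩ := hmem s
  obtain ⟨r₂, h₂⟩ := hmem t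
  rw [← h₁, ← h₂]
  exact ((L1Product.preservesBetweenness_apply n).comp (.of_isometry hφ)).aligned_of_ellOne
    ((L1Product.continuous_apply n).comp hφ.continuous) r₁ r r₂

theorem exists_eq_range_labelledFlat [∀ n, GeodesicTree (T n)] [∀ n, Nonempty (A n)]
    {F : Set (L1Product T z)} (hF : IsMaximalFlat N F) {H : AddSubgroup (EllOne N)}
    (hH : Dense (H : Set (EllOne N))) (hact : StabiliserActsLike (symGroup D z) F H) :
    ∃ (a : ∀ n, A n) (x : L1Product T z), F = Set.range (labelledFlat D a x) := by
  obtain ⟨φ, ψ, hφ, rfl, hψ⟩ := hact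
  have hline : ∀ n, ∃ a p, ∀ r, (φ r).1 n ∈ Set.range ((D n).line a p) := by
    intro n
    have hdense : Dense {r | ∃ g ∈ {g | ∃ s, (D n).Sym s g},
        ∀ r', g ((φ r').1 n) = (φ (r + r')).1 n} := by
      refine hH.mono fun h hh => ?_
      obtain ⟨g, hg⟩ := ψ.surjective (.ofAdd ⟨h, hh⟩)
      refine ⟨g.1.1.2 n, ⟨_, sym g.1 n⟩, fun r' => ?_⟩
      have := hψ g r'
      rw [hg] at this
      exact congrFun (congrArg Subtype.val this) n
    rcases ((L1Product.preservesBetweenness_apply n).comp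
      (.of_isometry hφ)).eq_const_or_exists_isometry
      ((L1Product.continuous_apply n).comp hφ.continuous) hdense with hconst | ⟨l, hl, hsub, hl'⟩
    · exact ⟨Classical.arbitrary _, (φ 0).1 n, fun r => ⟨0, by rw [(D n).line_zero, hconst r]⟩⟩
    · obtain ⟨a, p, hap⟩ := (D n).eq_line l hl <| hl'.mono <| by
        rintro s ⟨g, ⟨r, hr⟩, hgl⟩
        exact ⟨r, g, hr, hgl⟩
      exact ⟨a, p, fun r => hap ▸ hsub ⟨r, rfl⟩⟩
  choose a p hap using hline
  refine ⟨a, φ 0, hF.eq_of_subset ⟨_, isometry_labelledFlat D a _, rfl⟩ ?_⟩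
  rintro _ ⟨r, rfl⟩
  refine (mem_range_labelledFlat D).2 fun n => ?_
  rw [(D n).range_line_eq (hap n 0)]
  exact hap n r

theorem smul_range_labelledFlat_eq_iff {g : symGroup D z} :
    g • Set.range (labelledFlat D a x) = Set.range (labelledFlat D a' x') ↔
      trans g +ᵥ a = a' ∧ g • x ∈ Set.range (labelledFlat D a' x') := by
  rw [← range_labelledFlat_eq_iff, ← Set.image_smul, ← Set.range_comp]
  simp only [Function.comp_def, smul_labelledFlat]

theorem exists_trans_eq_smul_mem_range (a : ∀ n, A n) (x x' : L1Product T z) (r : EllOne N) :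
    ∃ g : symGroup D z, trans g = r ∧ g • x ∈ Set.range (labelledFlat D a x') := by
  obtain ⟨g, hg⟩ := exists_smul_eq (D := D) x (labelledFlat D a x' (-heightDiff D x x' + r))
  exact ⟨g, by rw [← heightDiff_smul g x, hg, heightDiff_labelledFlat, add_neg_cancel_left],
    hg ▸ ⟨_, rfl⟩⟩

theorem orbit_range_labelledFlat_eq_iff :
    MulAction.orbit (symGroup D z) (Set.range (labelledFlat D a x)) =
        MulAction.orbit (symGroup D z) (Set.range (labelledFlat D a' x')) ↔
      a ∈ AddAction.orbit (EllOne N) a' := by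
  rw [MulAction.orbit_eq_iff]
  constructor
  · rintro ⟨g, hg⟩
    exact ⟨_, ((smul_range_labelledFlat_eq_iff D).1 hg).1⟩
  · rintro ⟨r, rfl⟩
    obtain ⟨g, rfl, hg⟩ := exists_trans_eq_smul_mem_range D (r +ᵥ a') x' x r
    exact ⟨g, (smul_range_labelledFlat_eq_iff D).2 ⟨rfl, hg⟩⟩

theorem stabiliserActsLike_labelledFlat (a : ∀ n, A n) (x : L1Product T z) :
    StabiliserActsLike (symGroup D z) (Set.range (labelledFlat D a x))
      (AddAction.stabilizer (EllOne N) a) := by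
  have hmem (g : MulAction.stabilizer (symGroup D z) (Set.range (labelledFlat D a x))) :=
    (smul_range_labelledFlat_eq_iff D).1 g.2
  let ψ : MulAction.stabilizer (symGroup D z) (Set.range (labelledFlat D a x)) →*
      Multiplicative (AddAction.stabilizer (EllOne N) a) :=
    .mk' (fun g => .ofAdd ⟨trans g.1, (hmem g).1⟩) fun _ _ => rfl
  have hsmul (g : MulAction.stabilizer (symGroup D z) (Set.range (labelledFlat D a x))) :
      (g : symGroup D z) • x = labelledFlat D a x (trans g.1) := by
    obtain ⟨s, hs⟩ := (hmem g).2
    rw [← heightDiff_smul g.1 x, ← hs, heightDiff_labelledFlat, heightDiff_self, zero_add]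
  have hψ : Function.Bijective ψ := by
    refine ⟨(injective_iff_map_eq_one ψ).2 fun g hg => ?_, fun r => ?_⟩
    · have htrans : trans g.1 = 0 := congrArg Subtype.val hg
      refine Subtype.ext (eq_one_of_smul_eq g.1 x ?_)
      rw [hsmul, htrans, labelledFlat_zero]
    · obtain ⟨g, hg, hgx⟩ := exists_trans_eq_smul_mem_range D a x x (r.toAdd : EllOne N)
      exact ⟨⟨g, (smul_range_labelledFlat_eq_iff D).2 ⟨hg ▸ r.toAdd.2, hgx⟩⟩, Subtype.ext hg⟩
  refine ⟨_, .ofBijective ψ hψ, isometry_labelledFlat D a x, rfl, fun g r => ?_⟩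
  rw [smul_labelledFlat, (hmem g).1, hsmul, labelledFlat_labelledFlat]
  rfl

end LabelledFlat

end Product

/-! ### Labels with prescribed stabilisers -/

/-- The points `lab c` represent all the orbits with a nontrivial stabiliser, once each, and the
stabiliser of `lab c` is `K c`. (An orbit with `K c = ⊥` may be represented too.) -/
structure IsOrbitSystem {C R A : Type*} [AddCommGroup R] [AddAction R A] (K : C → AddSubgroup R)
    (lab : C → A) : Prop where
  stabilizer_eq : ∀ c, AddAction.stabilizer R (lab c) = K c
  exists_mem_orbit : ∀ a, AddAction.stabilizer R a ≠ ⊥ → ∃ c, a ∈ AddAction.orbit R (lab c)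
  eq_of_mem_orbit : ∀ {c c'}, lab c' ∈ AddAction.orbit R (lab c) → c' = c

theorem mk_sigma_le_continuum {C : Type} {X : C → Type} (hC : #C ≤ 𝔠) (hX : ∀ c, #(X c) ≤ 𝔠) :
    #(Σ c, X c) ≤ 𝔠 := by
  rw [mk_sigma]
  refine (sum_le_sum _ (fun _ => 𝔠) hX).trans ?_
  rw [sum_const']
  exact mul_le_of_le aleph0_le_continuum hC le_rfl

instance punitAddAction {M : Type*} [AddMonoid M] : AddAction M PUnit where
  zero_vadd _ := rfl
  add_vadd _ _ _ := rfl

namespace IsOrbitSystem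

variable {C R : Type} [AddCommGroup R] {K : C → AddSubgroup R}

theorem exists_mk_eq_continuum (hR : #R = 𝔠) (hC : #C ≤ 𝔠) (K : C → AddSubgroup R) :
    ∃ (A : Type) (_ : AddAction R A) (lab : C → A), #A = 𝔠 ∧ IsOrbitSystem K lab := by
  have hstab (x : Σ c, R ⧸ K c) (r : R) : r +ᵥ x = x ↔ r +ᵥ x.2 = x.2 := by
    rcases x with ⟨c, q⟩
    simp
  refine ⟨(Σ c, R ⧸ K c) ⊕ R, inferInstance, fun c => .inl ⟨c, (0 : R)⟩, ?_, ?_, ?_, ?_⟩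
  · rw [mk_sum, lift_id, lift_id, hR]
    refine add_eq_right aleph0_le_continuum (mk_sigma_le_continuum hC fun c => ?_)
    exact (mk_le_of_surjective QuotientAddGroup.mk_surjective).trans hR.le
  · intro c
    ext r
    rw [AddAction.mem_stabilizer_iff, Sum.vadd_inl, Sum.inl_injective.eq_iff, hstab,
      ← AddAction.mem_stabilizer_iff, AddAction.stabilizer_quotient]
  · rintro (⟨c, q⟩ | s) ha
    · obtain ⟨r, rfl⟩ := QuotientAddGroup.mk_surjective q
      exact ⟨c, r, congrArg (fun s : R => Sum.inl (⟨c, s⟩ : Σ c, R ⧸ K c)) (add_zero r)⟩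
    · refine absurd ((AddSubgroup.eq_bot_iff_forall _).2 fun r hr => ?_) ha
      simpa using hr
  · rintro c c' ⟨r, hr⟩
    exact (congrArg Sigma.fst (Sum.inl_injective hr)).symm

theorem punit : IsOrbitSystem (fun _ : Unit => (⊤ : AddSubgroup R)) fun _ => () where
  stabilizer_eq _ := by
    ext r
    simp
  exists_mem_orbit _ _ := ⟨(), 0, rfl⟩
  eq_of_mem_orbit _ := rfl

/-- In all factors but `n₀`, the stabiliser of a label is trivial unless it is the whole group. -/
theorem pi {N : Type} {A : N → Type} [∀ n, AddAction R (A n)] {lab : C → ∀ n, A n} {n₀ : N}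
    (h₀ : IsOrbitSystem K fun c => lab c n₀)
    (h : ∀ n ≠ n₀, ∀ c, IsOrbitSystem (fun _ : Unit => (⊤ : AddSubgroup R)) fun _ => lab c n) :
    IsOrbitSystem K lab := by
  have hfix : ∀ n ≠ n₀, ∀ c (r : R), r +ᵥ lab c n = lab c n := fun n hn c r =>
    AddAction.mem_stabilizer_iff.1 ((h n hn c).stabilizer_eq () ▸ AddSubgroup.mem_top r)
  refine ⟨fun c => ?_, fun a ha => ?_, ?_⟩
  · rw [← h₀.stabilizer_eq c]
    ext r
    refine ⟨fun hr => congrFun hr n₀, fun hr => funext fun n => ?_⟩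
    rcases eq_or_ne n n₀ with rfl | hn
    · exact hr
    · exact hfix n hn c r
  · have ha' : ∀ n, AddAction.stabilizer R (a n) ≠ ⊥ := fun n hn =>
      ha (eq_bot_iff.2 (hn ▸ fun r hr => congrFun hr n))
    obtain ⟨c, r, hr⟩ := h₀.exists_mem_orbit _ (ha' n₀)
    refine ⟨c, r, funext fun n => ?_⟩
    rcases eq_or_ne n n₀ with rfl | hn
    · exact hr
    · obtain ⟨-, s, hs⟩ := (h n hn c).exists_mem_orbit _ (ha' n)
      exact (hfix n hn c r).trans ((hfix n hn c s).symm.trans hs)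
  · rintro c c' ⟨r, hr⟩
    exact h₀.eq_of_mem_orbit ⟨r, congrFun hr n₀⟩

end IsOrbitSystem

theorem IsUniversalRealTree.exists_labelledTree {T R C : Type} [MetricSpace T]
    (hT : IsUniversalRealTree T 𝔠) [AddCommGroup R] (hR : #R = 𝔠) (c : R →+ ℝ) (hC : #C ≤ 𝔠)
    (K : C → AddSubgroup R) :
    ∃ (A : Type) (_ : AddAction R A) (_ : Nonempty A) (_ : LabelledTree T R c A) (lab : C → A),
      IsOrbitSystem K lab := by
  obtain ⟨A, _, lab, hA, hlab⟩ := IsOrbitSystem.exists_mk_eq_continuum hR hC K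
  obtain ⟨D⟩ := hT.nonempty_labelledTree c hA
  exact ⟨A, _, mk_ne_zero_iff.1 (hA ▸ continuum_ne_zero), D, lab, hlab⟩

namespace EllOne

variable {N : Type}

theorem mk_eq_continuum [Countable N] [Nonempty N] : #(EllOne N) = 𝔠 := by
  refine le_antisymm ?_ ?_
  · have hinj : Function.Injective fun (r : EllOne N) (n : N) => r n :=
      fun r s h => EllOne.ext (congrFun h)
    calc #(EllOne N) ≤ #(N → ℝ) := mk_le_of_injective hinj
      _ = 𝔠 ^ #N := by simp [Cardinal.mk_real]
      _ ≤ 𝔠 ^ ℵ₀ := power_le_power_left continuum_ne_zero (mk_le_aleph0_iff.2 inferInstance)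
      _ = 𝔠 := continuum_power_aleph0
  · rw [← Cardinal.mk_real]
    exact mk_le_of_surjective (surjective_apply (Classical.arbitrary N))

theorem ne_bot_of_dense [Nonempty N] {H : AddSubgroup (EllOne N)}
    (hH : Dense (H : Set (EllOne N))) : H ≠ ⊥ := by
  rintro rfl
  have := (surjective_apply (Classical.arbitrary N)).nontrivial
  obtain ⟨r, hr⟩ := exists_ne (0 : EllOne N)
  rw [AddSubgroup.coe_bot, dense_iff_closure_eq, closure_singleton] at hH
  exact hr (hH.symm.subset (Set.mem_univ r))

end EllOne

section Counting

variable {N : Type} {T : N → Type} [∀ n, MetricSpace (T n)] {z : ∀ n, T n}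

theorem exists_labelledTrees [Countable N] {n₀ : N} (hn₀ : IsUniversalRealTree (T n₀) 𝔠)
    (hT : ∀ n, IsUniversalRealTree (T n) 𝔠 ∨ Nonempty (T n ≃ᵢ ℝ)) {C : Type} (hC : #C ≤ 𝔠)
    (K : C → AddSubgroup (EllOne N)) :
    ∃ (A : N → Type) (_ : ∀ n, AddAction (EllOne N) (A n)) (_ : ∀ n, Nonempty (A n))
      (_ : ∀ n, LabelledTree (T n) (EllOne N) (EllOne.coord n) (A n)) (lab : C → ∀ n, A n),
      IsOrbitSystem K lab := by
  have : Nonempty N := ⟨n₀⟩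
  have hfactor : ∀ n, ∃ (A : Type) (_ : AddAction (EllOne N) A) (_ : Nonempty A)
      (_ : LabelledTree (T n) (EllOne N) (EllOne.coord n) A) (lab : C → A),
      (n = n₀ → IsOrbitSystem K lab) ∧
      (n ≠ n₀ → ∀ c, IsOrbitSystem (fun _ : Unit => (⊤ : AddSubgroup (EllOne N)))
        fun _ => lab c) := by
    intro n
    rcases eq_or_ne n n₀ with rfl | hn
    · obtain ⟨A, _, _, D, lab, h⟩ := hn₀.exists_labelledTree EllOne.mk_eq_continuum
        (EllOne.coord n) hC K
      exact ⟨A, _, ‹_›, D, lab, fun _ => h, absurd rfl⟩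
    rcases hT n with hT | ⟨⟨e⟩⟩
    · obtain ⟨A, _, _, D, lab, h⟩ := hT.exists_labelledTree EllOne.mk_eq_continuum
        (EllOne.coord n) ((mk_le_aleph0 (α := Unit)).trans aleph0_le_continuum) fun _ => ⊤
      exact ⟨A, _, ‹_›, D, fun _ => lab (), fun h => absurd h hn, fun _ _ => h⟩
    · exact ⟨Unit, inferInstance, inferInstance, realLineLabelledTree e _, fun _ => (),
        fun h => absurd h hn, fun _ _ => .punit⟩
  choose A _ _ D lab h₀ h using hfactor
  exact ⟨A, _, ‹_›, D, fun c n => lab n c, .pi (h₀ n₀ rfl) h⟩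

theorem mk_flatOrbits [Nonempty N] [∀ n, GeodesicTree (T n)] {A : N → Type}
    [∀ n, AddAction (EllOne N) (A n)] [∀ n, Nonempty (A n)]
    (D : ∀ n, LabelledTree (T n) (EllOne N) (EllOne.coord n) (A n)) {C : Type}
    {K : C → AddSubgroup (EllOne N)} {lab : C → ∀ n, A n} (hlab : IsOrbitSystem K lab)
    {H : AddSubgroup (EllOne N)} (hH : Dense (H : Set (EllOne N))) :
    #(flatOrbits (symGroup D z) (L1Product T z) H) =
      #{c : C // ∃ L : EllOne N ≃ₗᵢ[ℝ] EllOne N, L '' (H : Set (EllOne N)) = K c} := by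
  let x₀ : L1Product T z := ⟨z, by simp⟩
  have hact (a : ∀ n, A n) (x : L1Product T z) :=
    (stabiliserActsLike_labelledFlat D a x).iff_exists_image_eq (H := H)
  refine (mk_congr (Equiv.ofBijective (fun c => ⟨MulAction.orbit (symGroup D z)
    (Set.range (labelledFlat D (lab c.1) x₀)), _, isMaximalFlat_labelledFlat D _ _,
      (hact _ _).2 (hlab.stabilizer_eq c.1 ▸ c.2), rfl⟩) ⟨fun c c' h => ?_, ?_⟩)).symm
  · exact Subtype.ext (hlab.eq_of_mem_orbit
      ((orbit_range_labelledFlat_eq_iff D).1 (congrArg Subtype.val h)))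
  · rintro ⟨O, F, hF, hFH, rfl⟩
    obtain ⟨a, x, rfl⟩ := exists_eq_range_labelledFlat D hF hH hFH
    obtain ⟨L, hL⟩ := (hact a x).1 hFH
    have hdense : Dense (AddAction.stabilizer (EllOne N) a : Set (EllOne N)) :=
      hL ▸ L.surjective.denseRange.dense_image L.continuous hH
    obtain ⟨c, hc⟩ := hlab.exists_mem_orbit a (EllOne.ne_bot_of_dense hdense)
    refine ⟨⟨c, L, ?_⟩, Subtype.ext ((orbit_range_labelledFlat_eq_iff D).2
      (AddAction.mem_orbit_symm.1 hc))⟩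
    obtain ⟨r, rfl⟩ := hc
    rw [hL, ← hlab.stabilizer_eq c, AddAction.stabilizer_vadd_eq_right]

theorem exists_subgroups_of_multiplicity (ι : DenseSubgroupClass N → Cardinal.{0})
    (hι : #{q // ι q ≠ 0} ≤ 𝔠) (hι' : ∀ q, ι q ≤ 𝔠) :
    ∃ (C : Type) (K : C → AddSubgroup (EllOne N)), #C ≤ 𝔠 ∧ ∀ H : DenseSubgroup N,
      #{c // ∃ L : EllOne N ≃ₗᵢ[ℝ] EllOne N, L '' (H.1 : Set (EllOne N)) = K c} = ι ⟦H⟧ := by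
  refine ⟨Σ q, (ι q).out, fun c => c.1.out.1, ?_, fun H => ?_⟩
  · have hne : ∀ q, (ι q).out → ι q ≠ 0 := fun q x h => by
      rw [← mk_out (ι q), mk_eq_zero_iff] at h
      exact h.false x
    refine (mk_le_of_injective (β := Σ q : {q // ι q ≠ 0}, (ι q).out)
      (f := fun c => ⟨⟨c.1, hne c.1 c.2⟩, c.2⟩) ?_).trans
      (mk_sigma_le_continuum hι fun q => (mk_out _).trans_le (hι' q))
    rintro ⟨q, x⟩ ⟨q', x'⟩ h
    simpa using h
  · calc #{c : Σ q, (ι q).out // ∃ L : EllOne N ≃ₗᵢ[ℝ] EllOne N,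
          L '' (H.1 : Set (EllOne N)) = c.1.out.1}
        = #{c : Σ q, (ι q).out // c.1 = ⟦H⟧} := mk_congr (Equiv.subtypeEquivRight fun c =>
          (Quotient.mk_eq_iff_out (x := H) (y := c.1)).symm.trans eq_comm)
      _ = #(ι ⟦H⟧).out := mk_congr (Equiv.sigmaSubtype _)
      _ = ι ⟦H⟧ := mk_out _

end Counting

theorem theoremD {N : Type} [Countable N]
    (ι : DenseSubgroupClass N → Set.Iic (𝔠 : Cardinal.{0}))
    (hι : #{c : DenseSubgroupClass N // (ι c : Cardinal.{0}) ≠ 0} ≤ 𝔠)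
    (η : N → Fin 2) (hη : ∃ n, η n = 1)
    (T : N → Type) [∀ n, MetricSpace (T n)]
    (hT₁ : ∀ n, η n = 1 → IsUniversalRealTree (T n) 𝔠)
    (hT₀ : ∀ n, η n = 0 → Nonempty (T n ≃ᵢ ℝ)) :
    ∃ (z : ∀ n, T n) (G : Type) (_ : Group G) (_ : MulAction G (L1Product T z)),
      (∀ g : G, Isometry fun x : L1Product T z => g • x) ∧
      (∀ (g : G) (x : L1Product T z), g • x = x → g = 1) ∧
      (∀ x y : L1Product T z, ∃ g : G, g • x = y) ∧
      ∀ H : DenseSubgroup N,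
        #(flatOrbits G (L1Product T z) H.1) = (ι (Quotient.mk _ H) : Cardinal.{0}) := by
  obtain ⟨n₀, hn₀⟩ := hη
  have : Nonempty N := ⟨n₀⟩
  have hT (n : N) : IsUniversalRealTree (T n) 𝔠 ∨ Nonempty (T n ≃ᵢ ℝ) :=
    (Fin.exists_fin_two.1 ⟨η n, rfl⟩).symm.imp (hT₁ n) (hT₀ n)
  have (n : N) : GeodesicTree (T n) :=
    (hT n).elim (fun h => h.isRealTree.geodesicTree) fun ⟨e⟩ => .of_isometryEquiv e
  have (n : N) : Nonempty (T n) := (hT n).elim (·.nonempty) fun ⟨e⟩ => ⟨e.symm 0⟩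
  obtain ⟨C, K, hC, hK⟩ := exists_subgroups_of_multiplicity (fun q => (ι q : Cardinal)) hι
    fun q => (ι q).2
  obtain ⟨A, _, _, D, lab, hlab⟩ := exists_labelledTrees (hT₁ n₀ hn₀) hT hC K
  exact ⟨fun n => Classical.arbitrary (T n), symGroup D _, inferInstance, inferInstance,
    symGroup.isometry_smul, symGroup.eq_one_of_smul_eq, symGroup.exists_smul_eq,
    fun H => (mk_flatOrbits D hlab H.2).trans (hK H)⟩
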